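/- Let $d\in\mathbb N$ and let $(M_p)_{p\in\mathbb N}$ be a sequence of positive numbers with $M_0=1$ such that $(M.1)$ $M_p^2\le M_{p-1}M_{p+1}$ for $p\ge 1$; $(M.2)$ $M_{p+q}\le AH^{p+q}M_pM_q$ for all $p,q\in\mathbb N$ and some $A,H\ge 1$; $(M.3)'$ $\sum_{p\ge1}M_{p-1}/M_p<\infty$. Put $M(t)=\sup_p\log(t^p/M_p)$ for $t>0$, and for compact $K\subset\mathbb R^d$, $h>0$ and $\phi$ smooth near $K$ put $$\|\phi\|_{K,h}=\sup_{x\in K,\ \alpha\in\mathbb N^d}\frac{|\partial^\alpha\phi(x)|}{h^{|\alpha|}M_{|\alpha|}}\in[0,\infty].$$ Let $*$ be $(M_p)$ (Beurling case) or $\{M_p\}$ (Roumieu case). For $\Omega\subseteq\mathbb R^d$ open, $\mathcal E^{*}(\Omega)$ is the set of $\phi\in C^\infty(\Omega)$ (complex valued) such that for every compact $K\subset\Omega$ one has $\|\phi\|_{K,h}<\infty$ for all $h>0$ (resp. for some $h>0$). Let $\mathcal E^{*}_{\mathcal M}(\Omega)$ be the set of nets $(f_\varepsilon)_{\varepsilon\in(0,1]}$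 in $\mathcal E^*(\Omega)$ such that, as $\varepsilon\to0^+$, $$\forall K\ \forall h>0\ \exists k>0:\ \|f_\varepsilon\|_{K,h}=O(e^{M(k/\varepsilon)})\qquad(\text{resp. } \forall K\ \forall k>0\ \exists h>0:\ \|f_\varepsilon\|_{K,h}=O(e^{M(k/\varepsilon)})),$$ and let $\mathcal E^{*}_{\mathcal N}(\Omega)$ be the set of those with $$\forall K\ \forall h>0\ \forall k>0:\ \|f_\varepsilon\|_{K,h}=O(e^{-M(k/\varepsilon)})\qquad(\text{resp. } \forall K\ \exists k>0\ \exists h>0:\ \|f_\varepsilon\|_{K,h}=O(e^{-M(k/\varepsilon)})),$$ where $K$ runs over the compact subsets of $\Omega$. Then $\mathcal E^*_{\mathcal M}(\Omega)$ is an algebra with the pointwise operations, $\mathcal E^*_{\mathcal N}(\Omega)$ is an ideal in it, and we set $\mathcal G^*(\Omega)=\mathcal E^*_{\mathcal M}(\Omega)/\mathcal E^*_{\mathcal N}(\Omega)$, with restriction maps $[(f_\varepsilon)]\mapsto[(f_\varepsilon|_{\Omega'})]$ for $\Omega'\subseteq\Omega$. In both cases the following hold. 1. $\Omega\mapsto\mathcal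 G^*(\Omega)$ is a sheaf of commutative $\mathbb C$-algebras on $\mathbb R^d$, and it is a sheaf of differential algebras: $\partial_j[(f_\varepsilon)]=[(\partial_jf_\varepsilon)]$, $j=1,\dots,d$, are well-defined, pairwise commuting $\mathbb C$-linear derivations of each $\mathcal G^*(\Omega)$, and they commute with restrictions. 2. For every open $\Omega\subseteq\mathbb R^d$ the sheaf $\mathcal G^*$ on $\Omega$ is fine: for every locally finite open covering $(U_i)_i$ of $\Omega$ there are endomorphisms $\varphi_i$ of the sheaf of $\mathbb C$-vector spaces $\mathcal G^*|_\Omega$ such that the closure in $\Omega$ of $\{x:(\varphi_i)_x\ne0\}$ is contained in $U_i$, and $\sum_i\varphi_i=\mathrm{id}$ on stalks. It is also supple: for every open $V\subseteq\Omega$ and all relatively closed $Z_1,Z_2\subseteq V$, each $f\in\mathcal G^*(V)$ with $\operatorname{supp}f\subseteq Z_1\cup Z_2$ can be written as $f=f_1+f_2$ with $f_j\in\mathcal G^*(V)$ and $\operatorname{supp}f_j\subseteq Z_j$. 3. Let $P(D)=\sum_{\alpha\in\mathbb N^d}a_\alpha D^\alpha$, $D^\alpha=(-i\partial)^\alpha$,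 be a $*$-ultradifferential operator, that is, $a_\alpha\in\mathbb C$ and $|a_\alpha|\le CL^{|\alpha|}/M_{|\alpha|}$ for all $\alpha$, for some $L,C>0$ (resp. for every $L>0$ with some $C=C_L>0$). Then for every $(f_\varepsilon)\in\mathcal E^*_{\mathcal M}(\Omega)$ the series $P(D)f_\varepsilon=\sum_\alpha a_\alpha D^\alpha f_\varepsilon$ converges absolutely at each point of $\Omega$, the net $(P(D)f_\varepsilon)$ is in $\mathcal E^*_{\mathcal M}(\Omega)$, and $[(f_\varepsilon)]\mapsto[(P(D)f_\varepsilon)]$ is a well-defined morphism of sheaves of $\mathbb C$-vector spaces $\mathcal G^*\to\mathcal G^*$. Moreover, if $d\ge1$, then for every nonempty open $\Omega\subseteq\mathbb R^d$ the sheaf $\mathcal G^{(M_p)}$ on $\Omega$ is not flabby, i.e. not all restriction maps between its spaces of sections over open subsets of $\Omega$ are surjective. -/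

import Mathlib

open TopologicalSpace CategoryTheory Opposite
open scoped ContDiff ENNReal

namespace UltraGen

noncomputable section

/-! ### Weight sequences -/

/-- A positive weight sequence `(M_p)` with `M_0 = 1` satisfying the conditions
`(M.1)` (logarithmic convexity), `(M.2)` (stability under ultradifferential operators) and
`(M.3)'` (non-quasianalyticity). -/
structure WeightSequence where
  M : ℕ → ℝ
  pos : ∀ p, 0 < M p
  zero : M 0 = 1
  m1 : ∀ p, M (p + 1) ^ 2 ≤ M p * M (p + 2)
  m2 : ∃ A H : ℝ, 1 ≤ A ∧ 1 ≤ H ∧ ∀ p q, M (p + q) ≤ A * H ^ (p + q) * M p * M q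
  m3 : Summable fun p => M p / M (p + 1)

/-- The associated function `M(t) = sup_p log (t ^ p / M_p)` (used only for `t > 0`, where the
supremum is finite, see `bddAbove_assoc`). -/
def WeightSequence.assoc (W : WeightSequence) (t : ℝ) : ℝ :=
  ⨆ p : ℕ, Real.log (t ^ p / W.M p)

/-- The two classes: Beurling type `(M_p)` and Roumieu type `{M_p}`. -/
inductive UltraType
  | beurling
  | roumieu

/-! ### Ultradifferentiable functions

Functions on an open set `Ω ⊆ ℝ^d` are represented by functions on `ℝ^d` whose values outside `Ω`
are irrelevant; all conditions below only involve points of `Ω`. -/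

/-- `ℝ^d`. -/
abbrev E (d : ℕ) := EuclideanSpace ℝ (Fin d)

variable {d : ℕ}

/-- The partial derivative `∂_i f`. -/
def pderiv (i : Fin d) (f : E d → ℂ) : E d → ℂ :=
  fun x => fderiv ℝ f x (EuclideanSpace.single i 1)

/-- The partial derivative `∂^α f = ∂_0 ^ α_0 ⋯ ∂_{d-1} ^ α_{d-1} f` for a multi-index `α`. -/
def mderiv (α : Fin d → ℕ) (f : E d → ℂ) : E d → ℂ :=
  (List.finRange d).foldr (fun i g => (pderiv i)^[α i] g) f

/-- The length `|α|` of a multi-index. -/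
def order (α : Fin d → ℕ) : ℕ := ∑ i, α i

/-- The (extended) seminorm
`sup_{x ∈ K, α} |∂^α f (x)| / (h ^ |α| M_{|α|})`. -/
def ultraNorm (W : WeightSequence) (K : Set (E d)) (h : ℝ) (f : E d → ℂ) : ℝ≥0∞ :=
  ⨆ x ∈ K, ⨆ α : Fin d → ℕ, ENNReal.ofReal (‖mderiv α f x‖ / (h ^ order α * W.M (order α)))

/-- `f` is an ultradifferentiable function of class `*` on `Ω`, that is, `f ∈ ℰ^*(Ω)`. -/
def IsUltradiff (W : WeightSequence) (s : UltraType) (Ω : Opens (E d)) (f : E d → ℂ) : Prop :=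
  ContDiffOn ℝ ∞ f Ω ∧
  match s with
  | .beurling => ∀ K : Set (E d), IsCompact K → K ⊆ Ω → ∀ h > 0, ultraNorm W K h f < ⊤
  | .roumieu => ∀ K : Set (E d), IsCompact K → K ⊆ Ω → ∃ h > 0, ultraNorm W K h f < ⊤

/-! ### Moderate and negligible nets -/

/-- Nets `(f_ε)` of functions indexed by `ε ∈ (0, 1]`. -/
abbrev Net (d : ℕ) := Set.Ioc (0 : ℝ) 1 → E d → ℂ

/-- `N(ε) = O(g(ε))` as `ε → 0⁺`. -/
def IsBigOZero (N : Set.Ioc (0 : ℝ) 1 → ℝ≥0∞) (g : ℝ → ℝ) : Prop :=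
  ∃ C > 0, ∃ ε₀ > 0, ∀ ε : Set.Ioc (0 : ℝ) 1, (ε : ℝ) < ε₀ → N ε ≤ ENNReal.ofReal (C * g ε)

/-- The net `(f_ε)` belongs to the space of `*`-moderate nets on `Ω`. -/
def IsModerate (W : WeightSequence) (s : UltraType) (Ω : Opens (E d)) (f : Net d) : Prop :=
  (∀ ε, IsUltradiff W s Ω (f ε)) ∧
  match s with
  | .beurling => ∀ K : Set (E d), IsCompact K → K ⊆ Ω → ∀ h > 0, ∃ k > 0,
      IsBigOZero (fun ε => ultraNorm W K h (f ε)) fun ε => Real.exp (W.assoc (k / ε))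
  | .roumieu => ∀ K : Set (E d), IsCompact K → K ⊆ Ω → ∀ k > 0, ∃ h > 0,
      IsBigOZero (fun ε => ultraNorm W K h (f ε)) fun ε => Real.exp (W.assoc (k / ε))

/-- The net `(f_ε)` belongs to the space of `*`-negligible nets on `Ω`. -/
def IsNegligible (W : WeightSequence) (s : UltraType) (Ω : Opens (E d)) (f : Net d) : Prop :=
  (∀ ε, IsUltradiff W s Ω (f ε)) ∧
  match s with
  | .beurling => ∀ K : Set (E d), IsCompact K → K ⊆ Ω → ∀ h > 0, ∀ k > 0,
      IsBigOZero (fun ε => ultraNorm W K h (f ε)) fun ε => Real.exp (-W.assoc (k / ε))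
  | .roumieu => ∀ K : Set (E d), IsCompact K → K ⊆ Ω → ∃ k > 0, ∃ h > 0,
      IsBigOZero (fun ε => ultraNorm W K h (f ε)) fun ε => Real.exp (-W.assoc (k / ε))

/-! ### Helper facts: moderate nets form an algebra, negligible nets an ideal -/

/-- Iterated partial derivatives along a word of indices. -/
def wderiv : List (Fin d) → (E d → ℂ) → E d → ℂ
  | [], f => f
  | i :: w, f => pderiv i (wderiv w f)

theorem wderiv_append (w v : List (Fin d)) (f : E d → ℂ) :
    wderiv (w ++ v) f = wderiv w (wderiv v f) := by
  induction w with
  | nil => rfl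
  | cons i w ih => simp [wderiv, ih]

theorem wderiv_replicate (n : ℕ) (i : Fin d) (f : E d → ℂ) :
    wderiv (List.replicate n i) f = (pderiv i)^[n] f := by
  induction n with
  | zero => rfl
  | succ n ih => rw [List.replicate_succ, wderiv, ih, Function.iterate_succ_apply']

/-- The nondecreasing word with letter multiplicities `α`. -/
def word (α : Fin d → ℕ) : List (Fin d) :=
  (List.finRange d).flatMap fun i => List.replicate (α i) i

theorem mderiv_eq_wderiv (α : Fin d → ℕ) (f : E d → ℂ) : mderiv α f = wderiv (word α) f := by
  unfold mderiv word
  induction List.finRange d with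
  | nil => rfl
  | cons i l ih =>
    rw [List.foldr_cons, List.flatMap_cons, wderiv_append, ← ih, wderiv_replicate]

theorem length_word (α : Fin d → ℕ) : (word α).length = order α := by
  simp only [word, order, List.length_flatMap, List.length_replicate]
  rw [← List.ofFn_eq_map, List.sum_ofFn]

theorem perm_word (w : List (Fin d)) : w.Perm (word fun i => w.count i) := by
  rw [List.perm_iff_count]
  intro a
  simp only [word, List.count_flatMap, Function.comp_def, List.count_replicate]
  rw [← List.ofFn_eq_map, List.sum_ofFn]
  simp

section calculus

variable {Ω : Opens (E d)} {f g : E d → ℂ}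

theorem contDiffOn_pderiv (hf : ContDiffOn ℝ ∞ f Ω) (i : Fin d) :
    ContDiffOn ℝ ∞ (pderiv i f) Ω :=
  (hf.fderiv_of_isOpen Ω.isOpen (by simp)).clm_apply contDiffOn_const

theorem contDiffOn_wderiv (hf : ContDiffOn ℝ ∞ f Ω) (w : List (Fin d)) :
    ContDiffOn ℝ ∞ (wderiv w f) Ω := by
  induction w with
  | nil => exact hf
  | cons i w ih => exact contDiffOn_pderiv ih i

theorem pderiv_congr (h : Set.EqOn f g Ω) (i : Fin d) :
    Set.EqOn (pderiv i f) (pderiv i g) Ω := by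
  intro x hx
  have : f =ᶠ[nhds x] g := Filter.eventuallyEq_of_mem (Ω.isOpen.mem_nhds hx) h
  simp only [pderiv, this.fderiv_eq]

theorem wderiv_congr (h : Set.EqOn f g Ω) (w : List (Fin d)) :
    Set.EqOn (wderiv w f) (wderiv w g) Ω := by
  induction w with
  | nil => exact h
  | cons i w ih => exact pderiv_congr ih i

theorem differentiableAt_of (hf : ContDiffOn ℝ ∞ f Ω) {x : E d} (hx : x ∈ Ω) :
    DifferentiableAt ℝ f x :=
  (hf.contDiffAt (Ω.isOpen.mem_nhds hx)).differentiableAt (by simp)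

theorem pderiv_comm (hf : ContDiffOn ℝ ∞ f Ω) (i j : Fin d) :
    Set.EqOn (pderiv i (pderiv j f)) (pderiv j (pderiv i f)) Ω := by
  intro x hx
  have hc : ContDiffAt ℝ ∞ f x := hf.contDiffAt (Ω.isOpen.mem_nhds hx)
  have hs : IsSymmSndFDerivAt ℝ f x := hc.isSymmSndFDerivAt (by
    rw [minSmoothness_of_isRCLikeNormedField]; exact WithTop.coe_le_coe.2 le_top)
  have hd : DifferentiableAt ℝ (fderiv ℝ f) x :=
    (hc.fderiv_right (m := ∞) (by simp)).differentiableAt (by simp)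
  have key : ∀ k l : Fin d, pderiv k (pderiv l f) x =
      fderiv ℝ (fderiv ℝ f) x (EuclideanSpace.single k 1) (EuclideanSpace.single l 1) := by
    intro k l
    change fderiv ℝ (fun y => fderiv ℝ f y (EuclideanSpace.single l 1)) x _ = _
    rw [fderiv_clm_apply hd (differentiableAt_const _)]
    simp
  rw [key, key]
  exact hs _ _

theorem wderiv_perm (hf : ContDiffOn ℝ ∞ f Ω) {w v : List (Fin d)} (h : w.Perm v) :
    Set.EqOn (wderiv w f) (wderiv v f) Ω := by
  induction h with
  | nil => exact fun _ _ => rfl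
  | cons i _ ih => exact pderiv_congr ih i
  | swap i j l => exact pderiv_comm (contDiffOn_wderiv hf l) j i
  | trans _ _ ih₁ ih₂ => exact ih₁.trans ih₂

theorem pderiv_add (hf : ContDiffOn ℝ ∞ f Ω) (hg : ContDiffOn ℝ ∞ g Ω) (i : Fin d) :
    Set.EqOn (pderiv i (f + g)) (pderiv i f + pderiv i g) Ω := by
  intro x hx
  simp [pderiv, fderiv_add (differentiableAt_of hf hx) (differentiableAt_of hg hx)]

theorem wderiv_add (hf : ContDiffOn ℝ ∞ f Ω) (hg : ContDiffOn ℝ ∞ g Ω) (w : List (Fin d)) :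
    Set.EqOn (wderiv w (f + g)) (wderiv w f + wderiv w g) Ω := by
  induction w with
  | nil => exact fun _ _ => rfl
  | cons i w ih =>
    exact (pderiv_congr ih i).trans
      (pderiv_add (contDiffOn_wderiv hf w) (contDiffOn_wderiv hg w) i)

theorem pderiv_mul (hf : ContDiffOn ℝ ∞ f Ω) (hg : ContDiffOn ℝ ∞ g Ω) (i : Fin d) :
    Set.EqOn (pderiv i (f * g)) (f * pderiv i g + pderiv i f * g) Ω := by
  intro x hx
  have h := fderiv_mul (differentiableAt_of hf hx) (differentiableAt_of hg hx)
  simp only [pderiv, Pi.add_apply, Pi.mul_apply, h]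
  simp [mul_comm]

open Finset in
theorem norm_wderiv_mul_le {x : E d} (hx : x ∈ Ω) (w : List (Fin d)) :
    ∀ {f g : E d → ℂ}, ContDiffOn ℝ ∞ f Ω → ContDiffOn ℝ ∞ g Ω → ∀ a b : ℕ → ℝ,
      (∀ u, ‖wderiv u f x‖ ≤ a u.length) → (∀ u, ‖wderiv u g x‖ ≤ b u.length) →
      ‖wderiv w (f * g) x‖ ≤
        ∑ p ∈ antidiagonal w.length, (w.length.choose p.1 : ℝ) * (a p.1 * b p.2) := by
  induction w using List.reverseRecOn with
  | nil =>
    intro f g _ _ a b ha hb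
    have h1 := ha []
    have h2 := hb []
    simp only [wderiv, List.length_nil] at h1 h2
    simpa [wderiv] using mul_le_mul h1 h2 (norm_nonneg _) ((norm_nonneg _).trans h1)
  | append_singleton w i ih =>
    intro f g hf hg a b ha hb
    have hf' := contDiffOn_pderiv hf i
    have hg' := contDiffOn_pderiv hg i
    have e : wderiv (w ++ [i]) (f * g) x =
        wderiv w (f * pderiv i g) x + wderiv w (pderiv i f * g) x := by
      rw [wderiv_append]
      exact (wderiv_congr (pderiv_mul hf hg i) w hx).trans
        (wderiv_add (hf.mul hg') (hf'.mul hg) w hx)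
    have shift : ∀ (h : E d → ℂ) (c : ℕ → ℝ), (∀ u, ‖wderiv u h x‖ ≤ c u.length) →
        ∀ u, ‖wderiv u (pderiv i h) x‖ ≤ c (u.length + 1) := by
      intro h c hc u
      have := hc (u ++ [i])
      rwa [wderiv_append, List.length_append, List.length_singleton] at this
    have h1 := ih hf hg' a (fun n => b (n + 1)) ha (shift g b hb)
    have h2 := ih hf' hg (fun n => a (n + 1)) b (shift f a ha) hb
    rw [e, List.length_append, List.length_singleton,
      Finset.sum_antidiagonal_choose_succ_mul (fun m n => a m * b n)]
    refine (norm_add_le _ _).trans (add_le_add h1 (h2.trans (le_of_eq ?_)))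
    refine Finset.sum_congr rfl fun p hp => ?_
    rw [Nat.choose_symm_of_eq_add (mem_antidiagonal.1 hp).symm]

end calculus

section norms

variable {W : WeightSequence} {Ω : Opens (E d)} {K : Set (E d)} {f g : E d → ℂ}

theorem ultraNorm_le_iff {h C : ℝ} (hh : 0 < h) (hC : 0 ≤ C) :
    ultraNorm W K h f ≤ ENNReal.ofReal C ↔
      ∀ x ∈ K, ∀ α, ‖mderiv α f x‖ ≤ C * (h ^ order α * W.M (order α)) := by
  have hp : ∀ n, 0 < h ^ n * W.M n := fun n => mul_pos (pow_pos hh n) (W.pos n)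
  simp only [ultraNorm, iSup_le_iff, ENNReal.ofReal_le_ofReal_iff hC, div_le_iff₀ (hp _)]

theorem ultraNorm_le_iff_word (hf : ContDiffOn ℝ ∞ f Ω) (hK : K ⊆ Ω) {h C : ℝ} (hh : 0 < h)
    (hC : 0 ≤ C) :
    ultraNorm W K h f ≤ ENNReal.ofReal C ↔
      ∀ x ∈ K, ∀ w : List (Fin d), ‖wderiv w f x‖ ≤ C * (h ^ w.length * W.M w.length) := by
  rw [ultraNorm_le_iff hh hC]
  refine ⟨fun H x hx w => ?_, fun H x hx α => ?_⟩
  · have := H x hx fun i => w.count i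
    rwa [mderiv_eq_wderiv, ← wderiv_perm hf (perm_word w) (hK hx), ← length_word,
      ← (perm_word w).length_eq] at this
  · rw [mderiv_eq_wderiv, ← length_word]
    exact H x hx _

theorem WeightSequence.mul_le (W : WeightSequence) (p q : ℕ) : W.M p * W.M q ≤ W.M (p + q) := by
  have ratio : Monotone fun n => W.M (n + 1) / W.M n := by
    refine monotone_nat_of_le_succ fun n => ?_
    rw [div_le_div_iff₀ (W.pos _) (W.pos _)]
    have := W.m1 n
    nlinarith
  induction q with
  | zero => simp [W.zero]
  | succ q ih =>
    have h1 : W.M (q + 1) = W.M q * (W.M (q + 1) / W.M q) := by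
      rw [mul_div_cancel₀ _ (W.pos q).ne']
    have h2 : W.M (p + (q + 1)) = W.M (p + q) * (W.M (p + q + 1) / W.M (p + q)) := by
      rw [mul_div_cancel₀ _ (W.pos _).ne', add_assoc]
    rw [h1, h2, ← mul_assoc]
    exact mul_le_mul ih (ratio (Nat.le_add_left q p)) (div_pos (W.pos _) (W.pos _)).le
      (W.pos _).le

theorem ultraNorm_mul_le (hf : ContDiffOn ℝ ∞ f Ω) (hg : ContDiffOn ℝ ∞ g Ω) (hK : K ⊆ Ω)
    {h₁ h₂ C₁ C₂ : ℝ} (hh₁ : 0 < h₁) (hh₂ : 0 < h₂) (hC₁ : 0 ≤ C₁) (hC₂ : 0 ≤ C₂)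
    (H₁ : ultraNorm W K h₁ f ≤ ENNReal.ofReal C₁) (H₂ : ultraNorm W K h₂ g ≤ ENNReal.ofReal C₂) :
    ultraNorm W K (h₁ + h₂) (f * g) ≤ ENNReal.ofReal (C₁ * C₂) := by
  rw [ultraNorm_le_iff_word hf hK hh₁ hC₁] at H₁
  rw [ultraNorm_le_iff_word hg hK hh₂ hC₂] at H₂
  rw [ultraNorm_le_iff_word (f := f * g) (hf.mul hg) hK (add_pos hh₁ hh₂) (mul_nonneg hC₁ hC₂)]
  intro x hx w
  refine (norm_wderiv_mul_le (hK hx) w hf hg (fun n => C₁ * (h₁ ^ n * W.M n))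
    (fun n => C₂ * (h₂ ^ n * W.M n)) (H₁ x hx) (H₂ x hx)).trans ?_
  rw [(Commute.all h₁ h₂).add_pow', Finset.sum_mul, Finset.mul_sum]
  refine Finset.sum_le_sum fun p hp => ?_
  rw [← Finset.HasAntidiagonal.mem_antidiagonal.1 hp, nsmul_eq_mul]
  have hb := W.mul_le p.1 p.2
  have hc : 0 ≤ C₁ * C₂ * (((p.1 + p.2).choose p.1 : ℝ) * (h₁ ^ p.1 * h₂ ^ p.2)) := by positivity
  calc _ = C₁ * C₂ * (((p.1 + p.2).choose p.1 : ℝ) * (h₁ ^ p.1 * h₂ ^ p.2)) *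
        (W.M p.1 * W.M p.2) := by ring
    _ ≤ C₁ * C₂ * (((p.1 + p.2).choose p.1 : ℝ) * (h₁ ^ p.1 * h₂ ^ p.2)) * W.M (p.1 + p.2) :=
        mul_le_mul_of_nonneg_left hb hc
    _ = _ := by ring

theorem ultraNorm_add_le (hf : ContDiffOn ℝ ∞ f Ω) (hg : ContDiffOn ℝ ∞ g Ω) (hK : K ⊆ Ω)
    {h C₁ C₂ : ℝ} (hh : 0 < h) (hC₁ : 0 ≤ C₁) (hC₂ : 0 ≤ C₂)
    (H₁ : ultraNorm W K h f ≤ ENNReal.ofReal C₁) (H₂ : ultraNorm W K h g ≤ ENNReal.ofReal C₂) :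
    ultraNorm W K h (f + g) ≤ ENNReal.ofReal (C₁ + C₂) := by
  rw [ultraNorm_le_iff_word hf hK hh hC₁] at H₁
  rw [ultraNorm_le_iff_word hg hK hh hC₂] at H₂
  rw [ultraNorm_le_iff_word (f := f + g) (hf.add hg) hK hh (add_nonneg hC₁ hC₂)]
  intro x hx w
  rw [wderiv_add hf hg w (hK hx), add_mul]
  exact (norm_add_le _ _).trans (add_le_add (H₁ x hx w) (H₂ x hx w))

theorem ultraNorm_anti {h h' : ℝ} (hh : 0 < h) (hle : h ≤ h') :
    ultraNorm W K h' f ≤ ultraNorm W K h f := by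
  refine iSup₂_mono fun x _ => iSup_mono fun α => ENNReal.ofReal_le_ofReal ?_
  have := W.pos (order α)
  gcongr

theorem ultraNorm_const_le (c : ℂ) {h : ℝ} (hh : 0 < h) :
    ultraNorm W K h (fun _ : E d => c) ≤ ENNReal.ofReal ‖c‖ := by
  have key : ∀ w : List (Fin d), wderiv w (fun _ => c) = fun _ => if w = [] then c else 0 := by
    intro w
    induction w with
    | nil => simp [wderiv]
    | cons i w ih => funext x; simp [wderiv, pderiv, ih]
  rw [ultraNorm_le_iff_word (Ω := ⊤) contDiffOn_const (fun _ _ => trivial) hh (norm_nonneg c)]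
  intro x _ w
  have hp : 0 < h ^ w.length * W.M w.length := mul_pos (pow_pos hh _) (W.pos _)
  rw [key]
  rcases eq_or_ne w [] with rfl | hw
  · simp [W.zero]
  · simp only [hw, if_false, norm_zero]
    positivity

end norms

section growth

variable (W : WeightSequence)

theorem bddAbove_assoc {t : ℝ} (ht : 0 < t) :
    BddAbove (Set.range fun p : ℕ => Real.log (t ^ p / W.M p)) := by
  have h0 : ∀ᶠ p in Filter.atTop, W.M p / W.M (p + 1) < 1 / t :=
    W.m3.tendsto_atTop_zero.eventually (gt_mem_nhds (by positivity))
  obtain ⟨P, hP⟩ := Filter.eventually_atTop.1 h0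
  have hpos : ∀ p, 0 < t ^ p / W.M p := fun p => div_pos (pow_pos ht p) (W.pos p)
  have step : ∀ n, t ^ (P + n) / W.M (P + n) ≤ t ^ P / W.M P := by
    intro n
    induction n with
    | zero => exact le_rfl
    | succ n ih =>
      refine le_trans ?_ ih
      have h1 := hP (P + n) (Nat.le_add_right _ _)
      rw [div_lt_div_iff₀ (W.pos _) ht] at h1
      rw [← add_assoc, div_le_div_iff₀ (W.pos _) (W.pos _), pow_succ]
      have := pow_pos ht (P + n)
      nlinarith
  refine Filter.IsBoundedUnder.bddAbove_range
    ⟨Real.log (t ^ P / W.M P), Filter.eventually_map.2 (Filter.eventually_atTop.2 ⟨P, ?_⟩)⟩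
  intro p hp
  obtain ⟨n, rfl⟩ := Nat.exists_eq_add_of_le hp
  exact Real.log_le_log (hpos _) (step n)

theorem assoc_mono {t t' : ℝ} (ht : 0 < t) (hle : t ≤ t') : W.assoc t ≤ W.assoc t' := by
  refine ciSup_mono (bddAbove_assoc W (ht.trans_le hle)) fun p => ?_
  have := W.pos p
  exact Real.log_le_log (by positivity) (by gcongr)

theorem assoc_nonneg {t : ℝ} (ht : 0 < t) : 0 ≤ W.assoc t := by
  have := le_ciSup (bddAbove_assoc W ht) 0
  simpa [W.zero, WeightSequence.assoc] using this

theorem exists_two_mul_assoc_le :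
    ∃ A H : ℝ, 1 ≤ A ∧ 1 ≤ H ∧ ∀ t > 0, 2 * W.assoc t ≤ W.assoc (H * t) + Real.log A := by
  obtain ⟨A, H, hA, hH, h⟩ := W.m2
  refine ⟨A, H, hA, hH, fun t ht => ?_⟩
  have hA0 : 0 < A := by linarith
  have hH0 : 0 < H := by linarith
  have hHt : 0 < H * t := by positivity
  have key : ∀ p q, Real.log (t ^ p / W.M p) + Real.log (t ^ q / W.M q) ≤
      W.assoc (H * t) + Real.log A := by
    intro p q
    have hp := W.pos p
    have hq := W.pos q
    have hpq := W.pos (p + q)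
    have h1 : Real.log ((H * t) ^ (p + q) / W.M (p + q)) ≤ W.assoc (H * t) :=
      le_ciSup (bddAbove_assoc W hHt) (p + q)
    refine le_trans ?_ (add_le_add_left h1 (Real.log A))
    rw [← Real.log_mul (by positivity) (by positivity),
      ← Real.log_mul (by positivity) (by positivity)]
    refine Real.log_le_log (by positivity) ?_
    rw [div_mul_div_comm, div_mul_eq_mul_div, div_le_div_iff₀ (by positivity) hpq, mul_pow,
      ← pow_add]
    calc t ^ (p + q) * W.M (p + q)
        ≤ t ^ (p + q) * (A * H ^ (p + q) * W.M p * W.M q) :=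
          mul_le_mul_of_nonneg_left (h p q) (by positivity)
      _ = _ := by ring
  have h2 : ∀ p, Real.log (t ^ p / W.M p) + W.assoc t ≤ W.assoc (H * t) + Real.log A := by
    intro p
    have : W.assoc t ≤ W.assoc (H * t) + Real.log A - Real.log (t ^ p / W.M p) :=
      ciSup_le fun q => by linarith [key p q]
    linarith
  have h3 : W.assoc t ≤ W.assoc (H * t) + Real.log A - W.assoc t :=
    ciSup_le fun p => by linarith [h2 p]
  linarith

end growth

section closure

variable {W : WeightSequence} {s : UltraType} {Ω : Opens (E d)}

theorem lt_top_iff_exists {a : ℝ≥0∞} : a < ⊤ ↔ ∃ C : ℝ, 0 ≤ C ∧ a ≤ ENNReal.ofReal C :=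
  ⟨fun h => ⟨a.toReal, ENNReal.toReal_nonneg, (ENNReal.ofReal_toReal h.ne).ge⟩,
    fun ⟨_, _, h⟩ => h.trans_lt ENNReal.ofReal_lt_top⟩

theorem IsBigOZero.of_two {N₁ N₂ N : Set.Ioc (0 : ℝ) 1 → ℝ≥0∞} {g₁ g₂ g : ℝ → ℝ}
    (h₁ : IsBigOZero N₁ g₁) (h₂ : IsBigOZero N₂ g₂)
    (h : ∀ C₁ > 0, ∀ C₂ > 0, ∃ C > 0, ∀ ε, N₁ ε ≤ ENNReal.ofReal (C₁ * g₁ ε) →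
      N₂ ε ≤ ENNReal.ofReal (C₂ * g₂ ε) → N ε ≤ ENNReal.ofReal (C * g ε)) :
    IsBigOZero N g := by
  obtain ⟨C₁, hC₁, e₁, he₁, H₁⟩ := h₁
  obtain ⟨C₂, hC₂, e₂, he₂, H₂⟩ := h₂
  obtain ⟨C, hC, H⟩ := h C₁ hC₁ C₂ hC₂
  exact ⟨C, hC, min e₁ e₂, lt_min he₁ he₂, fun ε hε =>
    H ε (H₁ ε (hε.trans_le (min_le_left _ _))) (H₂ ε (hε.trans_le (min_le_right _ _)))⟩

theorem IsBigOZero.add {K : Set (E d)} (hK : K ⊆ Ω) {f g : Net d}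
    (hf : ∀ ε, ContDiffOn ℝ ∞ (f ε) Ω) (hg : ∀ ε, ContDiffOn ℝ ∞ (g ε) Ω) {h : ℝ} (hh : 0 < h)
    {a b c : ℝ → ℝ} (hac : ∀ ε > 0, a ε ≤ c ε) (hbc : ∀ ε > 0, b ε ≤ c ε)
    (h₁ : IsBigOZero (fun ε => ultraNorm W K h (f ε)) fun ε => Real.exp (a ε))
    (h₂ : IsBigOZero (fun ε => ultraNorm W K h (g ε)) fun ε => Real.exp (b ε)) :
    IsBigOZero (fun ε => ultraNorm W K h ((f + g) ε)) fun ε => Real.exp (c ε) := by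
  refine h₁.of_two h₂ fun C₁ hC₁ C₂ hC₂ => ⟨C₁ + C₂, by positivity, fun ε H₁ H₂ => ?_⟩
  refine (ultraNorm_add_le (hf ε) (hg ε) hK hh (by positivity) (by positivity) H₁ H₂).trans
    (ENNReal.ofReal_le_ofReal ?_)
  rw [add_mul]
  have := hac ε ε.2.1
  have := hbc ε ε.2.1
  gcongr

theorem IsBigOZero.mul {K : Set (E d)} (hK : K ⊆ Ω) {f g : Net d}
    (hf : ∀ ε, ContDiffOn ℝ ∞ (f ε) Ω) (hg : ∀ ε, ContDiffOn ℝ ∞ (g ε) Ω)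
    {h₁ h₂ : ℝ} (hh₁ : 0 < h₁) (hh₂ : 0 < h₂) {a b c : ℝ → ℝ} {L : ℝ}
    (habc : ∀ ε > 0, a ε + b ε ≤ c ε + L)
    (H₁ : IsBigOZero (fun ε => ultraNorm W K h₁ (f ε)) fun ε => Real.exp (a ε))
    (H₂ : IsBigOZero (fun ε => ultraNorm W K h₂ (g ε)) fun ε => Real.exp (b ε)) :
    IsBigOZero (fun ε => ultraNorm W K (h₁ + h₂) ((f * g) ε)) fun ε => Real.exp (c ε) := by
  refine H₁.of_two H₂ fun C₁ hC₁ C₂ hC₂ => ⟨C₁ * C₂ * Real.exp L, by positivity, fun ε N₁ N₂ => ?_⟩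
  refine (ultraNorm_mul_le (hf ε) (hg ε) hK hh₁ hh₂ (by positivity) (by positivity) N₁ N₂).trans
    (ENNReal.ofReal_le_ofReal ?_)
  have := Real.exp_le_exp.2 (habc ε ε.2.1)
  rw [Real.exp_add, Real.exp_add] at this
  calc C₁ * Real.exp (a ε) * (C₂ * Real.exp (b ε))
      = C₁ * C₂ * (Real.exp (a ε) * Real.exp (b ε)) := by ring
    _ ≤ C₁ * C₂ * (Real.exp (c ε) * Real.exp L) := by gcongr
    _ = _ := by ring

theorem IsBigOZero.mono {N N' : Set.Ioc (0 : ℝ) 1 → ℝ≥0∞} {g : ℝ → ℝ} (h : IsBigOZero N g)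
    (hle : ∀ ε, N' ε ≤ N ε) : IsBigOZero N' g := by
  obtain ⟨C, hC, e, he, H⟩ := h
  exact ⟨C, hC, e, he, fun ε hε => (hle ε).trans (H ε hε)⟩

theorem isUltradiff_const (c : ℂ) : IsUltradiff W s Ω fun _ => c := by
  refine ⟨contDiffOn_const, ?_⟩
  cases s
  · exact fun K _ _ h hh => (ultraNorm_const_le c hh).trans_lt ENNReal.ofReal_lt_top
  · exact fun K _ _ => ⟨1, one_pos, (ultraNorm_const_le c one_pos).trans_lt ENNReal.ofReal_lt_top⟩

theorem IsUltradiff.add {f g : E d → ℂ} (hf : IsUltradiff W s Ω f) (hg : IsUltradiff W s Ω g) :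
    IsUltradiff W s Ω (f + g) := by
  refine ⟨hf.1.add hg.1, ?_⟩
  cases s
  · intro K hK hKΩ h hh
    obtain ⟨C₁, hC₁, H₁⟩ := lt_top_iff_exists.1 (hf.2 K hK hKΩ h hh)
    obtain ⟨C₂, hC₂, H₂⟩ := lt_top_iff_exists.1 (hg.2 K hK hKΩ h hh)
    exact (ultraNorm_add_le hf.1 hg.1 hKΩ hh hC₁ hC₂ H₁ H₂).trans_lt ENNReal.ofReal_lt_top
  · intro K hK hKΩ
    obtain ⟨h₁, hh₁, N₁⟩ := hf.2 K hK hKΩ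
    obtain ⟨h₂, hh₂, N₂⟩ := hg.2 K hK hKΩ
    obtain ⟨C₁, hC₁, H₁⟩ := lt_top_iff_exists.1 N₁
    obtain ⟨C₂, hC₂, H₂⟩ := lt_top_iff_exists.1 N₂
    exact ⟨max h₁ h₂, lt_max_of_lt_left hh₁,
      (ultraNorm_add_le hf.1 hg.1 hKΩ (lt_max_of_lt_left hh₁) hC₁ hC₂
        ((ultraNorm_anti hh₁ (le_max_left _ _)).trans H₁)
        ((ultraNorm_anti hh₂ (le_max_right _ _)).trans H₂)).trans_lt ENNReal.ofReal_lt_top⟩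

theorem IsUltradiff.mul {f g : E d → ℂ} (hf : IsUltradiff W s Ω f) (hg : IsUltradiff W s Ω g) :
    IsUltradiff W s Ω (f * g) := by
  refine ⟨hf.1.mul hg.1, ?_⟩
  cases s
  · intro K hK hKΩ h hh
    obtain ⟨C₁, hC₁, H₁⟩ := lt_top_iff_exists.1 (hf.2 K hK hKΩ (h / 2) (half_pos hh))
    obtain ⟨C₂, hC₂, H₂⟩ := lt_top_iff_exists.1 (hg.2 K hK hKΩ (h / 2) (half_pos hh))
    have := ultraNorm_mul_le hf.1 hg.1 hKΩ (half_pos hh) (half_pos hh) hC₁ hC₂ H₁ H₂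
    rw [add_halves] at this
    exact this.trans_lt ENNReal.ofReal_lt_top
  · intro K hK hKΩ
    obtain ⟨h₁, hh₁, N₁⟩ := hf.2 K hK hKΩ
    obtain ⟨h₂, hh₂, N₂⟩ := hg.2 K hK hKΩ
    obtain ⟨C₁, hC₁, H₁⟩ := lt_top_iff_exists.1 N₁
    obtain ⟨C₂, hC₂, H₂⟩ := lt_top_iff_exists.1 N₂
    exact ⟨h₁ + h₂, add_pos hh₁ hh₂,
      (ultraNorm_mul_le hf.1 hg.1 hKΩ hh₁ hh₂ hC₁ hC₂ H₁ H₂).trans_lt ENNReal.ofReal_lt_top⟩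

theorem isModerate_const (c : ℂ) : IsModerate W s Ω fun _ _ => c := by
  have key : ∀ (K : Set (E d)) (h k : ℝ), 0 < h → 0 < k →
      IsBigOZero (fun _ => ultraNorm W K h fun _ => c) fun ε => Real.exp (W.assoc (k / ε)) := by
    intro K h k hh hk
    refine ⟨‖c‖ + 1, by positivity, 1, one_pos, fun ε _ =>
      (ultraNorm_const_le c hh).trans (ENNReal.ofReal_le_ofReal ?_)⟩
    have h1 : 1 ≤ Real.exp (W.assoc (k / ε)) :=
      Real.one_le_exp (assoc_nonneg W (div_pos hk ε.2.1))
    nlinarith [norm_nonneg c]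
  refine ⟨fun _ => isUltradiff_const c, ?_⟩
  cases s
  · exact fun K _ _ h hh => ⟨1, one_pos, key K h 1 hh one_pos⟩
  · exact fun K _ _ k hk => ⟨1, one_pos, key K 1 k one_pos hk⟩

theorem IsModerate.add {f g : Net d} (hf : IsModerate W s Ω f) (hg : IsModerate W s Ω g) :
    IsModerate W s Ω (f + g) := by
  refine ⟨fun ε => (hf.1 ε).add (hg.1 ε), ?_⟩
  have sf := fun ε => (hf.1 ε).1
  have sg := fun ε => (hg.1 ε).1
  cases s
  · intro K hK hKΩ h hh
    obtain ⟨k₁, hk₁, H₁⟩ := hf.2 K hK hKΩ h hh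
    obtain ⟨k₂, hk₂, H₂⟩ := hg.2 K hK hKΩ h hh
    refine ⟨max k₁ k₂, lt_max_of_lt_left hk₁,
      IsBigOZero.add hKΩ sf sg hh (fun ε hε => ?_) (fun ε hε => ?_) H₁ H₂⟩
    · exact assoc_mono W (div_pos hk₁ hε) (by gcongr; exact le_max_left _ _)
    · exact assoc_mono W (div_pos hk₂ hε) (by gcongr; exact le_max_right _ _)
  · intro K hK hKΩ k hk
    obtain ⟨h₁, hh₁, H₁⟩ := hf.2 K hK hKΩ k hk
    obtain ⟨h₂, hh₂, H₂⟩ := hg.2 K hK hKΩ k hk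
    exact ⟨max h₁ h₂, lt_max_of_lt_left hh₁,
      IsBigOZero.add hKΩ sf sg (lt_max_of_lt_left hh₁) (fun _ _ => le_rfl) (fun _ _ => le_rfl)
        (H₁.mono fun _ => ultraNorm_anti hh₁ (le_max_left _ _))
        (H₂.mono fun _ => ultraNorm_anti hh₂ (le_max_right _ _))⟩

theorem IsModerate.mul {f g : Net d} (hf : IsModerate W s Ω f) (hg : IsModerate W s Ω g) :
    IsModerate W s Ω (f * g) := by
  refine ⟨fun ε => (hf.1 ε).mul (hg.1 ε), ?_⟩
  have sf := fun ε => (hf.1 ε).1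
  have sg := fun ε => (hg.1 ε).1
  obtain ⟨A, H, hA, hH, hAH⟩ := exists_two_mul_assoc_le W
  have hH0 : 0 < H := by linarith
  cases s
  · intro K hK hKΩ h hh
    obtain ⟨k₁, hk₁, H₁⟩ := hf.2 K hK hKΩ (h / 2) (half_pos hh)
    obtain ⟨k₂, hk₂, H₂⟩ := hg.2 K hK hKΩ (h / 2) (half_pos hh)
    have hk : 0 < max k₁ k₂ := lt_max_of_lt_left hk₁
    refine ⟨H * max k₁ k₂, by positivity, ?_⟩
    have := IsBigOZero.mul (W := W) hKΩ sf sg (half_pos hh) (half_pos hh)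
      (c := fun ε => W.assoc (H * max k₁ k₂ / ε)) (L := Real.log A) (fun ε hε => ?_) H₁ H₂
    · rwa [add_halves] at this
    · have e1 : W.assoc (k₁ / ε) ≤ W.assoc (max k₁ k₂ / ε) :=
        assoc_mono W (div_pos hk₁ hε) (by gcongr; exact le_max_left _ _)
      have e2 : W.assoc (k₂ / ε) ≤ W.assoc (max k₁ k₂ / ε) :=
        assoc_mono W (div_pos hk₂ hε) (by gcongr; exact le_max_right _ _)
      have e3 := hAH _ (div_pos hk hε)
      rw [← mul_div_assoc] at e3
      linarith
  · intro K hK hKΩ k hk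
    obtain ⟨h₁, hh₁, H₁⟩ := hf.2 K hK hKΩ (k / H) (by positivity)
    obtain ⟨h₂, hh₂, H₂⟩ := hg.2 K hK hKΩ (k / H) (by positivity)
    refine ⟨h₁ + h₂, add_pos hh₁ hh₂,
      IsBigOZero.mul (L := Real.log A) hKΩ sf sg hh₁ hh₂ (fun ε hε => ?_) H₁ H₂⟩
    have e := hAH (k / H / ε) (by positivity)
    rw [← mul_div_assoc, mul_div_cancel₀ _ hH0.ne'] at e
    linarith

theorem isNegligible_zero : IsNegligible W s Ω (0 : Net d) := by
  have key : ∀ (K : Set (E d)) (h k : ℝ), 0 < h →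
      IsBigOZero (fun ε => ultraNorm W K h ((0 : Net d) ε))
        fun ε => Real.exp (-W.assoc (k / ε)) := by
    intro K h k hh
    refine ⟨1, one_pos, 1, one_pos, fun ε _ => (ultraNorm_const_le 0 hh).trans
      (ENNReal.ofReal_le_ofReal ?_)⟩
    rw [norm_zero]
    positivity
  refine ⟨fun _ => isUltradiff_const 0, ?_⟩
  cases s
  · exact fun K _ _ h hh k _ => key K h k hh
  · exact fun K _ _ => ⟨1, one_pos, 1, one_pos, key K 1 1 one_pos⟩

theorem IsNegligible.add {f g : Net d} (hf : IsNegligible W s Ω f) (hg : IsNegligible W s Ω g) :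
    IsNegligible W s Ω (f + g) := by
  refine ⟨fun ε => (hf.1 ε).add (hg.1 ε), ?_⟩
  have sf := fun ε => (hf.1 ε).1
  have sg := fun ε => (hg.1 ε).1
  cases s
  · exact fun K hK hKΩ h hh k hk =>
      IsBigOZero.add hKΩ sf sg hh (fun _ _ => le_rfl) (fun _ _ => le_rfl)
        (hf.2 K hK hKΩ h hh k hk) (hg.2 K hK hKΩ h hh k hk)
  · intro K hK hKΩ
    obtain ⟨k₁, hk₁, h₁, hh₁, H₁⟩ := hf.2 K hK hKΩ
    obtain ⟨k₂, hk₂, h₂, hh₂, H₂⟩ := hg.2 K hK hKΩ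
    refine ⟨min k₁ k₂, lt_min hk₁ hk₂, max h₁ h₂, lt_max_of_lt_left hh₁,
      IsBigOZero.add hKΩ sf sg (lt_max_of_lt_left hh₁) (fun ε hε => ?_) (fun ε hε => ?_)
        (H₁.mono fun _ => ultraNorm_anti hh₁ (le_max_left _ _))
        (H₂.mono fun _ => ultraNorm_anti hh₂ (le_max_right _ _))⟩
    · exact neg_le_neg (assoc_mono W (div_pos (lt_min hk₁ hk₂) hε)
        (by gcongr; exact min_le_left _ _))
    · exact neg_le_neg (assoc_mono W (div_pos (lt_min hk₁ hk₂) hε)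
        (by gcongr; exact min_le_right _ _))

theorem IsModerate.mul_negligible {f g : Net d} (hf : IsModerate W s Ω f)
    (hg : IsNegligible W s Ω g) : IsNegligible W s Ω (f * g) := by
  refine ⟨fun ε => (hf.1 ε).mul (hg.1 ε), ?_⟩
  have sf := fun ε => (hf.1 ε).1
  have sg := fun ε => (hg.1 ε).1
  obtain ⟨A, H, hA, hH, hAH⟩ := exists_two_mul_assoc_le W
  have hH0 : 0 < H := by linarith
  cases s
  · intro K hK hKΩ h hh k hk
    obtain ⟨k₁, hk₁, H₁⟩ := hf.2 K hK hKΩ (h / 2) (half_pos hh)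
    have hm : 0 < max k₁ k := lt_max_of_lt_left hk₁
    have H₂ := hg.2 K hK hKΩ (h / 2) (half_pos hh) (H * max k₁ k) (by positivity)
    have := IsBigOZero.mul (W := W) hKΩ sf sg (half_pos hh) (half_pos hh)
      (c := fun ε => -W.assoc (k / ε)) (L := Real.log A) (fun ε hε => ?_) H₁ H₂
    · rwa [add_halves] at this
    · have e1 : W.assoc (k₁ / ε) ≤ W.assoc (max k₁ k / ε) :=
        assoc_mono W (div_pos hk₁ hε) (by gcongr; exact le_max_left _ _)
      have e2 : W.assoc (k / ε) ≤ W.assoc (max k₁ k / ε) :=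
        assoc_mono W (div_pos hk hε) (by gcongr; exact le_max_right _ _)
      have e3 := hAH _ (div_pos hm hε)
      rw [← mul_div_assoc] at e3
      linarith
  · intro K hK hKΩ
    obtain ⟨k, hk, h₂, hh₂, H₂⟩ := hg.2 K hK hKΩ
    obtain ⟨h₁, hh₁, H₁⟩ := hf.2 K hK hKΩ (k / H) (by positivity)
    refine ⟨k / H, by positivity, h₁ + h₂, add_pos hh₁ hh₂,
      IsBigOZero.mul (L := Real.log A) hKΩ sf sg hh₁ hh₂ (fun ε hε => ?_) H₁ H₂⟩
    have e := hAH (k / H / ε) (by positivity)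
    rw [← mul_div_assoc, mul_div_cancel₀ _ hH0.ne'] at e
    linarith

theorem IsModerate.mono {Ω' : Opens (E d)} (hle : Ω' ≤ Ω) {f : Net d}
    (hf : IsModerate W s Ω f) : IsModerate W s Ω' f := by
  have hle' : (Ω' : Set (E d)) ⊆ Ω := hle
  cases s
  · exact ⟨fun ε => ⟨(hf.1 ε).1.mono hle, fun K hK h => (hf.1 ε).2 K hK (h.trans hle')⟩,
      fun K hK h => hf.2 K hK (h.trans hle')⟩
  · exact ⟨fun ε => ⟨(hf.1 ε).1.mono hle, fun K hK h => (hf.1 ε).2 K hK (h.trans hle')⟩,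
      fun K hK h => hf.2 K hK (h.trans hle')⟩

theorem IsNegligible.mono {Ω' : Opens (E d)} (hle : Ω' ≤ Ω) {f : Net d}
    (hf : IsNegligible W s Ω f) : IsNegligible W s Ω' f := by
  have hle' : (Ω' : Set (E d)) ⊆ Ω := hle
  cases s
  · exact ⟨fun ε => ⟨(hf.1 ε).1.mono hle, fun K hK h => (hf.1 ε).2 K hK (h.trans hle')⟩,
      fun K hK h => hf.2 K hK (h.trans hle')⟩
  · exact ⟨fun ε => ⟨(hf.1 ε).1.mono hle, fun K hK h => (hf.1 ε).2 K hK (h.trans hle')⟩,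
      fun K hK h => hf.2 K hK (h.trans hle')⟩

end closure

/-! ### The algebra `𝒢^*(Ω)` and its presheaf structure -/

variable (W : WeightSequence) (s : UltraType)

/-- The algebra of `*`-moderate nets on `Ω` (pointwise operations). -/
def moderate (Ω : Opens (E d)) : Subalgebra ℂ (Net d) where
  carrier := {f | IsModerate W s Ω f}
  mul_mem' := IsModerate.mul
  add_mem' := IsModerate.add
  algebraMap_mem' := isModerate_const

/-- The ideal of `*`-negligible nets on `Ω`. -/
def negligible (Ω : Opens (E d)) : Ideal (moderate W s Ω) where
  carrier := {f | IsNegligible W s Ω f.1}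
  add_mem' := IsNegligible.add
  zero_mem' := isNegligible_zero
  smul_mem' f _ hg := IsModerate.mul_negligible f.2 hg

/-- The algebra `𝒢^*(Ω)` of generalized functions of class `*` on `Ω`: moderate nets modulo
negligible nets. As nets vanishing on `Ω` are negligible, the values of the nets outside `Ω`
play no role. -/
abbrev G (Ω : Opens (E d)) : Type := moderate W s Ω ⧸ negligible W s Ω

/-- The class `[(f_ε)]` of a moderate net. -/
def cls {Ω : Opens (E d)} (f : Net d) (hf : IsModerate W s Ω f) : G W s Ω :=
  Ideal.Quotient.mk (negligible W s Ω) ⟨f, hf⟩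

/-- The restriction homomorphism `[(f_ε)] ↦ [(f_ε|_{Ω'})]`, for `Ω' ⊆ Ω`. -/
def res {Ω Ω' : Opens (E d)} (hle : Ω' ≤ Ω) : G W s Ω →ₐ[ℂ] G W s Ω' :=
  Ideal.quotientMapₐ (negligible W s Ω')
    (Subalgebra.inclusion (S := moderate W s Ω) (T := moderate W s Ω')
      fun _ hf => IsModerate.mono hle hf)
    (fun _ hf => IsNegligible.mono hle hf)

theorem res_cls {Ω Ω' : Opens (E d)} (hle : Ω' ≤ Ω) (f : Net d) (hf : IsModerate W s Ω f) :
    res W s hle (cls W s f hf) = cls W s f (hf.mono hle) := rfl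

variable (d) in
/-- `Ω ↦ 𝒢^*(Ω)` as a presheaf of commutative `ℂ`-algebras on `ℝ^d`. -/
def algPresheaf : TopCat.Presheaf (CommAlgCat.{0} ℂ) (TopCat.of (E d)) where
  obj Ω := CommAlgCat.of ℂ (G W s (unop Ω))
  map i := CommAlgCat.ofHom (res W s (leOfHom i.unop))
  map_id Ω := by
    ext f
    obtain ⟨f, rfl⟩ := Ideal.Quotient.mk_surjective f
    rfl
  map_comp i j := by
    ext f
    obtain ⟨f, rfl⟩ := Ideal.Quotient.mk_surjective f
    rfl

variable (d) in
/-- `Ω ↦ 𝒢^*(Ω)` as a presheaf of complex vector spaces on `ℝ^d`. -/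
def modPresheaf : TopCat.Presheaf (ModuleCat.{0} ℂ) (TopCat.of (E d)) :=
  algPresheaf d W s ⋙ forget₂ (CommAlgCat.{0} ℂ) (AlgCat.{0} ℂ) ⋙
    forget₂ (AlgCat.{0} ℂ) (ModuleCat.{0} ℂ)

/-! ### Ultradifferential operators -/

/-- The coefficient condition for a `*`-ultradifferential operator `P(D) = ∑_α a_α D^α`. -/
def IsUltraCoeff (a : (Fin d → ℕ) → ℂ) : Prop :=
  match s with
  | .beurling => ∃ L > 0, ∃ C > 0, ∀ α, ‖a α‖ ≤ C * L ^ order α / W.M (order α)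
  | .roumieu => ∀ L > 0, ∃ C > 0, ∀ α, ‖a α‖ ≤ C * L ^ order α / W.M (order α)

/-- The general term `a_α D^α f (x)` of `P(D) f (x)`, where `D^α = (-i ∂)^α`. -/
def ultraTerm (a : (Fin d → ℕ) → ℂ) (f : E d → ℂ) (x : E d) (α : Fin d → ℕ) : ℂ :=
  a α * ((-Complex.I) ^ order α * mderiv α f x)

/-- `P(D) f = ∑_α a_α D^α f`, pointwise. -/
def ultraOp (a : (Fin d → ℕ) → ℂ) (f : E d → ℂ) (x : E d) : ℂ :=
  ∑' α, ultraTerm a f x α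

/-! ### Sheaf-theoretic notions -/

section sheaf

variable {X : TopCat.{0}}

/-- The restriction of a presheaf to an open subset. -/
def restrictTo {C : Type*} [Category* C] (F : TopCat.Presheaf C X) (Ω : Opens X) :
    TopCat.Presheaf C ((Opens.toTopCat X).obj Ω) :=
  Ω.isOpenEmbedding.isOpenMap.functor.op ⋙ F

variable (F : TopCat.Presheaf (ModuleCat.{0} ℂ) X)

/-- `F` is fine: for every locally finite open covering `(U_i)` of `X` there are endomorphisms
`φ_i` of `F` such that `{x | (φ_i)_x ≠ 0}` has closure contained in `U_i`, and `∑_i φ_i = id`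
(on each stalk only finitely many `φ_i` are nonzero). -/
def IsFine : Prop :=
  ∀ (ι : Type) (U : ι → Opens X), LocallyFinite (fun i => (U i : Set X)) → (⨆ i, U i = ⊤) →
    ∃ φ : ι → (F ⟶ F),
      (∀ i, closure {x : X | (TopCat.Presheaf.stalkFunctor (ModuleCat.{0} ℂ) x).map (φ i) ≠ 0}
        ⊆ U i) ∧
      ∀ x : X, ∑ᶠ i, (TopCat.Presheaf.stalkFunctor (ModuleCat.{0} ℂ) x).map (φ i) =
        𝟙 (F.stalk x)

/-- The support of a section: the points of `V` at which its germ is nonzero. -/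
def sectionSupport {V : Opens X} (f : F.obj (op V)) : Set X :=
  {x | ∃ hx : x ∈ V, F.germ V x hx f ≠ 0}

/-- `F` is supple: every section over an open set `V` with support in the union of two closed
sets `Z₁ ∪ Z₂` is a sum of two sections with supports in `Z₁` and `Z₂` respectively. (The
relatively closed subsets of `V` are the traces on `V` of the closed subsets of `X`.) -/
def IsSupple : Prop :=
  ∀ (V : Opens X) (Z₁ Z₂ : Set X), IsClosed Z₁ → IsClosed Z₂ → ∀ f : F.obj (op V),
    sectionSupport F f ⊆ Z₁ ∪ Z₂ →
    ∃ f₁ f₂ : F.obj (op V), f = f₁ + f₂ ∧ sectionSupport F f₁ ⊆ Z₁ ∧ sectionSupport F f₂ ⊆ Z₂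

end sheaf

end

end UltraGen

open UltraGen

namespace UltraGen

noncomputable section

variable {d : ℕ}

/-! ### Locality -/

section locality

variable {W : WeightSequence} {s : UltraType} {Ω : Opens (E d)}

/-! Moderateness and negligibility are tested on compact sets, and a compact set is a finite union
of compact pieces as small as desired; both properties are therefore local (`IsModerate.of_locally`,
`IsNegligible.of_locally`). Locality of negligibility is already the uniqueness half of the sheaf
axiom.

Existence of gluings and fineness need cutoffs. Condition (M.3)' yields a step function of Beurling
class as an infinite iterated average (`exists_step`), hence bumps and countable partitions of unity
(`exists_bump`, `exists_partition`). A Beurling function, taken as a constant net, is moderate for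
both types, so multiplication by it acts on the sheaf. A coherent family is glued by summing the
products of its members with the partition functions (`exists_gluing`), and multiplication by the
regrouped partition functions gives fineness.

For suppleness, the natural cutoff separating `Z₁` from `Z₂` is an infinite sum of partition
functions that is uncontrolled near `Z₁ ∩ Z₂`. It is replaced by a partial sum whose length `m ε`
tends to infinity so slowly that the net stays moderate (`exists_slow_net`). Near a point of `V`
outside `Z₁ ∩ Z₂` the partial sums stabilise, so for small `ε` the truncation is invisible there.

Differential and ultradifferential operators obey linear seminorm estimates with constants
independent of the function, hence of `ε` (`IsUltraOperator`). For `P(D)` these come from (M.2),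
which turns the defining series into a geometric one.

Flabbiness fails in the Beurling case because the exponent `k` of a moderate net is uniform only on
compact sets: a net of exponent `n + 1` on the `n`-th of infinitely many slabs accumulating at a
hyperplane cannot be extended across it. -/

theorem ultraNorm_empty {h : ℝ} {f : E d → ℂ} : ultraNorm W ∅ h f = 0 := by
  simp [ultraNorm]

theorem ultraNorm_mono {K L : Set (E d)} (hKL : K ⊆ L) {h : ℝ} {f : E d → ℂ} :
    ultraNorm W K h f ≤ ultraNorm W L h f :=
  biSup_mono hKL

theorem ultraNorm_union {K L : Set (E d)} {h : ℝ} {f : E d → ℂ} :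
    ultraNorm W (K ∪ L) h f = max (ultraNorm W K h f) (ultraNorm W L h f) :=
  iSup_union

theorem mderiv_congr {f g : E d → ℂ} (h : Set.EqOn f g Ω) (α : Fin d → ℕ) :
    Set.EqOn (mderiv α f) (mderiv α g) Ω := by
  simp only [mderiv_eq_wderiv]
  exact wderiv_congr h _

theorem ultraNorm_congr {f g : E d → ℂ} (h : Set.EqOn f g Ω) {K : Set (E d)} (hK : K ⊆ Ω)
    {r : ℝ} : ultraNorm W K r f = ultraNorm W K r g := by
  refine iSup_congr fun x => iSup_congr fun hx => iSup_congr fun α => ?_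
  rw [mderiv_congr h α (hK hx)]

theorem IsUltradiff.congr {f g : E d → ℂ} (hf : IsUltradiff W s Ω f) (h : Set.EqOn g f Ω) :
    IsUltradiff W s Ω g := by
  refine ⟨hf.1.congr h, ?_⟩
  cases s
  · intro K hK hKΩ r hr
    rw [ultraNorm_congr h hKΩ]
    exact hf.2 K hK hKΩ r hr
  · intro K hK hKΩ
    obtain ⟨r, hr, H⟩ := hf.2 K hK hKΩ
    exact ⟨r, hr, by rwa [ultraNorm_congr h hKΩ]⟩

theorem IsBigOZero.congr {N N' : Set.Ioc (0 : ℝ) 1 → ℝ≥0∞} {g : ℝ → ℝ} (h : IsBigOZero N g)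
    {e : ℝ} (he : 0 < e) (hN : ∀ ε : Set.Ioc (0 : ℝ) 1, (ε : ℝ) < e → N' ε ≤ N ε) :
    IsBigOZero N' g := by
  obtain ⟨C, hC, e', he', H⟩ := h
  exact ⟨C, hC, min e e', lt_min he he', fun ε hε =>
    (hN ε (hε.trans_le (min_le_left _ _))).trans (H ε (hε.trans_le (min_le_right _ _)))⟩

/-- Growth conditions only see small `ε`, while membership in the class is required for every `ε`
and must be supplied separately. The version with a threshold serves nets that stabilise only for
small `ε`, as in the suppleness argument. -/
theorem IsModerate.congr_eventually {f g : Net d} (hf : IsModerate W s Ω f)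
    (hg : ∀ ε, IsUltradiff W s Ω (g ε)) {e : ℝ} (he : 0 < e)
    (h : ∀ ε : Set.Ioc (0 : ℝ) 1, (ε : ℝ) < e → Set.EqOn (g ε) (f ε) Ω) :
    IsModerate W s Ω g := by
  refine ⟨hg, ?_⟩
  cases s
  · intro K hK hKΩ r hr
    obtain ⟨k, hk, H⟩ := hf.2 K hK hKΩ r hr
    exact ⟨k, hk, H.congr he fun ε hε => (ultraNorm_congr (h ε hε) hKΩ).le⟩
  · intro K hK hKΩ k hk
    obtain ⟨r, hr, H⟩ := hf.2 K hK hKΩ k hk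
    exact ⟨r, hr, H.congr he fun ε hε => (ultraNorm_congr (h ε hε) hKΩ).le⟩

theorem IsModerate.congr {f g : Net d} (hf : IsModerate W s Ω f)
    (h : ∀ ε, Set.EqOn (g ε) (f ε) Ω) : IsModerate W s Ω g :=
  hf.congr_eventually (fun ε => (hf.1 ε).congr (h ε)) one_pos fun ε _ => h ε

theorem IsNegligible.congr_eventually {f g : Net d} (hf : IsNegligible W s Ω f)
    (hg : ∀ ε, IsUltradiff W s Ω (g ε)) {e : ℝ} (he : 0 < e)
    (h : ∀ ε : Set.Ioc (0 : ℝ) 1, (ε : ℝ) < e → Set.EqOn (g ε) (f ε) Ω) :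
    IsNegligible W s Ω g := by
  refine ⟨hg, ?_⟩
  cases s
  · intro K hK hKΩ r hr k hk
    exact (hf.2 K hK hKΩ r hr k hk).congr he fun ε hε => (ultraNorm_congr (h ε hε) hKΩ).le
  · intro K hK hKΩ
    obtain ⟨k, hk, r, hr, H⟩ := hf.2 K hK hKΩ
    exact ⟨k, hk, r, hr, H.congr he fun ε hε => (ultraNorm_congr (h ε hε) hKΩ).le⟩

theorem IsNegligible.congr {f g : Net d} (hf : IsNegligible W s Ω f)
    (h : ∀ ε, Set.EqOn (g ε) (f ε) Ω) : IsNegligible W s Ω g :=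
  hf.congr_eventually (fun ε => (hf.1 ε).congr (h ε)) one_pos fun ε _ => h ε

theorem isNegligible_of_eqOn_zero {f : Net d} (h : ∀ ε, Set.EqOn (f ε) 0 Ω) :
    IsNegligible W s Ω f :=
  isNegligible_zero.congr h

theorem IsNegligible.isModerate {f : Net d} (hf : IsNegligible W s Ω f) :
    IsModerate W s Ω f := by
  have key : ∀ {N : Set.Ioc (0 : ℝ) 1 → ℝ≥0∞} {k l : ℝ}, 0 < k → 0 < l →
      IsBigOZero N (fun ε => Real.exp (-W.assoc (k / ε))) →
      IsBigOZero N (fun ε => Real.exp (W.assoc (l / ε))) := by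
    rintro N k l hk hl ⟨C, hC, e, he, H⟩
    refine ⟨C, hC, e, he, fun ε hε => (H ε hε).trans (ENNReal.ofReal_le_ofReal ?_)⟩
    have h1 := assoc_nonneg W (div_pos hk ε.2.1)
    have h2 := assoc_nonneg W (div_pos hl ε.2.1)
    exact mul_le_mul_of_nonneg_left (Real.exp_le_exp.2 (by linarith)) hC.le
  refine ⟨hf.1, ?_⟩
  cases s
  · exact fun K hK hKΩ r hr => ⟨1, one_pos, key one_pos one_pos (hf.2 K hK hKΩ r hr 1 one_pos)⟩
  · intro K hK hKΩ k hk
    obtain ⟨k', hk', r, hr, H⟩ := hf.2 K hK hKΩ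
    exact ⟨r, hr, key hk' hk H⟩

/-- A property of sets that holds for small compact sets around each point and is stable under
subsets and unions holds for compact sets. -/
theorem compact_induction {Ω : Opens (E d)} {p : Set (E d) → Prop} (h0 : p ∅)
    (hmono : ∀ ⦃S T⦄, S ⊆ T → p T → p S) (hunion : ∀ ⦃S T⦄, p S → p T → p (S ∪ T))
    (hloc : ∀ x ∈ Ω, ∃ U : Opens (E d), x ∈ U ∧ ∀ K : Set (E d), IsCompact K → K ⊆ U → p K)
    {K : Set (E d)} (hK : IsCompact K) (hKΩ : K ⊆ Ω) : p K := by
  refine hK.induction_on h0 hmono hunion fun x hx => ?_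
  obtain ⟨U, hxU, hU⟩ := hloc x (hKΩ hx)
  obtain ⟨L, hL, hLU, hLc⟩ := local_compact_nhds (U.isOpen.mem_nhds hxU)
  exact ⟨L, mem_nhdsWithin_of_mem_nhds hL, hU L hLc hLU⟩

theorem contDiffOn_of_locally {f : E d → ℂ}
    (h : ∀ x ∈ Ω, ∃ U : Opens (E d), x ∈ U ∧ ContDiffOn ℝ ∞ f U) : ContDiffOn ℝ ∞ f Ω := by
  intro x hx
  obtain ⟨U, hxU, hU⟩ := h x hx
  exact (hU.contDiffAt (U.isOpen.mem_nhds hxU)).contDiffWithinAt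

theorem IsUltradiff.of_locally {f : E d → ℂ}
    (h : ∀ x ∈ Ω, ∃ U : Opens (E d), x ∈ U ∧ IsUltradiff W s U f) : IsUltradiff W s Ω f := by
  refine ⟨contDiffOn_of_locally fun x hx => ?_, ?_⟩
  · obtain ⟨U, hxU, hU⟩ := h x hx
    exact ⟨U, hxU, hU.1⟩
  cases s
  · intro K hK hKΩ r hr
    refine compact_induction (p := fun K => ultraNorm W K r f < ⊤) ?_ ?_ ?_ ?_ hK hKΩ
    · simp [ultraNorm_empty]
    · exact fun S T hST hT => (ultraNorm_mono hST).trans_lt hT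
    · exact fun S T hS hT => by rw [ultraNorm_union]; exact max_lt hS hT
    · intro x hx
      obtain ⟨U, hxU, hU⟩ := h x hx
      exact ⟨U, hxU, fun K hK hKU => hU.2 K hK hKU r hr⟩
  · intro K hK hKΩ
    refine compact_induction (p := fun K => ∃ r > 0, ultraNorm W K r f < ⊤) ?_ ?_ ?_ ?_ hK hKΩ
    · exact ⟨1, one_pos, by simp [ultraNorm_empty]⟩
    · rintro S T hST ⟨r, hr, hT⟩
      exact ⟨r, hr, (ultraNorm_mono hST).trans_lt hT⟩
    · rintro S T ⟨r, hr, hS⟩ ⟨r', hr', hT⟩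
      refine ⟨max r r', lt_max_of_lt_left hr, ?_⟩
      rw [ultraNorm_union]
      exact max_lt ((ultraNorm_anti hr (le_max_left _ _)).trans_lt hS)
        ((ultraNorm_anti hr' (le_max_right _ _)).trans_lt hT)
    · intro x hx
      obtain ⟨U, hxU, hU⟩ := h x hx
      exact ⟨U, hxU, hU.2⟩

theorem IsBigOZero.union {S T : Set (E d)} {h h₁ h₂ : ℝ} (hh₁ : 0 < h₁) (hh₂ : 0 < h₂)
    (hle₁ : h₁ ≤ h) (hle₂ : h₂ ≤ h) {f : Net d} {a b c : ℝ → ℝ}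
    (hac : ∀ ε > 0, a ε ≤ c ε) (hbc : ∀ ε > 0, b ε ≤ c ε)
    (H₁ : IsBigOZero (fun ε => ultraNorm W S h₁ (f ε)) fun ε => Real.exp (a ε))
    (H₂ : IsBigOZero (fun ε => ultraNorm W T h₂ (f ε)) fun ε => Real.exp (b ε)) :
    IsBigOZero (fun ε => ultraNorm W (S ∪ T) h (f ε)) fun ε => Real.exp (c ε) := by
  refine H₁.of_two H₂ fun C₁ hC₁ C₂ hC₂ => ⟨max C₁ C₂, lt_max_of_lt_left hC₁, fun ε N₁ N₂ => ?_⟩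
  rw [ultraNorm_union]
  have h1 := Real.exp_le_exp.2 (hac ε ε.2.1)
  have h2 := Real.exp_le_exp.2 (hbc ε ε.2.1)
  refine max_le ((ultraNorm_anti hh₁ hle₁).trans (N₁.trans ?_))
    ((ultraNorm_anti hh₂ hle₂).trans (N₂.trans ?_)) <;>
  refine ENNReal.ofReal_le_ofReal (mul_le_mul ?_ (by assumption) (Real.exp_nonneg _)
    (le_max_of_le_left hC₁.le))
  · exact le_max_left _ _
  · exact le_max_right _ _

theorem isBigOZero_empty {h : ℝ} {f : Net d} {a : ℝ → ℝ} :
    IsBigOZero (fun ε => ultraNorm W ∅ h (f ε)) fun ε => Real.exp (a ε) :=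
  ⟨1, one_pos, 1, one_pos, fun ε _ => by simp [ultraNorm_empty]⟩

theorem IsModerate.of_locally {f : Net d}
    (h : ∀ x ∈ Ω, ∃ U : Opens (E d), x ∈ U ∧ IsModerate W s U f) : IsModerate W s Ω f := by
  refine ⟨fun ε => IsUltradiff.of_locally fun x hx => ?_, ?_⟩
  · obtain ⟨U, hxU, hU⟩ := h x hx
    exact ⟨U, hxU, hU.1 ε⟩
  cases s
  · intro K hK hKΩ r hr
    refine compact_induction (p := fun K => ∃ k > 0, IsBigOZero (fun ε => ultraNorm W K r (f ε))
      fun ε => Real.exp (W.assoc (k / ε))) ⟨1, one_pos, isBigOZero_empty⟩ ?_ ?_ ?_ hK hKΩ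
    · rintro S T hST ⟨k, hk, H⟩
      exact ⟨k, hk, H.mono fun _ => ultraNorm_mono hST⟩
    · rintro S T ⟨k₁, hk₁, H₁⟩ ⟨k₂, hk₂, H₂⟩
      refine ⟨max k₁ k₂, lt_max_of_lt_left hk₁, IsBigOZero.union hr hr le_rfl le_rfl
        (fun ε hε => ?_) (fun ε hε => ?_) H₁ H₂⟩
      · exact assoc_mono W (div_pos hk₁ hε) (by gcongr; exact le_max_left _ _)
      · exact assoc_mono W (div_pos hk₂ hε) (by gcongr; exact le_max_right _ _)
    · intro x hx
      obtain ⟨U, hxU, hU⟩ := h x hx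
      exact ⟨U, hxU, fun K hK hKU => hU.2 K hK hKU r hr⟩
  · intro K hK hKΩ k hk
    refine compact_induction (p := fun K => ∃ r > 0, IsBigOZero (fun ε => ultraNorm W K r (f ε))
      fun ε => Real.exp (W.assoc (k / ε))) ⟨1, one_pos, isBigOZero_empty⟩ ?_ ?_ ?_ hK hKΩ
    · rintro S T hST ⟨r, hr, H⟩
      exact ⟨r, hr, H.mono fun _ => ultraNorm_mono hST⟩
    · rintro S T ⟨r₁, hr₁, H₁⟩ ⟨r₂, hr₂, H₂⟩
      exact ⟨max r₁ r₂, lt_max_of_lt_left hr₁, IsBigOZero.union hr₁ hr₂ (le_max_left _ _)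
        (le_max_right _ _) (fun ε hε => le_rfl) (fun ε hε => le_rfl) H₁ H₂⟩
    · intro x hx
      obtain ⟨U, hxU, hU⟩ := h x hx
      exact ⟨U, hxU, fun K hK hKU => hU.2 K hK hKU k hk⟩

theorem IsNegligible.of_locally {f : Net d}
    (h : ∀ x ∈ Ω, ∃ U : Opens (E d), x ∈ U ∧ IsNegligible W s U f) : IsNegligible W s Ω f := by
  refine ⟨fun ε => IsUltradiff.of_locally fun x hx => ?_, ?_⟩
  · obtain ⟨U, hxU, hU⟩ := h x hx
    exact ⟨U, hxU, hU.1 ε⟩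
  cases s
  · intro K hK hKΩ r hr k hk
    refine compact_induction (p := fun K => IsBigOZero (fun ε => ultraNorm W K r (f ε))
      fun ε => Real.exp (-W.assoc (k / ε))) isBigOZero_empty ?_ ?_ ?_ hK hKΩ
    · exact fun S T hST H => H.mono fun _ => ultraNorm_mono hST
    · exact fun S T H₁ H₂ => IsBigOZero.union hr hr le_rfl le_rfl
        (fun ε hε => le_rfl) (fun ε hε => le_rfl) H₁ H₂
    · intro x hx
      obtain ⟨U, hxU, hU⟩ := h x hx
      exact ⟨U, hxU, fun K hK hKU => hU.2 K hK hKU r hr k hk⟩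
  · intro K hK hKΩ
    refine compact_induction (p := fun K => ∃ k > 0, ∃ r > 0, IsBigOZero
      (fun ε => ultraNorm W K r (f ε)) fun ε => Real.exp (-W.assoc (k / ε)))
      ⟨1, one_pos, 1, one_pos, isBigOZero_empty⟩ ?_ ?_ ?_ hK hKΩ
    · rintro S T hST ⟨k, hk, r, hr, H⟩
      exact ⟨k, hk, r, hr, H.mono fun _ => ultraNorm_mono hST⟩
    · rintro S T ⟨k₁, hk₁, r₁, hr₁, H₁⟩ ⟨k₂, hk₂, r₂, hr₂, H₂⟩
      refine ⟨min k₁ k₂, lt_min hk₁ hk₂, max r₁ r₂, lt_max_of_lt_left hr₁, IsBigOZero.union hr₁ hr₂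
        (le_max_left _ _) (le_max_right _ _) (fun ε hε => ?_) (fun ε hε => ?_) H₁ H₂⟩
      · exact neg_le_neg (assoc_mono W (div_pos (lt_min hk₁ hk₂) hε)
          (by gcongr; exact min_le_left _ _))
      · exact neg_le_neg (assoc_mono W (div_pos (lt_min hk₁ hk₂) hε)
          (by gcongr; exact min_le_right _ _))
    · intro x hx
      obtain ⟨U, hxU, hU⟩ := h x hx
      exact ⟨U, hxU, hU.2⟩

theorem IsUltradiff.mono {Ω' : Opens (E d)} (hle : Ω' ≤ Ω) {f : E d → ℂ}
    (hf : IsUltradiff W s Ω f) : IsUltradiff W s Ω' f := by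
  have hle' : (Ω' : Set (E d)) ⊆ Ω := hle
  cases s
  · exact ⟨hf.1.mono hle, fun K hK h => hf.2 K hK (h.trans hle')⟩
  · exact ⟨hf.1.mono hle, fun K hK h => hf.2 K hK (h.trans hle')⟩

theorem IsUltradiff.of_beurling {f : E d → ℂ} (hf : IsUltradiff W .beurling Ω f) :
    IsUltradiff W s Ω f := by
  cases s
  · exact hf
  · exact ⟨hf.1, fun K hK hKΩ => ⟨1, one_pos, hf.2 K hK hKΩ 1 one_pos⟩⟩

theorem IsUltradiff.const_mul {f : E d → ℂ} (c : ℂ) (hf : IsUltradiff W s Ω f) :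
    IsUltradiff W s Ω fun x => c * f x :=
  (isUltradiff_const c).mul hf

/-- The constant net of an ultradifferentiable function of Beurling class is moderate. -/
theorem isModerate_of_beurling {f : E d → ℂ} (hf : IsUltradiff W .beurling Ω f) :
    IsModerate W s Ω fun _ => f := by
  have key : ∀ K : Set (E d), IsCompact K → K ⊆ Ω → ∀ r k : ℝ, 0 < r → 0 < k →
      IsBigOZero (fun _ => ultraNorm W K r f) fun ε => Real.exp (W.assoc (k / ε)) := by
    intro K hK hKΩ r k hr hk
    obtain ⟨C, hC, H⟩ := lt_top_iff_exists.1 (hf.2 K hK hKΩ r hr)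
    refine ⟨C + 1, by positivity, 1, one_pos, fun ε _ =>
      H.trans (ENNReal.ofReal_le_ofReal ?_)⟩
    have h1 : 1 ≤ Real.exp (W.assoc (k / ε)) :=
      Real.one_le_exp (assoc_nonneg W (div_pos hk ε.2.1))
    nlinarith
  refine ⟨fun _ => hf.of_beurling, ?_⟩
  cases s
  · exact fun K hK hKΩ h hh => ⟨1, one_pos, key K hK hKΩ h 1 hh one_pos⟩
  · exact fun K hK hKΩ k hk => ⟨1, one_pos, key K hK hKΩ 1 k one_pos hk⟩

end locality

/-! ### A smooth step function of Beurling class -/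

section step

open Filter Topology

/-- A summable positive series can be multiplied by a sequence tending to infinity. -/
theorem exists_tendsto_atTop_summable_mul {x : ℕ → ℝ} (hx : ∀ n, 0 < x n) (hs : Summable x) :
    ∃ c : ℕ → ℝ, (∀ n, 0 < c n) ∧ Tendsto c atTop atTop ∧ Summable fun n => c n * x n := by
  set R : ℕ → ℝ := fun n => ∑' k, x (k + n) with hR
  have hsn : ∀ n, Summable fun k => x (k + n) := fun n => (summable_nat_add_iff n).2 hs
  have hRpos : ∀ n, 0 < R n := fun n => (hsn n).tsum_pos (fun k => (hx _).le) 0 (hx _)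
  have hstep : ∀ n, R n = x n + R (n + 1) := by
    intro n
    rw [hR]
    simp only
    rw [(hsn n).tsum_eq_zero_add]
    simp only [zero_add, add_right_inj]
    congr 1; ext k; congr 1; ring
  have hlim : Tendsto R atTop (𝓝 0) := tendsto_sum_nat_add x
  have hsq : Tendsto (fun n => √(R n)) atTop (𝓝 0) := by
    simpa using hlim.sqrt
  -- The weights are the inverse square roots of the tails `R n`. Since `x n = R n - R (n + 1)`, the
  -- weighted terms are dominated by the telescoping differences `2 * (√(R n) - √(R (n + 1)))`.
  refine ⟨fun n => (√(R n))⁻¹, fun n => inv_pos.2 (Real.sqrt_pos.2 (hRpos n)), ?_, ?_⟩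
  · refine tendsto_inv_nhdsGT_zero.comp (tendsto_nhdsWithin_iff.2 ⟨hsq, ?_⟩)
    exact Eventually.of_forall fun n => Real.sqrt_pos.2 (hRpos n)
  · refine summable_of_sum_range_le (c := 2 * √(R 0))
      (fun n => (mul_pos (inv_pos.2 (Real.sqrt_pos.2 (hRpos n))) (hx n)).le) fun n => ?_
    have key : ∀ n, (√(R n))⁻¹ * x n ≤ 2 * (√(R n) - √(R (n + 1))) := by
      intro n
      have h1 := Real.sqrt_pos.2 (hRpos n)
      have h2 := Real.sqrt_pos.2 (hRpos (n + 1))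
      have h3 := Real.sq_sqrt (hRpos n).le
      have h4 := Real.sq_sqrt (hRpos (n + 1)).le
      have h5 := hstep n
      have h6 : √(R (n + 1)) ≤ √(R n) := Real.sqrt_le_sqrt (by linarith [hx n])
      rw [inv_mul_le_iff₀ h1]
      nlinarith
    have : ∀ n, ∑ i ∈ Finset.range n, (√(R i))⁻¹ * x i ≤ 2 * (√(R 0) - √(R n)) := by
      intro n
      induction n with
      | zero => simp
      | succ n ih => rw [Finset.sum_range_succ]; linarith [key n]
    linarith [this n, Real.sqrt_nonneg (R n)]

/-- Divided by `h ^ n`, the products have consecutive ratios `b n / h`, which tend to `0`; the ratio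
test makes them summable, hence bounded. This supplies the quantifier "for all `h`" of the Beurling
class. -/
theorem exists_prod_le_mul_pow {b : ℕ → ℝ} (hb : ∀ n, 0 < b n) (hlim : Tendsto b atTop (𝓝 0))
    {h : ℝ} (hh : 0 < h) : ∃ C > 0, ∀ n, ∏ j ∈ Finset.range n, b j ≤ C * h ^ n := by
  have hs : Summable fun n => (∏ j ∈ Finset.range n, b j) / h ^ n := by
    refine summable_of_ratio_norm_eventually_le (r := 1 / 2) (by norm_num) ?_
    filter_upwards [hlim.eventually (gt_mem_nhds (show 0 < h / 2 by positivity))] with n hn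
    have hp : 0 < ∏ j ∈ Finset.range n, b j := Finset.prod_pos fun j _ => hb j
    rw [Finset.prod_range_succ, Real.norm_of_nonneg (by have := hb n; positivity),
      Real.norm_of_nonneg (by positivity), pow_succ, ← div_mul_div_comm, mul_comm]
    refine mul_le_mul_of_nonneg_right ?_ (by positivity)
    rw [div_le_iff₀ hh]
    linarith
  obtain ⟨C, hC⟩ := hs.tendsto_atTop_zero.bddAbove_range
  refine ⟨max C 1, lt_max_of_lt_right one_pos, fun n => ?_⟩
  have := hC ⟨n, rfl⟩
  simp only at this
  rw [div_le_iff₀ (by positivity)] at this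
  exact this.trans (by gcongr; exact le_max_left _ _)

/-- The average of `u` over `[x - a, x]`. -/
def average (a : ℝ) (u : ℝ → ℝ) (x : ℝ) : ℝ := ∫ t in (0 : ℝ)..1, u (x - a * t)

/-- A change of variables writes the average as a difference quotient of a primitive of `u`.
Differentiating thus removes one average in exchange for a difference quotient of `u`, at the price
of a factor `2 / a` in the sup norm. -/
theorem hasDerivAt_average {a : ℝ} (ha : a ≠ 0) {u : ℝ → ℝ} (hu : Continuous u) (x : ℝ) :
    HasDerivAt (average a u) ((u x - u (x - a)) / a) x := by
  have e : average a u = fun x =>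
      a⁻¹ * ((∫ t in (0 : ℝ)..x, u t) - ∫ t in (0 : ℝ)..(x - a), u t) := by
    funext x
    rw [average, intervalIntegral.integral_comp_sub_mul _ ha,
      intervalIntegral.integral_interval_sub_left (hu.intervalIntegrable _ _)
        (hu.intervalIntegrable _ _)]
    simp
  rw [e, div_eq_inv_mul]
  have h1 : ∀ y, HasDerivAt (fun x => ∫ t in (0 : ℝ)..x, u t) (u y) y := fun y =>
    intervalIntegral.integral_hasDerivAt_right (hu.intervalIntegrable _ _)
      (hu.stronglyMeasurableAtFilter _ _) hu.continuousAt
  exact ((h1 x).sub ((h1 (x - a)).comp_sub_const x a)).const_mul _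

theorem average_sub {a : ℝ} {u v : ℝ → ℝ} (hu : Continuous u) (hv : Continuous v) (x : ℝ) :
    average a u x - average a v x = ∫ t in (0 : ℝ)..1, (u (x - a * t) - v (x - a * t)) :=
  (intervalIntegral.integral_sub ((by fun_prop : Continuous _).intervalIntegrable _ _)
    ((by fun_prop : Continuous _).intervalIntegrable _ _)).symm

/-- Allowing two functions and two points at once lets one lemma carry the Lipschitz bound, the
Cauchy estimate and the sup bound through each averaging. Translating `v` by `y - x` reduces it to a
single point. -/
theorem abs_average_sub_le {a C : ℝ} {u v : ℝ → ℝ} (hu : Continuous u) (hv : Continuous v)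
    (x y : ℝ) (h : ∀ t ∈ Set.Icc (0 : ℝ) 1, |u (x - a * t) - v (y - a * t)| ≤ C) :
    |average a u x - average a v y| ≤ C := by
  have e : average a v y = average a (fun z => v (z + (y - x))) x := by
    simp only [average]
    congr 1; ext t; congr 1; ring
  rw [e, average_sub hu (by fun_prop)]
  have := intervalIntegral.norm_integral_le_of_norm_le_const (a := 0) (b := 1) (C := C)
    (f := fun t => u (x - a * t) - v (x - a * t + (y - x))) (fun t ht => ?_)
  · simpa using this
  · rw [Set.uIoc_of_le zero_le_one] at ht
    have := h t ⟨ht.1.le, ht.2⟩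
    rwa [show y - a * t = x - a * t + (y - x) by ring] at this

theorem average_const {a c : ℝ} {u : ℝ → ℝ} (x : ℝ)
    (h : ∀ t ∈ Set.Icc (0 : ℝ) 1, u (x - a * t) = c) : average a u x = c := by
  rw [average, intervalIntegral.integral_congr (g := fun _ => c)]
  · simp
  · rw [Set.uIcc_of_le zero_le_one]
    exact h

/-- The piecewise linear step function. -/
def ramp (x : ℝ) : ℝ := max 0 (min 1 x)

/-- Iterated averages of the ramp function. -/
def iterAverage (a : ℕ → ℝ) : ℕ → ℕ → ℝ → ℝ
  | _, 0 => ramp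
  | m, n + 1 => average (a m) (iterAverage a (m + 1) n)

theorem abs_ramp_sub_le (x y : ℝ) : |ramp x - ramp y| ≤ |x - y| := by
  unfold ramp
  refine (abs_max_sub_max_le_max _ _ _ _).trans ?_
  have := abs_min_sub_min_le_max 1 x 1 y
  simp only [sub_self, abs_zero] at this ⊢
  rw [max_eq_right (abs_nonneg _)] at this ⊢
  exact this

theorem continuous_of_abs_sub_le {u : ℝ → ℝ} (h : ∀ x y, |u x - u y| ≤ |x - y|) :
    Continuous u :=
  (LipschitzWith.of_dist_le_mul (K := 1) fun x y => by
    simpa [Real.dist_eq] using h x y).continuous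

theorem iterAverage_lip (a : ℕ → ℝ) (n : ℕ) : ∀ m x y,
    |iterAverage a m n x - iterAverage a m n y| ≤ |x - y| := by
  induction n with
  | zero => exact fun m => abs_ramp_sub_le
  | succ n ih =>
    intro m x y
    have hc := continuous_of_abs_sub_le (ih (m + 1))
    refine abs_average_sub_le hc hc x y fun t _ => (ih _ _ _).trans (le_of_eq ?_)
    congr 1; ring

theorem continuous_iterAverage (a : ℕ → ℝ) (m n : ℕ) : Continuous (iterAverage a m n) :=
  continuous_of_abs_sub_le (iterAverage_lip a n m)

/-- The two sides differ only in the innermost average, of length `a (m + n)`, which moves the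
1-Lipschitz ramp by at most that length; the outer averages do not increase the sup distance. -/
theorem abs_iterAverage_succ_sub_le {a : ℕ → ℝ} (ha : ∀ n, 0 < a n) (n : ℕ) : ∀ m x,
    |iterAverage a m (n + 1) x - iterAverage a m n x| ≤ a (m + n) := by
  induction n with
  | zero =>
    intro m x
    have hc : Continuous ramp := continuous_of_abs_sub_le abs_ramp_sub_le
    change |average (a m) ramp x - ramp x| ≤ _
    have e : ramp x = average (a m) (fun _ => ramp x) x := (average_const x fun _ _ => rfl).symm
    rw [e]
    refine abs_average_sub_le hc continuous_const x x fun t ht => (abs_ramp_sub_le _ _).trans ?_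
    have := (ha m).le
    rw [show x - a m * t - x = -(a m * t) by ring, abs_neg,
      abs_of_nonneg (mul_nonneg this ht.1), add_zero]
    exact mul_le_of_le_one_right this ht.2
  | succ n ih =>
    intro m x
    refine abs_average_sub_le (continuous_iterAverage a _ _) (continuous_iterAverage a _ _) x x
      fun t _ => (ih _ _).trans (le_of_eq ?_)
    congr 1; ring

theorem iterAverage_eq_zero {a : ℕ → ℝ} (ha : ∀ n, 0 < a n) (n : ℕ) : ∀ m, ∀ x ≤ 0,
    iterAverage a m n x = 0 := by
  induction n with
  | zero => exact fun m x hx => max_eq_left ((min_le_right _ _).trans hx)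
  | succ n ih =>
    exact fun m x hx => average_const x fun t ht =>
      ih _ _ (by nlinarith [mul_nonneg (ha m).le ht.1])

/-- Averages look to the left only, so each one delays the plateau at height one by its length,
while the zero set on the left is preserved. -/
theorem iterAverage_eq_one {a : ℕ → ℝ} (ha : ∀ n, 0 < a n) (n : ℕ) : ∀ m,
    ∀ x ≥ 1 + ∑ j ∈ Finset.range n, a (m + j), iterAverage a m n x = 1 := by
  induction n with
  | zero =>
    intro m x hx
    simp only [Finset.range_zero, Finset.sum_empty, add_zero] at hx
    simp [iterAverage, ramp, min_eq_left hx]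
  | succ n ih =>
    intro m x hx
    refine average_const x fun t ht => ih _ _ ?_
    rw [Finset.sum_range_succ'] at hx
    have : a m * t ≤ a m := mul_le_of_le_one_right (ha m).le ht.2
    have e : ∑ j ∈ Finset.range n, a (m + 1 + j) = ∑ j ∈ Finset.range n, a (m + (j + 1)) :=
      Finset.sum_congr rfl fun j _ => by congr 1; ring
    rw [e]
    simp only [add_zero] at hx
    linarith

theorem abs_iterAverage_le {a : ℕ → ℝ} (n : ℕ) : ∀ m x, |iterAverage a m n x| ≤ 1 := by
  induction n with
  | zero =>
    intro m x
    simp only [iterAverage, ramp]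
    rw [abs_of_nonneg (le_max_left _ _)]
    exact max_le zero_le_one (min_le_left _ _)
  | succ n ih =>
    intro m x
    have := abs_average_sub_le (a := a m) (continuous_iterAverage a (m + 1) n)
      (continuous_const (y := (0 : ℝ))) x x (C := 1) fun t _ => by simpa using ih _ _
    rwa [average_const (u := fun _ => (0 : ℝ)) x (fun _ _ => rfl), sub_zero] at this

/-- Successive averages over shorter and shorter intervals have a limit. -/
theorem exists_average_fixed {a : ℕ → ℝ} (ha : ∀ n, 0 < a n) (hs : Summable a) :
    ∃ Φ : ℕ → ℝ → ℝ, (∀ m, Continuous (Φ m)) ∧ (∀ m x, |Φ m x| ≤ 1) ∧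
      (∀ m, Φ m = average (a m) (Φ (m + 1))) ∧ (∀ x ≤ 0, Φ 0 x = 0) ∧
      ∀ x ≥ 1 + ∑' j, a j, Φ 0 x = 1 := by
  have hlim : ∀ m x, ∃ l, Tendsto (fun n => iterAverage a m n x) atTop (𝓝 l) := by
    intro m x
    refine cauchySeq_tendsto_of_complete
      (cauchySeq_of_dist_le_of_summable (fun n => a (m + n)) (fun n => ?_) ?_)
    · rw [dist_comm, Real.dist_eq]
      exact abs_iterAverage_succ_sub_le ha n m x
    · simpa only [add_comm] using (summable_nat_add_iff m).2 hs
  choose Φ hΦ using hlim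
  have hlip : ∀ m x y, |Φ m x - Φ m y| ≤ |x - y| := fun m x y =>
    le_of_tendsto ((hΦ m x).sub (hΦ m y)).abs
      (Eventually.of_forall fun n => iterAverage_lip a n m x y)
  refine ⟨Φ, fun m => continuous_of_abs_sub_le (hlip m), fun m x =>
    le_of_tendsto (hΦ m x).abs (Eventually.of_forall fun n => abs_iterAverage_le n m x),
    fun m => funext fun x => ?_, fun x hx => ?_, fun x hx => ?_⟩
  -- With the index shifted by one, the approximants of `Φ m` are averages over length `a m` of
  -- those of `Φ (m + 1)`; dominated convergence with bound `1` passes this relation to the limit.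
  · refine tendsto_nhds_unique ((tendsto_add_atTop_iff_nat 1).2 (hΦ m x)) ?_
    refine intervalIntegral.tendsto_integral_filter_of_dominated_convergence (fun _ => 1)
      ?_ ?_ ?_ ?_
    · exact Eventually.of_forall fun n => ((continuous_iterAverage a (m + 1) n).comp
        (by fun_prop : Continuous fun t => x - a m * t)).aestronglyMeasurable
    · exact Eventually.of_forall fun n => MeasureTheory.ae_of_all _ fun t _ =>
        abs_iterAverage_le n _ _
    · simp
    · exact MeasureTheory.ae_of_all _ fun t _ => hΦ _ _
  · exact tendsto_nhds_unique (hΦ 0 x)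
      (tendsto_const_nhds.congr fun n => (iterAverage_eq_zero ha n 0 x hx).symm)
  · refine tendsto_nhds_unique (hΦ 0 x)
      (tendsto_const_nhds.congr fun n => (iterAverage_eq_one ha n 0 x ?_).symm)
    refine le_trans ?_ hx
    simp only [zero_add]
    linarith [hs.sum_le_tsum (Finset.range n) fun j _ => (ha j).le]

/-- Iterated difference quotients. -/
def diffQuot (a : ℕ → ℝ) : ℕ → (ℝ → ℝ) → ℝ → ℝ
  | 0, u => u
  | k + 1, u => diffQuot a k fun x => (u x - u (x - a k)) / a k

/-- Difference quotients are combinations of translations, which commute with differentiation. -/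
theorem hasDerivAt_diffQuot (a : ℕ → ℝ) (k : ℕ) : ∀ {u u' : ℝ → ℝ},
    (∀ x, HasDerivAt u (u' x) x) → ∀ x, HasDerivAt (diffQuot a k u) (diffQuot a k u' x) x := by
  induction k with
  | zero => exact fun h => h
  | succ k ih =>
    exact fun h => ih fun x => ((h x).sub ((h (x - a k)).comp_sub_const x (a k))).div_const _

theorem abs_diffQuot_le {a : ℕ → ℝ} (ha : ∀ n, 0 < a n) (k : ℕ) : ∀ {u : ℝ → ℝ} {B : ℝ},
    (∀ x, |u x| ≤ B) → ∀ x, |diffQuot a k u x| ≤ (∏ j ∈ Finset.range k, 2 / a j) * B := by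
  induction k with
  | zero => exact fun h => by simpa [diffQuot] using h
  | succ k ih =>
    intro u B h x
    rw [Finset.prod_range_succ, mul_assoc]
    refine ih (fun y => ?_) x
    rw [abs_div, abs_of_pos (ha k), div_mul_eq_mul_div]
    have := ha k
    gcongr
    calc |u y - u (y - a k)| ≤ |u y| + |u (y - a k)| := abs_sub _ _
      _ ≤ 2 * B := by linarith [h y, h (y - a k)]

theorem WeightSequence.prod_ratio (W : WeightSequence) (n : ℕ) :
    ∏ j ∈ Finset.range n, W.M (j + 1) / W.M j = W.M n := by
  induction n with
  | zero => simp [W.zero]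
  | succ n ih => rw [Finset.prod_range_succ, ih, mul_div_cancel₀ _ (W.pos n).ne']

/-- A step function of Beurling class, given with all its derivatives. -/
theorem exists_step (W : WeightSequence) : ∃ D : ℕ → ℝ → ℝ,
    (∀ n x, HasDerivAt (D n) (D (n + 1) x) x) ∧
    (∀ h > 0, ∃ C > 0, ∀ n x, |D n x| ≤ C * (h ^ n * W.M n)) ∧
    (∀ x ≤ 0, D 0 x = 0) ∧ ∀ x ≥ 1, D 0 x = 1 := by
  obtain ⟨c, hc, hct, hcs⟩ := exists_tendsto_atTop_summable_mul
    (fun n => div_pos (W.pos n) (W.pos (n + 1))) W.m3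
  -- The lengths remain summable although they exceed the ratios `M n / M (n + 1)` by factors `c n`
  -- tending to infinity. In `∏ 2 / a j` the ratios multiply to `M n`, and the extra `∏ 2 / c j` is
  -- smaller than any geometric sequence, up to a constant.
  set a : ℕ → ℝ := fun n => c n * (W.M n / W.M (n + 1)) with ha_def
  have ha : ∀ n, 0 < a n := fun n => mul_pos (hc n) (div_pos (W.pos n) (W.pos (n + 1)))
  obtain ⟨Φ, hΦc, hΦ1, hΦa, hΦ0, hΦ2⟩ := exists_average_fixed ha hcs
  -- `S` bounds the width of the transition: one for the ramp plus all averaging lengths. Rescaling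
  -- by `S` moves the transition into `[0, 1]`.
  set S : ℝ := 1 + ∑' j, a j with hS
  have hSpos : 0 < S := by linarith [hcs.tsum_pos (fun j => (ha j).le) 0 (ha 0)]
  -- Each differentiation peels off one average, so the `n`-th derivative of `Φ 0` is an `n`-fold
  -- difference quotient of the bounded function `Φ n`.
  have hder : ∀ n x, HasDerivAt (diffQuot a n (Φ n)) (diffQuot a (n + 1) (Φ (n + 1)) x) x := by
    intro n x
    refine hasDerivAt_diffQuot a n (fun x => ?_) x
    rw [hΦa n]
    exact hasDerivAt_average (ha n).ne' (hΦc (n + 1)) x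
  refine ⟨fun n x => S ^ n * diffQuot a n (Φ n) (S * x), fun n x => ?_, fun h hh => ?_, ?_, ?_⟩
  · have := ((hder n (S * x)).comp x ((hasDerivAt_id x).const_mul S)).const_mul (S ^ n)
    convert! this using 1
    simp only [pow_succ]; ring
  · have hb : ∀ n, 0 < 2 * S / c n := fun n => by have := hc n; positivity
    obtain ⟨C, hC, H⟩ := exists_prod_le_mul_pow hb (hct.const_div_atTop (2 * S)) hh
    refine ⟨C, hC, fun n x => ?_⟩
    have h1 := abs_diffQuot_le ha n (hΦ1 n) (S * x)
    rw [mul_one] at h1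
    rw [abs_mul, abs_of_pos (pow_pos hSpos n)]
    calc S ^ n * |diffQuot a n (Φ n) (S * x)|
        ≤ S ^ n * ∏ j ∈ Finset.range n, 2 / a j := by gcongr
      _ = (∏ j ∈ Finset.range n, 2 * S / c j) * ∏ j ∈ Finset.range n, W.M (j + 1) / W.M j := by
          rw [← Finset.prod_mul_distrib, ← Finset.card_range n, ← Finset.prod_const,
            Finset.card_range, ← Finset.prod_mul_distrib]
          refine Finset.prod_congr rfl fun j _ => ?_
          have := (hc j).ne'
          have := (W.pos j).ne'
          have := (W.pos (j + 1)).ne'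
          rw [ha_def]
          field_simp
      _ ≤ C * h ^ n * W.M n := by
          rw [W.prod_ratio]
          exact mul_le_mul_of_nonneg_right (H n) (W.pos n).le
      _ = _ := by ring
  · intro x hx
    simpa [diffQuot] using hΦ0 _ (mul_nonpos_of_nonneg_of_nonpos hSpos.le hx)
  · intro x hx
    simpa [diffQuot] using hΦ2 (S * x) (le_mul_of_one_le_right hSpos.le hx)

end step

/-! ### Smooth families and bump functions -/

section families

variable {W : WeightSequence} {Ω : Opens (E d)}

/-- The linear form with partial derivatives `c i`. -/
def gradForm (c : Fin d → ℂ) : E d →L[ℝ] ℂ :=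
  ∑ i, (EuclideanSpace.proj i : E d →L[ℝ] ℝ).smulRight (c i)

theorem gradForm_apply (c : Fin d → ℂ) (v : E d) : gradForm c v = ∑ i, v i • c i := by
  simp [gradForm]

theorem gradForm_single (c : Fin d → ℂ) (i : Fin d) :
    gradForm c (EuclideanSpace.single i 1) = c i := by
  rw [gradForm_apply, Finset.sum_eq_single i]
  · simp
  · intro j _ hj
    simp [hj]
  · simp

theorem eq_gradForm (L : E d →L[ℝ] ℂ) : L = gradForm fun i => L (EuclideanSpace.single i 1) := by
  refine ContinuousLinearMap.ext fun v => ?_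
  have hv : v = ∑ i, v i • (EuclideanSpace.single i (1 : ℝ) : E d) := by
    ext j
    simp [Finset.sum_apply, Pi.single_apply]
  conv_lhs => rw [hv, map_sum]
  rw [gradForm_apply]
  exact Finset.sum_congr rfl fun i _ => L.map_smul _ _

/-- A function with a full family of iterated partial derivatives is smooth. -/
theorem smooth_of_family {G : List (Fin d) → E d → ℂ}
    (hG : ∀ w, ∀ x ∈ Ω, HasFDerivAt (G w) (gradForm fun i => G (i :: w) x) x) :
    (∀ w, ContDiffOn ℝ ∞ (G w) Ω) ∧ ∀ w, Set.EqOn (wderiv w (G [])) (G w) Ω := by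
  constructor
  -- The induction on the order of smoothness treats all words at once, since the derivative of `G
  -- w` is assembled from the longer words `i :: w`.
  · have key : ∀ n : ℕ, ∀ w, ContDiffOn ℝ n (G w) Ω := by
      intro n
      induction n with
      | zero =>
        exact fun w => contDiffOn_zero.2 fun x hx => (hG w x hx).continuousAt.continuousWithinAt
      | succ n ih =>
        intro w
        rw [Nat.cast_add, Nat.cast_one, contDiffOn_succ_iff_fderiv_of_isOpen Ω.isOpen]
        refine ⟨fun x hx => (hG w x hx).differentiableAt.differentiableWithinAt, by simp, ?_⟩
        refine ContDiffOn.congr (f := fun x => gradForm fun i => G (i :: w) x) ?_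
          fun x hx => (hG w x hx).fderiv
        unfold gradForm
        exact ContDiffOn.sum fun i _ =>
          (ContinuousLinearMap.smulRightL ℝ (E d) ℂ (EuclideanSpace.proj i)).contDiff.comp_contDiffOn
            (ih (i :: w))
    exact fun w => contDiffOn_infty.2 fun n => key n w
  · intro w
    induction w with
    | nil => exact fun _ _ => rfl
    | cons i w ih =>
      intro x hx
      rw [wderiv, pderiv_congr ih i hx, pderiv, (hG w x hx).fderiv, gradForm_single]

/-- A function of one coordinate has vanishing derivative along any word containing another letter;
along the remaining words the chain rule contributes `c ^ w.length`, absorbed by applying the bound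
with `h / |c|`. -/
theorem isUltradiff_coord {D : ℕ → ℝ → ℝ} (hD : ∀ n x, HasDerivAt (D n) (D (n + 1) x) x)
    (hb : ∀ h > 0, ∃ C > 0, ∀ n x, |D n x| ≤ C * (h ^ n * W.M n)) (j : Fin d) {c : ℝ}
    (hc : c ≠ 0) (b : ℝ) :
    IsUltradiff W .beurling ⊤ fun x : E d => ((D 0 (c * x j + b) : ℝ) : ℂ) := by
  set G : List (Fin d) → E d → ℂ := fun w x =>
    if ∀ i ∈ w, i = j then ((c ^ w.length * D w.length (c * x j + b) : ℝ) : ℂ) else 0 with hGdef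
  have hG : ∀ w, ∀ x ∈ (⊤ : Opens (E d)),
      HasFDerivAt (G w) (gradForm fun i => G (i :: w) x) x := by
    intro w x _
    by_cases hw : ∀ i ∈ w, i = j
    · have h1 : HasDerivAt (fun t : ℝ => ((c ^ w.length * D w.length (c * t + b) : ℝ) : ℂ))
          ((c ^ (w.length + 1) * D (w.length + 1) (c * x j + b) : ℝ) : ℂ) (x j) := by
        have := (((hD w.length (c * x j + b)).comp (x j)
          (((hasDerivAt_id (x j)).const_mul c).add_const b)).const_mul (c ^ w.length)).ofReal_comp
        convert! this using 1
        rw [pow_succ, mul_one]; congr 1; ring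
      have h2 := h1.hasFDerivAt.comp x (EuclideanSpace.proj j : E d →L[ℝ] ℝ).hasFDerivAt
      convert! h2 using 1
      · funext y
        simp only [hGdef]
        rw [if_pos hw]
        rfl
      · refine ContinuousLinearMap.ext fun v => ?_
        rw [gradForm_apply, Finset.sum_eq_single j]
        · simp only [hGdef]
          rw [if_pos (by simpa using hw)]
          simp
        · intro i _ hi
          simp only [hGdef]
          rw [if_neg (by simp [hi]), smul_zero]
        · simp
    · have e1 : G w = fun _ => 0 := by
        funext y
        simp only [hGdef]
        rw [if_neg hw]
      have e2 : (gradForm fun i => G (i :: w) x) = 0 := by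
        refine ContinuousLinearMap.ext fun v => ?_
        rw [gradForm_apply]
        refine Finset.sum_eq_zero fun i _ => ?_
        simp only [hGdef]
        rw [if_neg (fun h => hw fun k hk => h k (List.mem_cons_of_mem _ hk)), smul_zero]
      rw [e1, e2]
      exact hasFDerivAt_const _ _
  obtain ⟨hs, hw⟩ := smooth_of_family hG
  have e0 : (fun x : E d => ((D 0 (c * x j + b) : ℝ) : ℂ)) = G [] := by
    funext x
    simp [hGdef]
  rw [e0]
  refine ⟨hs [], fun K _ hK h hh => ?_⟩
  obtain ⟨C, hC, H⟩ := hb (h / |c|) (by positivity)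
  refine lt_top_iff_exists.2 ⟨C, hC.le, ?_⟩
  rw [ultraNorm_le_iff_word (hs []) hK hh hC.le]
  intro x _ w
  rw [hw w (Set.mem_univ x)]
  simp only [hGdef]
  have hM := W.pos w.length
  split_ifs
  · rw [Complex.norm_real, Real.norm_eq_abs, abs_mul, abs_pow]
    calc |c| ^ w.length * |D w.length (c * x j + b)|
        ≤ |c| ^ w.length * (C * ((h / |c|) ^ w.length * W.M w.length)) := by gcongr; exact H _ _
      _ = _ := by
        rw [div_pow]
        have : |c| ^ w.length ≠ 0 := by positivity
        field_simp
  · rw [norm_zero]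
    positivity

theorem IsUltradiff.prod {s : UltraType} {ι : Type*} {f : ι → E d → ℂ} {t : Finset ι}
    (h : ∀ i ∈ t, IsUltradiff W s Ω (f i)) : IsUltradiff W s Ω (∏ i ∈ t, f i) := by
  classical
  induction t using Finset.induction_on with
  | empty => exact isUltradiff_const 1
  | insert i t hi ih =>
    rw [Finset.prod_insert hi]
    exact (h i (Finset.mem_insert_self _ _)).mul
      (ih fun j hj => h j (Finset.mem_insert_of_mem hj))

theorem IsUltradiff.sum {s : UltraType} {ι : Type*} {f : ι → E d → ℂ} {t : Finset ι}
    (h : ∀ i ∈ t, IsUltradiff W s Ω (f i)) : IsUltradiff W s Ω (∑ i ∈ t, f i) := by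
  classical
  induction t using Finset.induction_on with
  | empty => exact isUltradiff_const 0
  | insert i t hi ih =>
    rw [Finset.sum_insert hi]
    exact (h i (Finset.mem_insert_self _ _)).add
      (ih fun j hj => h j (Finset.mem_insert_of_mem hj))

theorem IsUltradiff.one_sub {s : UltraType} {f : E d → ℂ} (hf : IsUltradiff W s Ω f) :
    IsUltradiff W s Ω (1 - f) := by
  have := (isUltradiff_const (W := W) (s := s) (Ω := Ω) 1).add (hf.const_mul (-1))
  refine this.congr fun x _ => ?_
  simp [sub_eq_add_neg]

/-- Bump functions of Beurling class. -/
theorem exists_bump (W : WeightSequence) {U : Opens (E d)} {x₀ : E d} (hx₀ : x₀ ∈ U) :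
    ∃ ψ : E d → ℂ, IsUltradiff W .beurling ⊤ ψ ∧
      (∃ V : Opens (E d), x₀ ∈ V ∧ Set.EqOn ψ 1 V) ∧ IsCompact (tsupport ψ) ∧
      tsupport ψ ⊆ U := by
  obtain ⟨D, hD, hb, h0, h1⟩ := exists_step W
  obtain ⟨R, hR, hRU⟩ := Metric.nhds_basis_closedBall.mem_iff.1 (U.isOpen.mem_nhds hx₀)
  -- The bump lives on the cube of half-side `2 * r = R / (d + 1)`, which lies in the ball because
  -- `d * (R / (d + 1)) ^ 2 ≤ R ^ 2`. Using `d + 1` keeps the denominator positive when `d = 0`.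
  set r : ℝ := R / (2 * (d + 1)) with hr_def
  have hr : 0 < r := by positivity
  -- In each coordinate the two mirrored steps are both one where `|x j - x₀ j| ≤ r`, and one of
  -- them vanishes where `|x j - x₀ j| ≥ 2 * r`.
  set ψ : E d → ℂ := ∏ j : Fin d, ((fun x => ((D 0 (r⁻¹ * x j + (2 - r⁻¹ * x₀ j)) : ℝ) : ℂ)) *
    fun x => ((D 0 (-r⁻¹ * x j + (2 + r⁻¹ * x₀ j)) : ℝ) : ℂ)) with hψ
  have hsupp : tsupport ψ ⊆ Metric.closedBall x₀ R := by
    refine closure_minimal (fun x hx => ?_) Metric.isClosed_closedBall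
    have hlt : ∀ j, |x j - x₀ j| ≤ 2 * r := by
      intro j
      by_contra! hj
      refine hx ?_
      rw [hψ, Finset.prod_apply]
      refine Finset.prod_eq_zero (Finset.mem_univ j) ?_
      rw [Pi.mul_apply]
      rcases lt_abs.1 hj with h | h
      · have : -r⁻¹ * x j + (2 + r⁻¹ * x₀ j) ≤ 0 := by
          have : r⁻¹ * (2 * r) ≤ r⁻¹ * (x j - x₀ j) := by gcongr
          rw [mul_comm 2 r, inv_mul_cancel_left₀ hr.ne'] at this
          linarith
        rw [h0 _ this]; simp
      · have : r⁻¹ * x j + (2 - r⁻¹ * x₀ j) ≤ 0 := by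
          have : r⁻¹ * (2 * r) ≤ r⁻¹ * -(x j - x₀ j) := by gcongr
          rw [mul_comm 2 r, inv_mul_cancel_left₀ hr.ne'] at this
          linarith
        rw [h0 _ this]; simp
    rw [Metric.mem_closedBall, dist_eq_norm]
    refine abs_le_of_sq_le_sq' ?_ hR.le |>.2
    rw [EuclideanSpace.real_norm_sq_eq]
    calc ∑ j, (x - x₀) j ^ 2 ≤ ∑ j : Fin d, (2 * r) ^ 2 :=
          Finset.sum_le_sum fun j _ => sq_le_sq' (abs_le.1 (hlt j)).1 (abs_le.1 (hlt j)).2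
      _ = d * (R / (d + 1)) ^ 2 := by
          rw [hr_def]
          simp
          field_simp
          norm_num
      _ ≤ R ^ 2 := by
          have hd : (0 : ℝ) ≤ d := Nat.cast_nonneg d
          rw [div_pow, mul_div_assoc', div_le_iff₀ (by positivity), mul_comm]
          gcongr
          nlinarith
  refine ⟨ψ, IsUltradiff.prod fun j _ => (isUltradiff_coord hD hb j (by positivity) _).mul
    (isUltradiff_coord hD hb j (neg_ne_zero.2 (by positivity)) _), ?_,
    (isCompact_closedBall x₀ R).of_isClosed_subset (isClosed_tsupport ψ) hsupp,
    hsupp.trans hRU⟩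
  refine ⟨⟨{x | ∀ j, |x j - x₀ j| < r}, ?_⟩, ?_, ?_⟩
  · simp only [Set.ofPred_forall]
    exact isOpen_iInter_of_finite fun j => isOpen_lt (by fun_prop) continuous_const
  · simp [hr]
  · intro x hx
    rw [hψ, Finset.prod_apply, Pi.one_apply]
    refine Finset.prod_eq_one fun j _ => ?_
    have hj := abs_lt.1 (hx j)
    have e1 : r⁻¹ * (x j - x₀ j) ≤ 1 := by
      rw [inv_mul_le_iff₀ hr]; linarith
    have e2 : -1 ≤ r⁻¹ * (x j - x₀ j) := by
      rw [le_inv_mul_iff₀ hr]; linarith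
    rw [Pi.mul_apply, h1 _ (by linarith), h1 _ (by linarith)]
    simp

/-- Partitions of unity of Beurling class subordinate to an open covering. -/
theorem exists_partition (W : WeightSequence) {ι : Type*} [Nonempty ι] (U : ι → Opens (E d)) :
    ∃ (χ : ℕ → E d → ℂ) (i : ℕ → ι), (∀ n, IsUltradiff W .beurling ⊤ (χ n)) ∧
      (∀ n, IsCompact (tsupport (χ n))) ∧ (∀ n, tsupport (χ n) ⊆ U (i n)) ∧
      ∀ x ∈ ⨆ i, U i, ∃ V : Opens (E d), x ∈ V ∧ ∃ N, (∀ n ≥ N, Set.EqOn (χ n) 0 V) ∧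
        ∀ n ≥ N, Set.EqOn (∑ m ∈ Finset.range n, χ m) 1 V := by
  have hbump : ∀ x : (⨆ i, U i : Opens (E d)), ∃ (i : ι) (ψ : E d → ℂ) (V : Opens (E d)),
      IsUltradiff W .beurling ⊤ ψ ∧ (x : E d) ∈ V ∧ Set.EqOn ψ 1 V ∧ IsCompact (tsupport ψ) ∧
      tsupport ψ ⊆ U i := by
    intro x
    obtain ⟨i, hi⟩ := Opens.mem_iSup.1 x.2
    obtain ⟨ψ, hψ, ⟨V, hV, h1⟩, h2⟩ := exists_bump W hi
    exact ⟨i, ψ, V, hψ, hV, h1, h2⟩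
  choose i ψ V hψ hxV hψ1 hc hsub using hbump
  rcases isEmpty_or_nonempty (⨆ i, U i : Opens (E d)) with hemp | hne
  · refine ⟨fun _ => 0, fun _ => Classical.arbitrary ι, fun _ => isUltradiff_const 0, ?_, ?_,
      fun x hx => (hemp.false ⟨x, hx⟩).elim⟩
    · exact fun _ => by simp [tsupport]
    · exact fun _ => by simp [tsupport]
  obtain ⟨T, hT, hTU⟩ := isOpen_iUnion_countable (fun x => (V x : Set (E d)))
    fun x => (V x).isOpen
  have hcov : ∀ x : (⨆ i, U i : Opens (E d)), ∃ y ∈ T, (x : E d) ∈ V y := by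
    intro x
    have : (x : E d) ∈ ⋃ x, (V x : Set (E d)) := Set.mem_iUnion.2 ⟨x, hxV x⟩
    rw [← hTU] at this
    simpa using this
  have hTne : T.Nonempty := by
    obtain ⟨y, hy, _⟩ := hcov hne.some
    exact ⟨y, hy⟩
  obtain ⟨e, rfl⟩ := hT.exists_eq_range hTne
  -- The partial sums telescope to `1 - ∏ (1 - ψ (e m))`. Where some `ψ (e k)` equals one, the
  -- product vanishes from index `k + 1` on, so the later `χ n` vanish and the sums are exactly one.
  set χ : ℕ → E d → ℂ := fun n => ψ (e n) * ∏ m ∈ Finset.range n, (1 - ψ (e m)) with hχ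
  have hsupp : ∀ n, tsupport (χ n) ⊆ tsupport (ψ (e n)) := fun n => tsupport_mul_subset_left
  have hsum : ∀ n, ∑ m ∈ Finset.range n, χ m = 1 - ∏ m ∈ Finset.range n, (1 - ψ (e m)) := by
    intro n
    induction n with
    | zero => simp
    | succ n ih => rw [Finset.sum_range_succ, ih, Finset.prod_range_succ]; simp only [hχ]; ring
  refine ⟨χ, fun n => i (e n), fun n => (hψ _).mul (IsUltradiff.prod fun m _ => (hψ _).one_sub),
    fun n => (hc _).of_isClosed_subset (isClosed_tsupport _) (hsupp n),
    fun n => (hsupp n).trans (hsub _), fun x hx => ?_⟩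
  obtain ⟨_, ⟨k, rfl⟩, hk⟩ := hcov ⟨x, hx⟩
  have hprod : ∀ n ≥ k + 1, ∀ y ∈ V (e k), (∏ m ∈ Finset.range n, (1 - ψ (e m))) y = 0 := by
    intro n hn y hy
    rw [Finset.prod_apply]
    refine Finset.prod_eq_zero (Finset.mem_range.2 hn) ?_
    simp [hψ1 (e k) hy]
  refine ⟨V (e k), hk, k + 1, fun n hn y hy => ?_, fun n hn y hy => ?_⟩
  · simp only [hχ, Pi.mul_apply, hprod n hn y hy, mul_zero, Pi.zero_apply]
  · rw [hsum, Pi.sub_apply, hprod n hn y hy, sub_zero]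

end families

/-! ### Continuous operators on ultradifferentiable functions -/

section operators

variable {W : WeightSequence} {s : UltraType} {Ω : Opens (E d)}

/-- A local linear operator on functions of class `*` which is bounded for the seminorms, as
required by the type. -/
structure IsUltraOperator (W : WeightSequence) (s : UltraType)
    (T : (E d → ℂ) → E d → ℂ) : Prop where
  smooth : ∀ (Ω : Opens (E d)) (f : E d → ℂ), IsUltradiff W s Ω f → ContDiffOn ℝ ∞ (T f) Ω
  add : ∀ (Ω : Opens (E d)) (f g : E d → ℂ), IsUltradiff W s Ω f → IsUltradiff W s Ω g →
    Set.EqOn (T (f + g)) (T f + T g) Ω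
  smul : ∀ (Ω : Opens (E d)) (c : ℂ) (f : E d → ℂ), IsUltradiff W s Ω f →
    Set.EqOn (T (c • f)) (c • T f) Ω
  -- The constants are fixed before `Ω`, `f` and `K`, hence serve all members of a net at once. The
  -- order of the two radii follows the type: the output radius is prescribed in the Beurling case,
  -- the input radius in the Roumieu case.
  bound : match s with
    | .beurling => ∀ r > 0, ∃ r' > 0, ∃ C > 0, ∀ (Ω : Opens (E d)) (f : E d → ℂ),
        IsUltradiff W .beurling Ω f → ∀ K : Set (E d), K ⊆ Ω → ∀ B ≥ 0,
        ultraNorm W K r' f ≤ ENNReal.ofReal B → ultraNorm W K r (T f) ≤ ENNReal.ofReal (C * B)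
    | .roumieu => ∀ r' > 0, ∃ r > 0, ∃ C > 0, ∀ (Ω : Opens (E d)) (f : E d → ℂ),
        IsUltradiff W .roumieu Ω f → ∀ K : Set (E d), K ⊆ Ω → ∀ B ≥ 0,
        ultraNorm W K r' f ≤ ENNReal.ofReal B → ultraNorm W K r (T f) ≤ ENNReal.ofReal (C * B)

variable {T : (E d → ℂ) → E d → ℂ}

theorem IsUltraOperator.isUltradiff (hT : IsUltraOperator W s T) {f : E d → ℂ}
    (hf : IsUltradiff W s Ω f) : IsUltradiff W s Ω (T f) := by
  refine ⟨hT.smooth Ω f hf, ?_⟩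
  cases s
  · intro K hK hKΩ r hr
    obtain ⟨r', hr', C, hC, H⟩ := hT.bound r hr
    obtain ⟨B, hB, HB⟩ := lt_top_iff_exists.1 (hf.2 K hK hKΩ r' hr')
    exact (H Ω f hf K hKΩ B hB HB).trans_lt ENNReal.ofReal_lt_top
  · intro K hK hKΩ
    obtain ⟨r', hr', h⟩ := hf.2 K hK hKΩ
    obtain ⟨r, hr, C, hC, H⟩ := hT.bound r' hr'
    obtain ⟨B, hB, HB⟩ := lt_top_iff_exists.1 h
    exact ⟨r, hr, (H Ω f hf K hKΩ B hB HB).trans_lt ENNReal.ofReal_lt_top⟩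

theorem IsBigOZero.of_bound {N N' : Set.Ioc (0 : ℝ) 1 → ℝ≥0∞} {g : ℝ → ℝ} {C : ℝ} (hC : 0 < C)
    (h : IsBigOZero N fun ε => Real.exp (g ε))
    (hN : ∀ ε, ∀ B ≥ 0, N ε ≤ ENNReal.ofReal B → N' ε ≤ ENNReal.ofReal (C * B)) :
    IsBigOZero N' fun ε => Real.exp (g ε) := by
  obtain ⟨B, hB, e, he, H⟩ := h
  refine ⟨C * B, by positivity, e, he, fun ε hε => ?_⟩
  have := hN ε _ (by positivity) (H ε hε)
  rwa [← mul_assoc] at this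

theorem IsUltraOperator.isModerate (hT : IsUltraOperator W s T) {f : Net d}
    (hf : IsModerate W s Ω f) : IsModerate W s Ω fun ε => T (f ε) := by
  refine ⟨fun ε => hT.isUltradiff (hf.1 ε), ?_⟩
  cases s
  · intro K hK hKΩ r hr
    obtain ⟨r', hr', C, hC, H⟩ := hT.bound r hr
    obtain ⟨k, hk, h⟩ := hf.2 K hK hKΩ r' hr'
    exact ⟨k, hk, h.of_bound hC fun ε => H Ω (f ε) (hf.1 ε) K hKΩ⟩
  · intro K hK hKΩ k hk
    obtain ⟨r', hr', h⟩ := hf.2 K hK hKΩ k hk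
    obtain ⟨r, hr, C, hC, H⟩ := hT.bound r' hr'
    exact ⟨r, hr, h.of_bound hC fun ε => H Ω (f ε) (hf.1 ε) K hKΩ⟩

theorem IsUltraOperator.isNegligible (hT : IsUltraOperator W s T) {f : Net d}
    (hf : IsNegligible W s Ω f) : IsNegligible W s Ω fun ε => T (f ε) := by
  refine ⟨fun ε => hT.isUltradiff (hf.1 ε), ?_⟩
  cases s
  · intro K hK hKΩ r hr k hk
    obtain ⟨r', hr', C, hC, H⟩ := hT.bound r hr
    exact (hf.2 K hK hKΩ r' hr' k hk).of_bound hC fun ε => H Ω (f ε) (hf.1 ε) K hKΩ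
  · intro K hK hKΩ
    obtain ⟨k, hk, r', hr', h⟩ := hf.2 K hK hKΩ
    obtain ⟨r, hr, C, hC, H⟩ := hT.bound r' hr'
    exact ⟨k, hk, r, hr, h.of_bound hC fun ε => H Ω (f ε) (hf.1 ε) K hKΩ⟩

theorem cls_eq_cls_iff {f g : Net d} (hf : IsModerate W s Ω f) (hg : IsModerate W s Ω g) :
    cls W s f hf = cls W s g hg ↔ IsNegligible W s Ω (f - g) :=
  Ideal.Quotient.eq

theorem cls_congr {f g : Net d} (hf : IsModerate W s Ω f) (hg : IsModerate W s Ω g)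
    (h : ∀ ε, Set.EqOn (f ε) (g ε) Ω) : cls W s f hf = cls W s g hg :=
  (cls_eq_cls_iff hf hg).2 (isNegligible_of_eqOn_zero fun ε x hx => by
    simp [h ε hx])

theorem exists_cls (x : G W s Ω) : ∃ (f : Net d) (hf : IsModerate W s Ω f), x = cls W s f hf := by
  obtain ⟨⟨f, hf⟩, rfl⟩ := Ideal.Quotient.mk_surjective x
  exact ⟨f, hf, rfl⟩

/-- The linear map on `𝒢^*(Ω)` induced by an operator. -/
def IsUltraOperator.toLinearMap (hT : IsUltraOperator W s T) (Ω : Opens (E d)) :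
    G W s Ω →ₗ[ℂ] G W s Ω :=
  Submodule.liftQ ((negligible W s Ω).restrictScalars ℂ)
    { toFun := fun f => cls W s (fun ε => T (f.1 ε)) (hT.isModerate f.2)
      map_add' := fun f g => cls_congr _ ((hT.isModerate f.2).add (hT.isModerate g.2))
        fun ε => hT.add Ω _ _ (f.2.1 ε) (g.2.1 ε)
      map_smul' := fun c f => cls_congr _ ((moderate W s Ω).smul_mem (hT.isModerate f.2) c)
        fun ε => hT.smul Ω c _ (f.2.1 ε) }
    (fun _ hf => Ideal.Quotient.eq_zero_iff_mem.2 (hT.isNegligible hf))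

/-- Restriction keeps the same representative, a net of functions on all of `ℝ^d`, and `T` acts on
that representative; compatibility is definitional. -/
theorem IsUltraOperator.toLinearMap_res (hT : IsUltraOperator W s T) {Ω' : Opens (E d)}
    (hle : Ω' ≤ Ω) (x : G W s Ω) :
    hT.toLinearMap Ω' (res W s hle x) = res W s hle (hT.toLinearMap Ω x) := by
  obtain ⟨f, hf, rfl⟩ := exists_cls x
  rfl

/-- The sheaf morphism induced by an operator. -/
def IsUltraOperator.toHom (hT : IsUltraOperator W s T) :
    modPresheaf d W s ⟶ modPresheaf d W s where
  app Ω := ModuleCat.ofHom (hT.toLinearMap (unop Ω))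
  naturality Ω Ω' i := by
    ext x
    exact hT.toLinearMap_res (leOfHom i.unop) x

/-! ### Partial derivatives -/

theorem pderiv_smul {f : E d → ℂ} (hf : ContDiffOn ℝ ∞ f Ω) (c : ℂ) (i : Fin d) :
    Set.EqOn (pderiv i (c • f)) (c • pderiv i f) Ω := by
  intro x hx
  simp [pderiv, fderiv_const_smul (differentiableAt_of hf hx)]

theorem wderiv_smul {f : E d → ℂ} (hf : ContDiffOn ℝ ∞ f Ω) (c : ℂ) (w : List (Fin d)) :
    Set.EqOn (wderiv w (c • f)) (c • wderiv w f) Ω := by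
  induction w with
  | nil => exact fun _ _ => rfl
  | cons i w ih => exact (pderiv_congr ih i).trans (pderiv_smul (contDiffOn_wderiv hf w) c i)

/-- Condition (M.2) with second index `1` bounds `M (n + 1)` by a multiple of `H ^ (n + 1) * M n`:
one derivative costs a dilation of the radius by `H`. -/
theorem ultraNorm_pderiv_le {A H : ℝ}
    (hAH : ∀ p q, W.M (p + q) ≤ A * H ^ (p + q) * W.M p * W.M q) {f : E d → ℂ}
    (hf : ContDiffOn ℝ ∞ f Ω) {K : Set (E d)} (hK : K ⊆ Ω) {r B : ℝ} (hr : 0 < r) (hH : 0 < H)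
    (hA : 0 < A) (hB : 0 ≤ B) (h : ultraNorm W K r f ≤ ENNReal.ofReal B) (i : Fin d) :
    ultraNorm W K (r * H) (pderiv i f) ≤ ENNReal.ofReal (A * H * r * W.M 1 * B) := by
  have hM := W.pos 1
  rw [ultraNorm_le_iff_word hf hK hr hB] at h
  rw [ultraNorm_le_iff_word (contDiffOn_pderiv hf i) hK (by positivity) (by positivity)]
  intro x hx w
  have h1 := h x hx (w ++ [i])
  rw [wderiv_append, List.length_append, List.length_singleton] at h1
  refine h1.trans ?_
  calc B * (r ^ (w.length + 1) * W.M (w.length + 1))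
      ≤ B * (r ^ (w.length + 1) * (A * H ^ (w.length + 1) * W.M w.length * W.M 1)) := by
        gcongr; exact hAH _ _
    _ = _ := by rw [mul_pow]; ring

theorem isUltraOperator_pderiv (W : WeightSequence) (s : UltraType) (i : Fin d) :
    IsUltraOperator W s (pderiv i) where
  smooth Ω f hf := contDiffOn_pderiv hf.1 i
  add Ω f g hf hg := pderiv_add hf.1 hg.1 i
  smul Ω c f hf := pderiv_smul hf.1 c i
  bound := by
    obtain ⟨A, H, hA, hH, hAH⟩ := W.m2
    have hA0 : 0 < A := by linarith
    have hH0 : 0 < H := by linarith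
    have hM := W.pos 1
    cases s
    · intro r hr
      refine ⟨r / H, by positivity, A * H * (r / H) * W.M 1, by positivity,
        fun Ω f hf K hK B hB h => ?_⟩
      have := ultraNorm_pderiv_le hAH hf.1 hK (by positivity) hH0 hA0 hB h i
      rwa [div_mul_cancel₀ _ hH0.ne'] at this
    · intro r hr
      exact ⟨r * H, by positivity, A * H * r * W.M 1, by positivity,
        fun Ω f hf K hK B hB h => ultraNorm_pderiv_le hAH hf.1 hK hr hH0 hA0 hB h i⟩

/-- The partial derivative as a derivation of `𝒢^*(Ω)`. -/
def partialDerivation (W : WeightSequence) (s : UltraType) (i : Fin d) (Ω : Opens (E d)) :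
    Derivation ℂ (G W s Ω) (G W s Ω) :=
  Derivation.mk' ((isUltraOperator_pderiv W s i).toLinearMap Ω) fun x y => by
    obtain ⟨f, hf, rfl⟩ := exists_cls x
    obtain ⟨g, hg, rfl⟩ := exists_cls y
    have hf' := (isUltraOperator_pderiv W s i).isModerate hf
    have hg' := (isUltraOperator_pderiv W s i).isModerate hg
    refine cls_congr ((isUltraOperator_pderiv W s i).isModerate (hf.mul hg))
      ((hf.mul hg').add (hg.mul hf')) fun ε y hy => ?_
    refine (pderiv_mul (hf.1 ε).1 (hg.1 ε).1 i hy).trans ?_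
    simp [mul_comm]

theorem partialDerivation_cls (i : Fin d) {f : Net d} (hf : IsModerate W s Ω f) :
    partialDerivation W s i Ω (cls W s f hf) = cls W s (fun ε => pderiv i (f ε))
      ((isUltraOperator_pderiv W s i).isModerate hf) :=
  rfl

/-! ### Ultradifferential operators -/

/-- The sum over multi-indices factors into `d` geometric series; a finite set of indices is first
enclosed in a box, where the factorisation is a finite identity. -/
theorem summable_pow_order {q : ℝ} (h0 : 0 ≤ q) (h1 : q < 1) :
    Summable fun α : Fin d → ℕ => q ^ order α := by
  refine summable_of_sum_le (c := ∏ _ : Fin d, ∑' n : ℕ, q ^ n) (fun α => pow_nonneg h0 _)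
    fun u => ?_
  obtain ⟨N, hN⟩ : ∃ N, ∀ α ∈ u, ∀ i, α i < N := by
    refine ⟨u.sup (fun α => Finset.univ.sup α) + 1, fun α hα i => Nat.lt_succ_of_le ?_⟩
    exact (Finset.le_sup (f := α) (Finset.mem_univ i)).trans
      (Finset.le_sup (f := fun α : Fin d → ℕ => Finset.univ.sup α) hα)
  calc ∑ α ∈ u, q ^ order α
      ≤ ∑ α ∈ Fintype.piFinset fun _ : Fin d => Finset.range N, q ^ order α :=
        Finset.sum_le_sum_of_subset_of_nonneg
          (fun α hα => Fintype.mem_piFinset.2 fun i => Finset.mem_range.2 (hN α hα i))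
          fun α _ _ => pow_nonneg h0 _
    _ = ∏ _ : Fin d, ∑ n ∈ Finset.range N, q ^ n := by
        rw [Finset.prod_univ_sum]
        exact Finset.sum_congr rfl fun α _ => (Finset.prod_pow_eq_pow_sum _ _ _).symm
    _ ≤ _ := Finset.prod_le_prod (fun _ _ => Finset.sum_nonneg fun n _ => pow_nonneg h0 n)
        fun _ _ => (summable_geometric_of_lt_one h0 h1).sum_le_tsum _ fun n _ => pow_nonneg h0 n

theorem hasFDerivAt_wderiv {f : E d → ℂ} (hf : ContDiffOn ℝ ∞ f Ω) (w : List (Fin d)) {x : E d}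
    (hx : x ∈ Ω) : HasFDerivAt (wderiv w f) (gradForm fun i => wderiv (i :: w) f x) x := by
  have := (differentiableAt_of (contDiffOn_wderiv hf w) hx).hasFDerivAt
  rwa [eq_gradForm (fderiv ℝ (wderiv w f) x)] at this

theorem smul_gradForm (c : ℂ) (b : Fin d → ℂ) : c • gradForm b = gradForm fun i => c * b i := by
  refine ContinuousLinearMap.ext fun v => ?_
  simp [gradForm_apply, Finset.mul_sum, mul_left_comm]

theorem norm_gradForm_le (c : Fin d → ℂ) : ‖gradForm c‖ ≤ ∑ i, ‖c i‖ := by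
  refine ContinuousLinearMap.opNorm_le_bound _ (Finset.sum_nonneg fun i _ => norm_nonneg _)
    fun v => ?_
  rw [gradForm_apply, Finset.sum_mul]
  refine (norm_sum_le _ _).trans (Finset.sum_le_sum fun i _ => ?_)
  rw [norm_smul, mul_comm]
  gcongr
  exact PiLp.norm_apply_le v i

/-- The general term of the derivative of `P(D) f` along a word. -/
def ultraWordTerm (a : (Fin d → ℕ) → ℂ) (f : E d → ℂ) (w : List (Fin d)) (x : E d)
    (α : Fin d → ℕ) : ℂ :=
  a α * ((-Complex.I) ^ order α * wderiv (w ++ word α) f x)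

theorem ultraWordTerm_nil (a : (Fin d → ℕ) → ℂ) (f : E d → ℂ) (x : E d) :
    ultraWordTerm a f [] x = ultraTerm a f x := by
  funext α
  rw [ultraWordTerm, ultraTerm, mderiv_eq_wderiv, List.nil_append]

/-- (M.2) splits `M` at `|w| + |α|`; the factor at `|α|` cancels the denominator of the coefficient
bound. There remains a geometric term in `α`, times the weight in `w` for the dilated radius `r *
H`. -/
theorem norm_ultraWordTerm_le {A H : ℝ}
    (hAH : ∀ p q, W.M (p + q) ≤ A * H ^ (p + q) * W.M p * W.M q) {L C r B : ℝ}
    (hL : 0 < L) (hC : 0 < C) (hr : 0 < r) (hB : 0 ≤ B)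
    {a : (Fin d → ℕ) → ℂ} (ha : ∀ α, ‖a α‖ ≤ C * L ^ order α / W.M (order α)) {f : E d → ℂ}
    (hf : ContDiffOn ℝ ∞ f Ω) {K : Set (E d)} (hK : K ⊆ Ω)
    (h : ultraNorm W K r f ≤ ENNReal.ofReal B) {x : E d} (hx : x ∈ K) (w : List (Fin d))
    (α : Fin d → ℕ) :
    ‖ultraWordTerm a f w x α‖ ≤
      C * A * B * ((r * H) ^ w.length * W.M w.length) * (L * r * H) ^ order α := by
  rw [ultraNorm_le_iff_word hf hK hr hB] at h
  have h1 := h x hx (w ++ word α)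
  rw [List.length_append, length_word] at h1
  have hM := W.pos (order α)
  have hI : ‖(-Complex.I) ^ order α‖ = 1 := by simp
  rw [ultraWordTerm, norm_mul, norm_mul, hI, one_mul]
  calc ‖a α‖ * ‖wderiv (w ++ word α) f x‖
      ≤ (C * L ^ order α / W.M (order α)) *
        (B * (r ^ (w.length + order α) * W.M (w.length + order α))) := by
        gcongr; exact ha α
    _ ≤ (C * L ^ order α / W.M (order α)) *
        (B * (r ^ (w.length + order α) *
          (A * H ^ (w.length + order α) * W.M w.length * W.M (order α)))) := by
        gcongr; exact hAH _ _
    _ = _ := by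
        simp only [mul_pow, pow_add]
        field_simp

/-- Around each point the coefficients and the function satisfy estimates whose parameters are
small enough for `P(D) f` to converge. -/
theorem exists_local_bounds {H : ℝ} (hH : 0 < H) {a : (Fin d → ℕ) → ℂ} (ha : IsUltraCoeff W s a)
    {f : E d → ℂ} (hf : IsUltradiff W s Ω f) {K : Set (E d)} (hK : IsCompact K) (hKΩ : K ⊆ Ω) :
    ∃ L > 0, ∃ C > 0, ∃ r > 0, ∃ B ≥ 0, L * r * H < 1 ∧
      (∀ α, ‖a α‖ ≤ C * L ^ order α / W.M (order α)) ∧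
      ultraNorm W K r f ≤ ENNReal.ofReal B := by
  cases s
  -- In both types the free parameter is chosen to make `L * r * H = 1 / 2`: in the Beurling case
  -- `L` is given and `r` is free, in the Roumieu case the roles are exchanged.
  · obtain ⟨L, hL, C, hC, h⟩ := ha
    obtain ⟨B, hB, h'⟩ := lt_top_iff_exists.1
      (hf.2 K hK hKΩ (1 / (2 * L * H)) (by positivity))
    refine ⟨L, hL, C, hC, 1 / (2 * L * H), by positivity, B, hB, ?_, h, h'⟩
    field_simp
    norm_num
  · obtain ⟨r, hr, h'⟩ := hf.2 K hK hKΩ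
    obtain ⟨B, hB, h'⟩ := lt_top_iff_exists.1 h'
    obtain ⟨C, hC, h⟩ := ha (1 / (2 * r * H)) (by positivity)
    refine ⟨_, by positivity, C, hC, r, hr, B, hB, ?_, h, h'⟩
    field_simp
    norm_num

theorem summable_ultraWordTerm {a : (Fin d → ℕ) → ℂ} (ha : IsUltraCoeff W s a)
    {f : E d → ℂ} (hf : IsUltradiff W s Ω f) {K : Set (E d)} (hK : IsCompact K) (hKΩ : K ⊆ Ω)
    (w : List (Fin d)) :
    ∃ u : (Fin d → ℕ) → ℝ, Summable u ∧ ∀ x ∈ K, ∀ α, ‖ultraWordTerm a f w x α‖ ≤ u α := by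
  obtain ⟨A, H, hA, hH, hAH⟩ := W.m2
  have hH0 : 0 < H := by linarith
  obtain ⟨L, hL, C, hC, r, hr, B, hB, hlt, h, h'⟩ := exists_local_bounds hH0 ha hf hK hKΩ
  exact ⟨_, (summable_pow_order (by positivity) hlt).mul_left _, fun x hx α =>
    norm_ultraWordTerm_le hAH hL hC hr hB h hf.1 hKΩ h' hx w α⟩

theorem summable_ultraTerm {a : (Fin d → ℕ) → ℂ} (ha : IsUltraCoeff W s a)
    {f : E d → ℂ} (hf : IsUltradiff W s Ω f) {x : E d} (hx : x ∈ Ω) :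
    Summable (ultraTerm a f x) := by
  obtain ⟨u, hu, h⟩ := summable_ultraWordTerm ha hf isCompact_singleton
    (Set.singleton_subset_iff.2 hx) []
  rw [← ultraWordTerm_nil]
  exact Summable.of_norm_bounded hu (h x rfl)

/-- On a closed ball the series for all words `i :: w` have summable majorants uniform in the point,
so termwise differentiation is legitimate. Together with `smooth_of_family` this gives smoothness of
`P(D) f` and all its derivatives. -/
theorem hasFDerivAt_tsum_ultraWordTerm {a : (Fin d → ℕ) → ℂ} (ha : IsUltraCoeff W s a)
    {f : E d → ℂ} (hf : IsUltradiff W s Ω f) (w : List (Fin d)) {x : E d} (hx : x ∈ Ω) :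
    HasFDerivAt (fun y => ∑' α, ultraWordTerm a f w y α)
      (gradForm fun i => ∑' α, ultraWordTerm a f (i :: w) x α) x := by
  obtain ⟨R, hR, hRΩ⟩ := Metric.nhds_basis_closedBall.mem_iff.1 (Ω.isOpen.mem_nhds hx)
  have hK := isCompact_closedBall x R
  have hxB := Metric.mem_ball_self (x := x) hR
  choose u hu hbd using fun i => summable_ultraWordTerm ha hf hK hRΩ (i :: w)
  obtain ⟨u₀, hu₀, hbd₀⟩ := summable_ultraWordTerm ha hf hK hRΩ w
  have hsum : Summable fun α => ∑ i, u i α := summable_sum fun i _ => hu i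
  have hnorm : ∀ α, ∀ y ∈ Metric.ball x R,
      ‖gradForm fun i => ultraWordTerm a f (i :: w) y α‖ ≤ ∑ i, u i α := fun α y hy =>
    (norm_gradForm_le _).trans
      (Finset.sum_le_sum fun i _ => hbd i y (Metric.ball_subset_closedBall hy) α)
  have h1 := hasFDerivAt_tsum_of_isPreconnected (𝕜 := ℝ) hsum Metric.isOpen_ball
    (convex_ball x R).isPreconnected (f := fun α y => ultraWordTerm a f w y α)
    (f' := fun α y => gradForm fun i => ultraWordTerm a f (i :: w) y α)
    (fun α y hy => ?_) hnorm hxB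
    (Summable.of_norm_bounded hu₀ (hbd₀ x (Metric.ball_subset_closedBall hxB))) hxB
  · have hs : Summable fun α => gradForm fun i => ultraWordTerm a f (i :: w) x α :=
      Summable.of_norm_bounded hsum fun α => hnorm α x hxB
    -- The sum of linear forms is identified by its values on the basis vectors; evaluation is
    -- continuous and linear, so it passes inside the sum.
    rw [eq_gradForm (∑' α, gradForm fun i => ultraWordTerm a f (i :: w) x α)] at h1
    convert! h1 using 2
    funext i
    have := (ContinuousLinearMap.apply ℝ ℂ (EuclideanSpace.single i (1 : ℝ) : E d)).map_tsum hs
    simp only [ContinuousLinearMap.apply_apply] at this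
    rw [this]
    exact tsum_congr fun α => (gradForm_single (fun i => ultraWordTerm a f (i :: w) x α) i).symm
  · have h2 := ((hasFDerivAt_wderiv hf.1 (w ++ word α)
      (hRΩ (Metric.ball_subset_closedBall hy))).const_mul ((-Complex.I) ^ order α)).const_mul (a α)
    rw [smul_gradForm, smul_gradForm] at h2
    exact h2

theorem ultraOp_eq (a : (Fin d → ℕ) → ℂ) (f : E d → ℂ) :
    ultraOp a f = fun x => ∑' α, ultraWordTerm a f [] x α := by
  funext x
  rw [ultraOp, ultraWordTerm_nil]

theorem ultraNorm_ultraOp_le {A H : ℝ} (hA : 0 < A) (hH : 0 < H)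
    (hAH : ∀ p q, W.M (p + q) ≤ A * H ^ (p + q) * W.M p * W.M q) {L C r B : ℝ}
    (hL : 0 < L) (hC : 0 < C) (hr : 0 < r) (hB : 0 ≤ B) (hlt : L * r * H < 1)
    {a : (Fin d → ℕ) → ℂ} (ha : IsUltraCoeff W s a)
    (haL : ∀ α, ‖a α‖ ≤ C * L ^ order α / W.M (order α)) {f : E d → ℂ}
    (hf : IsUltradiff W s Ω f) {K : Set (E d)} (hK : K ⊆ Ω)
    (h : ultraNorm W K r f ≤ ENNReal.ofReal B) :
    ultraNorm W K (r * H) (ultraOp a f) ≤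
      ENNReal.ofReal (C * A * (∑' α : Fin d → ℕ, (L * r * H) ^ order α) * B) := by
  have hq : 0 ≤ L * r * H := by positivity
  have hS : 0 ≤ ∑' α : Fin d → ℕ, (L * r * H) ^ order α :=
    tsum_nonneg fun α => pow_nonneg hq _
  obtain ⟨hs, hw⟩ := smooth_of_family (Ω := Ω)
    (G := fun w x => ∑' α, ultraWordTerm a f w x α) fun w x hx =>
      hasFDerivAt_tsum_ultraWordTerm ha hf w hx
  rw [ultraOp_eq, ultraNorm_le_iff_word (hs []) hK (by positivity) (by positivity)]
  intro x hx w
  rw [hw w (hK hx)]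
  refine (tsum_of_norm_bounded ((summable_pow_order hq hlt).hasSum.mul_left _)
    fun α => norm_ultraWordTerm_le hAH hL hC hr hB haL hf.1 hK h hx w α).trans (le_of_eq ?_)
  ring

theorem isUltraOperator_ultraOp {a : (Fin d → ℕ) → ℂ} (ha : IsUltraCoeff W s a) :
    IsUltraOperator W s (ultraOp a) where
  smooth Ω f hf := by
    rw [ultraOp_eq]
    exact (smooth_of_family (G := fun w x => ∑' α, ultraWordTerm a f w x α) fun w x hx =>
      hasFDerivAt_tsum_ultraWordTerm ha hf w hx).1 []
  add Ω f g hf hg x hx := by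
    simp only [ultraOp, Pi.add_apply]
    rw [← (summable_ultraTerm ha hf hx).tsum_add (summable_ultraTerm ha hg hx)]
    refine tsum_congr fun α => ?_
    simp only [ultraTerm, mderiv_eq_wderiv]
    rw [wderiv_add hf.1 hg.1 _ hx, Pi.add_apply]
    ring
  smul Ω c f hf x hx := by
    simp only [ultraOp, Pi.smul_apply, smul_eq_mul]
    rw [← tsum_mul_left]
    refine tsum_congr fun α => ?_
    simp only [ultraTerm, mderiv_eq_wderiv]
    rw [wderiv_smul hf.1 c _ hx, Pi.smul_apply, smul_eq_mul]
    ring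
  bound := by
    obtain ⟨A, H, hA, hH, hAH⟩ := W.m2
    have hA0 : 0 < A := by linarith
    have hH0 : 0 < H := by linarith
    have hpos : ∀ q : ℝ, 0 ≤ q → q < 1 → 0 < ∑' α : Fin d → ℕ, q ^ order α := fun q h0 h1 =>
      (summable_pow_order h0 h1).tsum_pos (fun α => pow_nonneg h0 _) 0 (by simp [order])
    cases s
    · intro r hr
      obtain ⟨L, hL, C, hC, h⟩ := id ha
      -- The first bound ensures `r' * H ≤ r`, so the dilated radius stays within the prescribed
      -- one; the second makes the geometric ratio at most `1 / 2`.
      set r' := min (r / H) (1 / (2 * L * H)) with hr'_def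
      have hr' : 0 < r' := by positivity
      have hlt : L * r' * H < 1 := by
        calc L * r' * H ≤ L * (1 / (2 * L * H)) * H := by gcongr; exact min_le_right _ _
          _ < 1 := by field_simp; norm_num
      have := hpos _ (by positivity) hlt
      refine ⟨r', hr', C * A * ∑' α : Fin d → ℕ, (L * r' * H) ^ order α, by positivity,
        fun Ω f hf K hK B hB hN => (ultraNorm_anti (by positivity) ?_).trans
          (ultraNorm_ultraOp_le hA0 hH0 hAH hL hC hr' hB hlt ha h hf hK hN)⟩
      rw [← le_div_iff₀ hH0]
      exact min_le_left _ _
    · intro r hr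
      obtain ⟨C, hC, h⟩ := ha (1 / (2 * r * H)) (by positivity)
      have hlt : 1 / (2 * r * H) * r * H < 1 := by field_simp; norm_num
      have := hpos _ (by positivity) hlt
      exact ⟨r * H, by positivity,
        C * A * ∑' α : Fin d → ℕ, (1 / (2 * r * H) * r * H) ^ order α, by positivity,
        fun Ω f hf K hK B hB hN =>
          ultraNorm_ultraOp_le hA0 hH0 hAH (by positivity) hC hr hB hlt ha h hf hK hN⟩

end operators

/-! ### Gluing -/

section gluing

variable {W : WeightSequence} {s : UltraType} {Ω : Opens (E d)}

theorem IsModerate.sum {ι : Type*} {f : ι → Net d} {t : Finset ι}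
    (h : ∀ i ∈ t, IsModerate W s Ω (f i)) : IsModerate W s Ω (∑ i ∈ t, f i) :=
  (moderate W s Ω).sum_mem h

theorem IsNegligible.sum {ι : Type*} {f : ι → Net d} {t : Finset ι}
    (h : ∀ i ∈ t, IsNegligible W s Ω (f i)) : IsNegligible W s Ω (∑ i ∈ t, f i) := by
  classical
  induction t using Finset.induction_on with
  | empty => exact isNegligible_zero
  | insert i t hi ih =>
    rw [Finset.sum_insert hi]
    exact (h i (Finset.mem_insert_self _ _)).add
      (ih fun j hj => h j (Finset.mem_insert_of_mem hj))

theorem eqOn_zero_compl_tsupport (χ : E d → ℂ) (f : E d → ℂ) :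
    Set.EqOn (χ * f) 0 (⟨(tsupport χ)ᶜ, (isClosed_tsupport χ).isOpen_compl⟩ : Opens (E d)) := by
  intro x hx
  simp [image_eq_zero_of_notMem_tsupport hx]

/-- By locality it suffices to look near each point: inside `U` this is a product of moderate nets,
and a point outside `U` has the complement of the closed support as a neighbourhood on which the
product vanishes. -/
theorem IsModerate.bump_mul {χ : E d → ℂ} (hχ : IsUltradiff W .beurling ⊤ χ) {U : Opens (E d)}
    (hU : tsupport χ ⊆ U) {f : Net d} (hf : IsModerate W s U f) :
    IsModerate W s ⊤ fun ε => χ * f ε := by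
  refine IsModerate.of_locally fun x _ => ?_
  by_cases hx : x ∈ U
  · exact ⟨U, hx, (isModerate_of_beurling (hχ.mono le_top)).mul hf⟩
  · exact ⟨⟨(tsupport χ)ᶜ, (isClosed_tsupport χ).isOpen_compl⟩, fun h => hx (hU h),
      (isNegligible_of_eqOn_zero fun ε =>
      eqOn_zero_compl_tsupport χ (f ε)).isModerate⟩

theorem IsNegligible.bump_mul {χ : E d → ℂ} (hχ : IsUltradiff W .beurling ⊤ χ)
    {U : Opens (E d)} (hU : tsupport χ ⊆ U) {f : Net d} (hf : IsNegligible W s (U ⊓ Ω) f) :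
    IsNegligible W s Ω fun ε => χ * f ε := by
  refine IsNegligible.of_locally fun x hxΩ => ?_
  by_cases hx : x ∈ U
  · exact ⟨U ⊓ Ω, ⟨hx, hxΩ⟩, (isModerate_of_beurling (hχ.mono le_top)).mul_negligible hf⟩
  · exact ⟨⟨(tsupport χ)ᶜ, (isClosed_tsupport χ).isOpen_compl⟩, fun h => hx (hU h),
      isNegligible_of_eqOn_zero fun ε =>
      eqOn_zero_compl_tsupport χ (f ε)⟩

/-- With `g = ∑ χ n * f (i n)` and `∑ χ n = 1`, the difference `g - f j` is locally a finite sum of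
terms `χ n * (f (i n) - f j)`. Each is negligible on all of `U j`, since the support of `χ n` lies
in `U (i n)`. -/
theorem exists_gluing {ι : Type*} [Nonempty ι] (U : ι → Opens (E d)) (f : ι → Net d)
    (hf : ∀ i, IsModerate W s (U i) (f i))
    (hc : ∀ i j, IsNegligible W s (U i ⊓ U j) (f i - f j)) :
    ∃ g : Net d, IsModerate W s (⨆ i, U i) g ∧ ∀ i, IsNegligible W s (U i) (g - f i) := by
  obtain ⟨χ, i, hχ, -, hsub, hloc⟩ := exists_partition W U
  set g : Net d := fun ε x => ∑' n, χ n x * f (i n) ε x with hg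
  have hsum : ∀ (V : Opens (E d)) (N : ℕ), (∀ n ≥ N, Set.EqOn (χ n) 0 V) → ∀ ε,
      Set.EqOn (g ε) ((∑ n ∈ Finset.range N, fun ε => χ n * f (i n) ε : Net d) ε) V := by
    intro V N hN ε x hx
    simp only [hg, Finset.sum_apply, Pi.mul_apply]
    refine tsum_eq_sum fun n hn => ?_
    rw [hN n (by simpa using hn) hx, Pi.zero_apply, zero_mul]
  refine ⟨g, IsModerate.of_locally fun x hx => ?_, fun j => IsNegligible.of_locally fun x hx => ?_⟩
  · obtain ⟨V, hxV, N, hN, -⟩ := hloc x hx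
    exact ⟨V, hxV, (IsModerate.sum fun n _ => ((hf (i n)).bump_mul (hχ n) (hsub n)).mono
      le_top).congr (hsum V N hN)⟩
  · obtain ⟨V, hxV, N, hN, hN1⟩ := hloc x (Opens.mem_iSup.2 ⟨j, hx⟩)
    have h1 : IsNegligible W s (U j)
        (∑ n ∈ Finset.range N, fun ε => χ n * (f (i n) - f j) ε) :=
      IsNegligible.sum fun n _ => (hc (i n) j).bump_mul (hχ n) (hsub n)
    refine ⟨V ⊓ U j, ⟨hxV, hx⟩, (h1.mono inf_le_right).congr fun ε y hy => ?_⟩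
    have h2 : ∑ n ∈ Finset.range N, χ n y = 1 := by
      simpa using hN1 N le_rfl hy.1
    have h3 := hsum V N hN ε hy.1
    simp only [Finset.sum_apply, Pi.mul_apply, Pi.sub_apply, mul_sub,
      Finset.sum_sub_distrib] at h3 ⊢
    rw [h3, ← Finset.sum_mul, h2, one_mul]

end gluing

/-! ### The sheaf property -/

section sheafProperty

open Limits

/-- The forgetful functor of commutative algebras is corepresented by the polynomial ring. -/
def corepresentableForget : (forget (CommAlgCat.{0} ℂ)).CorepresentableBy
    (CommAlgCat.of ℂ (Polynomial ℂ)) where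
  homEquiv {Y} :=
    { toFun := fun f => f.hom Polynomial.X
      invFun := fun y => CommAlgCat.ofHom (Polynomial.aeval y)
      left_inv := fun f => by
        ext
        simp
      right_inv := fun y => by simp }
  homEquiv_comp g f := rfl

/-- Needed to test the sheaf condition on underlying sets, by unique gluing. -/
instance : PreservesLimits (forget (CommAlgCat.{0} ℂ)) :=
  haveI : (forget (CommAlgCat.{0} ℂ)).IsCorepresentable := corepresentableForget.isCorepresentable
  inferInstance

theorem isSheaf_algPresheaf (W : WeightSequence) (s : UltraType) :
    (algPresheaf d W s).IsSheaf := by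
  rw [TopCat.Presheaf.isSheaf_iff_isSheafUniqueGluing]
  intro ι U sf hsf
  choose f hf hfs using fun i => exists_cls (W := W) (s := s) (Ω := U i) (sf i)
  have hc : ∀ i j, IsNegligible W s (U i ⊓ U j) (f i - f j) := by
    intro i j
    have h := hsf i j
    rw [hfs i, hfs j] at h
    exact (cls_eq_cls_iff ((hf i).mono inf_le_left) ((hf j).mono inf_le_right)).1 h
  have hex : ∃ g : Net d, IsModerate W s (iSup U) g ∧ ∀ i, IsNegligible W s (U i) (g - f i) := by
    rcases isEmpty_or_nonempty ι with hι | hι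
    · exact ⟨0, isNegligible_zero.isModerate, fun i => hι.elim i⟩
    · exact exists_gluing U f hf hc
  obtain ⟨g, hg, hgf⟩ := hex
  refine ⟨cls W s g hg, fun i => ?_, fun t ht => ?_⟩
  · rw [hfs i]
    exact (cls_eq_cls_iff (hg.mono (le_iSup U i)) (hf i)).2 (hgf i)
  · obtain ⟨t, ht', rfl⟩ := exists_cls (W := W) (s := s) (Ω := iSup U) t
    refine (cls_eq_cls_iff ht' hg).2 (IsNegligible.of_locally fun x hx => ?_)
    obtain ⟨i, hi⟩ := Opens.mem_iSup.1 hx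
    refine ⟨U i, hi, ?_⟩
    have h := ht i
    rw [hfs i] at h
    have h1 := (cls_eq_cls_iff (ht'.mono (le_iSup U i)) (hf i)).1 h
    -- Reversing the equality of classes turns negligibility of `g - f i` into that of `f i - g`, to
    -- be added to `t - f i`.
    have h2 := (cls_eq_cls_iff (hf i) (hg.mono (le_iSup U i))).1
      ((cls_eq_cls_iff (hg.mono (le_iSup U i)) (hf i)).2 (hgf i)).symm
    simpa using h1.add h2

end sheafProperty

/-! ### Germs -/

section germs

variable {W : WeightSequence} {s : UltraType}

/-- An open subset of the open set `Ω`, as an open subset of `ℝ^d`. -/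
abbrev imageOpen (Ω : Opens (TopCat.of (E d))) (V : Opens ((Opens.toTopCat _).obj Ω)) :
    Opens (E d) :=
  Ω.isOpenEmbedding.isOpenMap.functor.obj V

theorem mem_imageOpen {Ω : Opens (TopCat.of (E d))} {V : Opens ((Opens.toTopCat _).obj Ω)}
    {x : (Opens.toTopCat _).obj Ω} : (x.1 : E d) ∈ imageOpen Ω V ↔ x ∈ V := by
  constructor
  · rintro ⟨y, hy, hyx⟩
    rwa [← Subtype.ext hyx]
  · exact fun hx => ⟨x, hx, rfl⟩

theorem imageOpen_mono {Ω : Opens (TopCat.of (E d))} {V V' : Opens ((Opens.toTopCat _).obj Ω)}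
    (h : V' ≤ V) : imageOpen Ω V' ≤ imageOpen Ω V :=
  Set.image_mono h

/-- The class of a moderate net as a section of the restricted presheaf. -/
def sec {Ω : Opens (TopCat.of (E d))} {V : Opens ((Opens.toTopCat _).obj Ω)} (f : Net d)
    (hf : IsModerate W s (imageOpen Ω V) f) : (restrictTo (modPresheaf d W s) Ω).obj (op V) :=
  cls W s f hf

variable {Ω : Opens (TopCat.of (E d))} {V : Opens ((Opens.toTopCat _).obj Ω)}

theorem exists_sec (x : (restrictTo (modPresheaf d W s) Ω).obj (op V)) :
    ∃ (f : Net d) (hf : IsModerate W s (imageOpen Ω V) f), x = sec f hf :=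
  exists_cls (W := W) (s := s) x

theorem map_sec {V' : Opens ((Opens.toTopCat _).obj Ω)} (i : V' ⟶ V) {f : Net d}
    (hf : IsModerate W s (imageOpen Ω V) f) :
    (restrictTo (modPresheaf d W s) Ω).map i.op (sec f hf) =
      sec f (hf.mono (imageOpen_mono (leOfHom i))) :=
  rfl

theorem sec_eq_zero_iff {f : Net d} (hf : IsModerate W s (imageOpen Ω V) f) :
    sec (W := W) (s := s) f hf = 0 ↔ IsNegligible W s (imageOpen Ω V) f :=
  Ideal.Quotient.eq_zero_iff_mem

theorem sec_eq_sec_iff {f g : Net d} (hf : IsModerate W s (imageOpen Ω V) f)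
    (hg : IsModerate W s (imageOpen Ω V) g) :
    sec (W := W) (s := s) f hf = sec g hg ↔ IsNegligible W s (imageOpen Ω V) (f - g) :=
  cls_eq_cls_iff hf hg

theorem sec_add {f g : Net d} (hf : IsModerate W s (imageOpen Ω V) f)
    (hg : IsModerate W s (imageOpen Ω V) g) :
    sec (W := W) (s := s) f hf + sec g hg = sec (f + g) (hf.add hg) :=
  rfl

/-- Translates every statement about stalks into one about nets on open subsets of `ℝ^d`.
Representatives are defined everywhere, so the neighbourhood `U` need not lie in `V` or `Ω`; it is
intersected with `V` afterwards. -/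
theorem germ_sec_eq_zero_iff {x : (Opens.toTopCat _).obj Ω} (hx : x ∈ V) {f : Net d}
    (hf : IsModerate W s (imageOpen Ω V) f) :
    (restrictTo (modPresheaf d W s) Ω).germ V x hx (sec f hf) = 0 ↔
      ∃ U : Opens (E d), (x.1 : E d) ∈ U ∧ IsNegligible W s U f := by
  constructor
  · intro h
    rw [← map_zero ((restrictTo (modPresheaf d W s) Ω).germ V x hx).hom] at h
    obtain ⟨V', hxV', iU, iV, e⟩ := TopCat.Presheaf.germ_eq _ x hx hx _ _ h
    refine ⟨imageOpen Ω V', mem_imageOpen.2 hxV', ?_⟩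
    rw [map_zero, map_sec, sec_eq_zero_iff] at e
    exact e
  · rintro ⟨U, hxU, hU⟩
    set V' : Opens ((Opens.toTopCat _).obj Ω) := V ⊓ (Opens.map Ω.inclusion').obj U with hV'
    have hxV' : x ∈ V' := ⟨hx, hxU⟩
    have hle : imageOpen Ω V' ≤ U := by
      rintro _ ⟨y, hy, rfl⟩
      exact hy.2
    rw [← TopCat.Presheaf.germ_res_apply _ (homOfLE inf_le_left : V' ⟶ V) x hxV', map_sec,
      (sec_eq_zero_iff _).2 (hU.mono hle), map_zero]

end germs

/-! ### Fineness -/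

section fine

variable {W : WeightSequence} {s : UltraType} {Ω : Opens (TopCat.of (E d))}

/-- Multiplication by a function of Beurling class, as an endomorphism of the restricted sheaf. -/
def mulHom (s : UltraType) {χ : E d → ℂ} (hχ : IsUltradiff W .beurling Ω χ) :
    restrictTo (modPresheaf d W s) Ω ⟶ restrictTo (modPresheaf d W s) Ω where
  app V := ModuleCat.ofHom (LinearMap.mulLeft ℂ (cls W s (Ω := imageOpen Ω (unop V)) (fun _ => χ)
    (isModerate_of_beurling (hχ.mono (by rintro _ ⟨y, -, rfl⟩; exact y.2)))))
  naturality V V' i := by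
    ext x
    obtain ⟨f, hf, rfl⟩ := exists_sec (V := unop V) x
    rfl

theorem isModerate_mul_of_beurling {χ : E d → ℂ} (hχ : IsUltradiff W .beurling Ω χ)
    {V : Opens ((Opens.toTopCat _).obj Ω)} {f : Net d} (hf : IsModerate W s (imageOpen Ω V) f) :
    IsModerate W s (imageOpen Ω V) fun ε => χ * f ε :=
  (isModerate_of_beurling (hχ.mono (by rintro _ ⟨y, -, rfl⟩; exact y.2))).mul hf

/-- The action of a sheaf endomorphism on the stalk. -/
abbrev stalkMap (φ : restrictTo (modPresheaf d W s) Ω ⟶ restrictTo (modPresheaf d W s) Ω)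
    (x : (Opens.toTopCat _).obj Ω) :
    (restrictTo (modPresheaf d W s) Ω).stalk x ⟶ (restrictTo (modPresheaf d W s) Ω).stalk x :=
  (TopCat.Presheaf.stalkFunctor (ModuleCat.{0} ℂ) x).map φ

theorem stalk_end_ext {x : (Opens.toTopCat _).obj Ω}
    {φ ψ : (restrictTo (modPresheaf d W s) Ω).stalk x ⟶ (restrictTo (modPresheaf d W s) Ω).stalk x}
    (h : ∀ (V : Opens ((Opens.toTopCat _).obj Ω)) (hx : x ∈ V) (f : Net d)
      (hf : IsModerate W s (imageOpen Ω V) f),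
      φ ((restrictTo (modPresheaf d W s) Ω).germ V x hx (sec f hf)) =
        ψ ((restrictTo (modPresheaf d W s) Ω).germ V x hx (sec f hf))) : φ = ψ := by
  refine TopCat.Presheaf.stalk_hom_ext _ fun V hxV => ?_
  ext y
  obtain ⟨f, hf, rfl⟩ := exists_sec y
  exact h V hxV f hf

theorem stalkMap_mulHom_germ {χ : E d → ℂ} (hχ : IsUltradiff W .beurling Ω χ)
    {x : (Opens.toTopCat _).obj Ω} {V : Opens ((Opens.toTopCat _).obj Ω)} (hx : x ∈ V) {f : Net d}
    (hf : IsModerate W s (imageOpen Ω V) f) :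
    stalkMap (mulHom s hχ) x ((restrictTo (modPresheaf d W s) Ω).germ V x hx (sec f hf)) =
      (restrictTo (modPresheaf d W s) Ω).germ V x hx (sec (fun ε => χ * f ε)
        (isModerate_mul_of_beurling hχ hf)) :=
  TopCat.Presheaf.stalkFunctor_map_germ_apply V x hx (mulHom s hχ) (sec f hf)

theorem stalkMap_mulHom_eq_zero {χ : E d → ℂ} (hχ : IsUltradiff W .beurling Ω χ)
    {x : (Opens.toTopCat _).obj Ω} {U : Opens (E d)} (hx : (x.1 : E d) ∈ U)
    (hU : Set.EqOn χ 0 U) : stalkMap (mulHom s hχ) x = 0 := by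
  refine stalk_end_ext fun V hxV f hf => ?_
  rw [stalkMap_mulHom_germ]
  exact (germ_sec_eq_zero_iff hxV _).2
    ⟨U, hx, isNegligible_of_eqOn_zero fun ε y hy => by simp [hU hy]⟩

theorem sum_stalkMap_mulHom {ι : Type*} {χ : ι → E d → ℂ}
    (hχ : ∀ i, IsUltradiff W .beurling Ω (χ i)) (t : Finset ι) {x : (Opens.toTopCat _).obj Ω}
    {V : Opens ((Opens.toTopCat _).obj Ω)} (hx : x ∈ V) {f : Net d}
    (hf : IsModerate W s (imageOpen Ω V) f) :
    (∑ i ∈ t, stalkMap (mulHom s (hχ i)) x)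
        ((restrictTo (modPresheaf d W s) Ω).germ V x hx (sec f hf)) =
      (restrictTo (modPresheaf d W s) Ω).germ V x hx (sec (fun ε => (∑ i ∈ t, χ i) * f ε)
        (isModerate_mul_of_beurling (IsUltradiff.sum fun i _ => hχ i) hf)) := by
  classical
  induction t using Finset.induction_on with
  | empty =>
    exact ((germ_sec_eq_zero_iff hx _).2
      ⟨⊤, trivial, isNegligible_of_eqOn_zero fun ε y _ => by simp⟩).symm
  | insert i t hi ih =>
    rw [Finset.sum_insert hi]
    refine Eq.trans (congrArg₂ (· + ·) (stalkMap_mulHom_germ (hχ i) hx hf) ih) ?_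
    simp only
    rw [← map_add, sec_add]
    congr 2
    funext ε
    simp [Finset.sum_insert hi, add_mul]

/-- The endomorphisms are multiplications by `X i`, the sum of the partition functions `χ n`
assigned to the index `i`. Near each point these sums are finite. -/
theorem isFine_restrictTo (W : WeightSequence) (s : UltraType) (Ω : Opens (TopCat.of (E d))) :
    IsFine (restrictTo (modPresheaf d W s) Ω) := by
  classical
  intro ι U _ hU
  rcases isEmpty_or_nonempty ι with hι | hι
  · refine ⟨fun i => hι.elim i, fun i => hι.elim i, fun x => ?_⟩
    have : x ∈ ⨆ i, U i := hU ▸ trivial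
    obtain ⟨i, -⟩ := Opens.mem_iSup.1 this
    exact hι.elim i
  obtain ⟨χ, idx, hχ, -, hsub, hloc⟩ := exists_partition W fun i => imageOpen Ω (U i)
  have hloc' : ∀ x ∈ Ω, ∃ V : Opens (E d), x ∈ V ∧ ∃ N, (∀ n ≥ N, Set.EqOn (χ n) 0 V) ∧
      ∀ n ≥ N, Set.EqOn (∑ m ∈ Finset.range n, χ m) 1 V := by
    intro x hx
    refine hloc x ?_
    have : (⟨x, hx⟩ : (Opens.toTopCat _).obj Ω) ∈ ⨆ i, U i := hU ▸ trivial
    obtain ⟨i, hi⟩ := Opens.mem_iSup.1 this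
    exact Opens.mem_iSup.2 ⟨i, mem_imageOpen.2 hi⟩
  set X : ι → E d → ℂ := fun i x => ∑' n, if idx n = i then χ n x else 0 with hX
  have hXsum : ∀ i (V : Opens (E d)) (N : ℕ), (∀ n ≥ N, Set.EqOn (χ n) 0 V) →
      Set.EqOn (X i) (∑ n ∈ Finset.range N with idx n = i, χ n) V := by
    intro i V N hN x hx
    simp only [hX, Finset.sum_apply]
    rw [Finset.sum_filter]
    refine tsum_eq_sum fun n hn => ?_
    rw [hN n (by simpa using hn) hx, Pi.zero_apply, ite_self]
  have hXu : ∀ i, IsUltradiff W .beurling Ω (X i) := fun i =>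
    IsUltradiff.of_locally fun x hx => by
      obtain ⟨V, hxV, N, hN, -⟩ := hloc' x hx
      exact ⟨V, hxV, (IsUltradiff.sum fun n _ => (hχ n).mono le_top).congr (hXsum i V N hN)⟩
  refine ⟨fun i => mulHom s (hXu i), fun i x hx => ?_, fun x => ?_⟩
  · by_contra hxU
    obtain ⟨V, hxV, N, hN, -⟩ := hloc' x.1 x.2
    -- Near a point outside `U i` only finitely many `χ n` matter, and the closed supports of those
    -- assigned to `i` miss the point; on the resulting neighbourhood `X i` vanishes, so the point
    -- is not in the closure.
    set O : Opens (E d) := V ⊓ ⟨⋂ n ∈ Finset.range N, ⋂ _ : idx n = i, (tsupport (χ n))ᶜ,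
      isOpen_biInter_finset fun n _ => isOpen_iInter_of_finite fun _ =>
        (isClosed_tsupport _).isOpen_compl⟩ with hO
    have hxO : (x.1 : E d) ∈ O := by
      refine ⟨hxV, Set.mem_iInter₂.2 fun n _ => Set.mem_iInter.2 fun hn h => hxU ?_⟩
      have := hsub n h
      rw [hn] at this
      exact mem_imageOpen.1 this
    have hXO : Set.EqOn (X i) 0 O := by
      intro y hy
      rw [hXsum i V N hN hy.1, Finset.sum_apply]
      refine Finset.sum_eq_zero fun n hn => ?_
      obtain ⟨hn1, hn2⟩ := Finset.mem_filter.1 hn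
      exact image_eq_zero_of_notMem_tsupport (Set.mem_iInter.1 (Set.mem_iInter₂.1 hy.2 n hn1) hn2)
    obtain ⟨y, hyO, hy⟩ := mem_closure_iff.1 hx ((Opens.map Ω.inclusion').obj O)
      ((Opens.map Ω.inclusion').obj O).isOpen hxO
    exact hy (stalkMap_mulHom_eq_zero (hXu i) hyO hXO)
  · obtain ⟨V, hxV, N, hN, hN1⟩ := hloc' x.1 x.2
    have hsupp : Function.support (fun i => stalkMap (mulHom s (hXu i)) x) ⊆
        ((Finset.range N).image idx : Finset ι) := by
      intro i hi
      by_contra hiN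
      refine hi (stalkMap_mulHom_eq_zero (hXu i) hxV fun y hy => ?_)
      rw [hXsum i V N hN hy, Finset.filter_false_of_mem, Finset.sum_empty]
      exact fun n hn h => hiN (Finset.mem_coe.2 (Finset.mem_image.2 ⟨n, hn, h⟩))
    refine Eq.trans (finsum_eq_sum_of_support_subset _ hsupp) ?_
    refine stalk_end_ext fun O hxO f hf => ?_
    refine (sum_stalkMap_mulHom (s := s) hXu ((Finset.range N).image idx) hxO hf).trans ?_
    refine Eq.trans ?_ (ModuleCat.id_apply _ _).symm
    refine sub_eq_zero.1 ?_
    rw [← map_sub]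
    refine (germ_sec_eq_zero_iff hxO _).2
      ⟨V, hxV, isNegligible_of_eqOn_zero fun ε z hz => ?_⟩
    -- Regrouping the finite sum of the `χ n` along the fibres of `idx` gives the sum of the `X i`.
    have h2 : ∑ i ∈ (Finset.range N).image idx, X i z = 1 := by
      have h3 := hN1 N le_rfl hz
      rw [Finset.sum_apply, ← Finset.sum_fiberwise_of_maps_to
        (fun n hn => Finset.mem_image_of_mem idx hn)] at h3
      rw [← Pi.one_apply (M := fun _ => ℂ) z, ← h3]
      refine Finset.sum_congr rfl fun i _ => ?_
      rw [hXsum i V N hN hz, Finset.sum_apply]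
    simp [Finset.sum_apply, h2]

end fine

/-! ### Suppleness -/

section supple

variable {W : WeightSequence} {s : UltraType}

theorem div_le_exp_assoc (W : WeightSequence) {t : ℝ} (ht : 0 < t) :
    t / W.M 1 ≤ Real.exp (W.assoc t) := by
  have h := le_ciSup (bddAbove_assoc W ht) 1
  rw [pow_one] at h
  rw [← Real.log_le_iff_le_exp (div_pos ht (W.pos 1))]
  exact h

/-- The term `p = 1` of the supremum already makes `exp (M (k / ε))` grow at least like a multiple
of `1 / ε`, so any fixed constant is eventually absorbed. -/
theorem exists_lt_exp_assoc (W : WeightSequence) (C : ℝ) {k : ℝ} (hk : 0 < k) :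
    ∃ e > 0, ∀ ε : Set.Ioc (0 : ℝ) 1, (ε : ℝ) < e → C < Real.exp (W.assoc (k / ε)) := by
  have hM := W.pos 1
  refine ⟨k / ((|C| + 1) * W.M 1), by positivity, fun ε hε => ?_⟩
  have hε0 := ε.2.1
  refine lt_of_lt_of_le ?_ (div_le_exp_assoc W (div_pos hk hε0))
  rw [lt_div_iff₀ (by positivity)] at hε
  rw [div_div, lt_div_iff₀ (by positivity)]
  have h1 : C < |C| + 1 := (le_abs_self C).trans_lt (lt_add_one _)
  calc C * (ε * W.M 1) ≤ (|C| + 1) * (ε * W.M 1) := by gcongr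
    _ = ε * ((|C| + 1) * W.M 1) := by ring
    _ < k := hε

/-- A sequence of functions of Beurling class can be run through so slowly, as `ε → 0`, that the
resulting net is moderate. -/
theorem exists_slow_net (W : WeightSequence) (s : UltraType) {σ : ℕ → E d → ℂ}
    (hσ : ∀ n, IsUltradiff W .beurling ⊤ (σ n)) :
    ∃ m : Set.Ioc (0 : ℝ) 1 → ℕ,
      (∀ N, ∃ e > 0, ∀ ε : Set.Ioc (0 : ℝ) 1, (ε : ℝ) < e → N ≤ m ε) ∧
      IsModerate W s ⊤ fun ε => σ (m ε) := by
  have h1 : ∀ n : ℕ, ∃ e > 0, ∀ ε : Set.Ioc (0 : ℝ) 1, (ε : ℝ) < e →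
      ultraNorm W (Metric.closedBall 0 n) (1 / (n + 1)) (σ n) ≤
        ENNReal.ofReal (Real.exp (W.assoc (1 / (n + 1) / ε))) := by
    intro n
    obtain ⟨C, hC, h⟩ := lt_top_iff_exists.1 ((hσ n).2 (Metric.closedBall 0 n)
      (isCompact_closedBall _ _) (fun _ _ => trivial) (1 / (n + 1)) (by positivity))
    obtain ⟨e, he, H⟩ := exists_lt_exp_assoc W C (k := 1 / (n + 1)) (by positivity)
    exact ⟨e, he, fun ε hε => h.trans (ENNReal.ofReal_le_ofReal (H ε hε).le)⟩
  choose e he h using h1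
  classical
  -- `m ε` is the last index whose estimate is already valid at `ε`. The cap `⌈1 / ε⌉₊` makes the
  -- maximum exist and tends to infinity, so it does not obstruct `m ε → ∞`.
  set m : Set.Ioc (0 : ℝ) 1 → ℕ := fun ε =>
    Nat.findGreatest (fun n => (ε : ℝ) < e n) ⌈1 / (ε : ℝ)⌉₊ with hm
  have hlarge : ∀ N, ∃ e' > 0, ∀ ε : Set.Ioc (0 : ℝ) 1, (ε : ℝ) < e' → N ≤ m ε := by
    intro N
    refine ⟨min (e N) (1 / (N + 1)), lt_min (he N) (by positivity), fun ε hε => ?_⟩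
    refine Nat.le_findGreatest ?_ (hε.trans_le (min_le_left _ _))
    have h2 : (ε : ℝ) < 1 / (N + 1) := hε.trans_le (min_le_right _ _)
    have hε0 := ε.2.1
    rw [lt_div_iff₀ (by positivity)] at h2
    have h3 : (N : ℝ) ≤ 1 / ε := by
      rw [le_div_iff₀ hε0]
      nlinarith
    exact_mod_cast h3.trans (Nat.le_ceil _)
  -- `Nat.findGreatest` returns `0` when no index qualifies, so the estimate for `m ε` is guaranteed
  -- only once index `0` qualifies.
  have hspec : ∀ ε : Set.Ioc (0 : ℝ) 1, (ε : ℝ) < e 0 → (ε : ℝ) < e (m ε) := fun ε hε =>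
    Nat.findGreatest_spec (P := fun n => (ε : ℝ) < e n) (Nat.zero_le _) hε
  -- At index `n` the compact set, radius and exponent are the ball of radius `n`, `1 / (n + 1)` and
  -- `1 / (n + 1)`. They eventually beat any given `K`, `r` and `k`, which covers both types at
  -- once.
  have key : ∀ K : Set (E d), IsCompact K → ∀ r > 0, ∀ k > 0,
      IsBigOZero (fun ε => ultraNorm W K r (σ (m ε))) fun ε => Real.exp (W.assoc (k / ε)) := by
    intro K hK r hr k hk
    obtain ⟨R, hR⟩ := hK.isBounded.subset_closedBall 0
    obtain ⟨N, hN⟩ := exists_nat_gt (max R (max (1 / r) (1 / k)))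
    obtain ⟨e', he', H⟩ := hlarge N
    refine ⟨1, one_pos, min e' (e 0), lt_min he' (he 0), fun ε hε => ?_⟩
    have hε0 := ε.2.1
    have hNm : (N : ℝ) ≤ m ε := by exact_mod_cast H ε (hε.trans_le (min_le_left _ _))
    have hmr : R ≤ m ε := by
      linarith [le_max_left R (max (1 / r) (1 / k))]
    have hmr' : 1 / ((m ε : ℝ) + 1) ≤ r := by
      rw [one_div_le (by positivity) hr]
      linarith [le_max_right R (max (1 / r) (1 / k)), le_max_left (1 / r) (1 / k)]
    have hmk : 1 / ((m ε : ℝ) + 1) ≤ k := by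
      rw [one_div_le (by positivity) hk]
      linarith [le_max_right R (max (1 / r) (1 / k)), le_max_right (1 / r) (1 / k)]
    rw [one_mul]
    refine (ultraNorm_mono (hR.trans (Metric.closedBall_subset_closedBall hmr))).trans
      ((ultraNorm_anti (by positivity) hmr').trans
        ((h (m ε) ε (hspec ε (hε.trans_le (min_le_right _ _)))).trans
          (ENNReal.ofReal_le_ofReal (Real.exp_le_exp.2 (assoc_mono W (by positivity) ?_)))))
    gcongr
  refine ⟨m, hlarge, fun ε => (hσ _).of_beurling, ?_⟩
  cases s
  · exact fun K hK _ r hr => ⟨1, one_pos, key K hK r hr 1 one_pos⟩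
  · exact fun K hK _ k hk => ⟨1, one_pos, key K hK 1 one_pos k hk⟩

theorem mem_sectionSupport_sec {Ω : Opens (TopCat.of (E d))}
    {V : Opens ((Opens.toTopCat _).obj Ω)} {x : (Opens.toTopCat _).obj Ω} {f : Net d}
    (hf : IsModerate W s (imageOpen Ω V) f) :
    x ∈ sectionSupport (restrictTo (modPresheaf d W s) Ω) (sec f hf) ↔
      x ∈ V ∧ ∀ U : Opens (E d), (x.1 : E d) ∈ U → ¬ IsNegligible W s U f := by
  constructor
  · rintro ⟨hx, h⟩
    exact ⟨hx, fun U hU hn => h ((germ_sec_eq_zero_iff hx hf).2 ⟨U, hU, hn⟩)⟩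
  · rintro ⟨hx, h⟩
    refine ⟨hx, fun h0 => ?_⟩
    obtain ⟨U, hU, hn⟩ := (germ_sec_eq_zero_iff hx hf).1 h0
    exact h U hU hn

/-- The partition is subordinate to `V \ Z₁` (index `false`) and `V \ Z₂` (index `true`). The slowly
truncated sum of the `false` part multiplies `f` to give `f₂`, and the remainder is `f₁`. -/
theorem isSupple_restrictTo (W : WeightSequence) (s : UltraType) (Ω : Opens (TopCat.of (E d))) :
    IsSupple (restrictTo (modPresheaf d W s) Ω) := by
  classical
  intro V Z₁ Z₂ hZ₁ hZ₂ y hy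
  obtain ⟨f, hf, rfl⟩ := exists_sec y
  set P := imageOpen Ω V with hP
  set U : Bool → Opens (E d) := fun b =>
    imageOpen Ω (V ⊓ ⟨(if b then Z₂ else Z₁)ᶜ, by
      split_ifs
      exacts [hZ₂.isOpen_compl, hZ₁.isOpen_compl]⟩) with hU
  have hmemU : ∀ (b : Bool) (x : (Opens.toTopCat _).obj Ω),
      (x.1 : E d) ∈ U b ↔ x ∈ V ∧ x ∉ if b then Z₂ else Z₁ := fun b x => mem_imageOpen
  obtain ⟨χ, idx, hχ, -, hsub, hloc⟩ := exists_partition W U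
  set σ : ℕ → E d → ℂ := fun n => ∑ k ∈ Finset.range n with idx k = false, χ k with hσ
  have hσu : ∀ n, IsUltradiff W .beurling ⊤ (σ n) := fun n => IsUltradiff.sum fun k _ => hχ k
  obtain ⟨m, hm, hmod⟩ := exists_slow_net W s hσu
  have hf₂ : IsModerate W s P fun ε => σ (m ε) * f ε := (hmod.mono le_top).mul hf
  have hf₁ : IsModerate W s P fun ε => f ε - σ (m ε) * f ε :=
    (moderate W s P).sub_mem hf hf₂
  have hneg : ∀ x ∈ V, x ∉ Z₁ → x ∉ Z₂ → ∃ O : Opens (E d), (x.1 : E d) ∈ O ∧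
      IsNegligible W s O f := by
    intro x hx h1 h2
    by_contra! h
    exact (hy ((mem_sectionSupport_sec hf).2 ⟨hx, h⟩)).elim h1 h2
  -- For `b = false` and `x ∉ Z₂`: if `x ∈ Z₁`, the supports of the `χ k` avoid `x`; otherwise `x`
  -- lies outside both sets and `f` itself is negligible nearby. The case `b = true` is symmetric.
  have hsplit : ∀ (b : Bool) (T : Finset ℕ) (x : (Opens.toTopCat _).obj Ω), x ∈ V →
      x ∉ (if b then Z₁ else Z₂) → (∀ k ∈ T, idx k = b) → ∃ O : Opens (E d), (x.1 : E d) ∈ O ∧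
        IsNegligible W s O fun ε => (∑ k ∈ T, χ k) * f ε := by
    intro b T x hxV hx hT
    by_cases hx' : x ∈ if b then Z₂ else Z₁
    · refine ⟨⟨⋂ k ∈ T, (tsupport (χ k))ᶜ, isOpen_biInter_finset fun k _ =>
        (isClosed_tsupport _).isOpen_compl⟩, ?_, isNegligible_of_eqOn_zero fun ε z hz => ?_⟩
      · refine Set.mem_iInter₂.2 fun k hk h => ?_
        have := hsub k h
        rw [hT k hk] at this
        exact ((hmemU b x).1 this).2 hx'
      · rw [Pi.mul_apply, Finset.sum_apply, Finset.sum_eq_zero fun k hk => ?_, zero_mul]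
        · rfl
        · exact image_eq_zero_of_notMem_tsupport (Set.mem_iInter₂.1 hz k hk)
    · obtain ⟨O, hxO, hO⟩ := hneg x hxV (by cases b <;> simp_all) (by cases b <;> simp_all)
      exact ⟨O, hxO, (isModerate_of_beurling ((IsUltradiff.sum fun k _ => hχ k).mono
        le_top)).mul_negligible hO⟩
  have hstab : ∀ (b : Bool) (x : (Opens.toTopCat _).obj Ω), x ∈ V →
      x ∉ (if b then Z₁ else Z₂) → ∃ O : Opens (E d), (x.1 : E d) ∈ O ∧ O ≤ P ∧ ∃ N,
        (∀ n ≥ N, Set.EqOn (χ n) 0 O) ∧ ∀ n ≥ N, Set.EqOn (∑ k ∈ Finset.range n, χ k) 1 O := by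
    intro b x hxV hx
    obtain ⟨O, hxO, N, h1, h2⟩ := hloc x.1 (Opens.mem_iSup.2 ⟨!b, (hmemU _ x).2 ⟨hxV, by
      cases b <;> simpa using hx⟩⟩)
    exact ⟨O ⊓ P, ⟨hxO, mem_imageOpen.2 hxV⟩, inf_le_right, N, fun n hn => (h1 n hn).mono
      fun _ h => h.1, fun n hn => (h2 n hn).mono fun _ h => h.1⟩
  -- Where the partition is locally finite, the truncation level no longer matters once it exceeds
  -- `N`, that is, for small `ε`.
  have hconst : ∀ (O : Opens (E d)) (N : ℕ), (∀ n ≥ N, Set.EqOn (χ n) 0 O) → ∀ n ≥ N,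
      Set.EqOn (σ n) (σ N) O := by
    intro O N hN n hn x hx
    simp only [hσ, Finset.sum_apply]
    refine (Finset.sum_subset (Finset.filter_subset_filter _ (Finset.range_mono hn))
      fun k hk hk' => hN k ?_ hx).symm
    by_contra! h
    exact hk' (Finset.mem_filter.2 ⟨Finset.mem_range.2 h, (Finset.mem_filter.1 hk).2⟩)
  refine ⟨sec _ hf₁, sec _ hf₂, ?_, fun x hx => ?_, fun x hx => ?_⟩
  · rw [sec_add]
    congr 1
    funext ε
    simp
  · obtain ⟨hxV, hx⟩ := (mem_sectionSupport_sec hf₁).1 hx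
    by_contra hxZ
    obtain ⟨O, hxO, hOP, N, hN0, hN1⟩ := hstab true x hxV (by simpa using hxZ)
    obtain ⟨O', hxO', hO'⟩ := hsplit true {k ∈ Finset.range N | idx k = true} x hxV
      (by simpa using hxZ) fun k hk => (Finset.mem_filter.1 hk).2
    obtain ⟨e, he, h⟩ := hm N
    refine hx (O ⊓ O') ⟨hxO, hxO'⟩ ((hO'.mono inf_le_right).congr_eventually
      (fun ε => (hf₁.1 ε).mono (inf_le_left.trans hOP)) he fun ε hε z hz => ?_)
    have h1 := hN1 N le_rfl hz.1
    rw [← Finset.sum_filter_add_sum_filter_not (Finset.range N) (fun k => idx k = true)] at h1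
    simp only [Bool.not_eq_true] at h1
    have h2 : (∑ k ∈ Finset.range N with idx k = true, χ k) z + σ N z = 1 := h1
    rw [Pi.sub_apply, Pi.mul_apply, hconst O N hN0 _ (h ε hε) hz.1, Pi.mul_apply,
      eq_sub_of_add_eq h2]
    ring
  · obtain ⟨hxV, hx⟩ := (mem_sectionSupport_sec hf₂).1 hx
    by_contra hxZ
    obtain ⟨O, hxO, hOP, N, hN0, hN1⟩ := hstab false x hxV (by simpa using hxZ)
    obtain ⟨O', hxO', hO'⟩ := hsplit false {k ∈ Finset.range N | idx k = false} x hxV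
      (by simpa using hxZ) fun k hk => (Finset.mem_filter.1 hk).2
    obtain ⟨e, he, h⟩ := hm N
    refine hx (O ⊓ O') ⟨hxO, hxO'⟩ ((hO'.mono inf_le_right).congr_eventually
      (fun ε => (hf₂.1 ε).mono (inf_le_left.trans hOP)) he fun ε hε z hz => ?_)
    rw [Pi.mul_apply, hconst O N hN0 _ (h ε hε) hz.1, Pi.mul_apply]

end supple

/-! ### Failure of flabbiness -/

section flabby

variable {W : WeightSequence}

theorem norm_le_of_ultraNorm_le {K : Set (E d)} {h C : ℝ} {f : E d → ℂ} (hh : 0 < h) (hC : 0 ≤ C)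
    (H : ultraNorm W K h f ≤ ENNReal.ofReal C) {x : E d} (hx : x ∈ K) : ‖f x‖ ≤ C := by
  have h1 := (ultraNorm_le_iff hh hC).1 H x hx 0
  have h0 : order (0 : Fin d → ℕ) = 0 := by simp [order]
  have hw : word (0 : Fin d → ℕ) = [] := List.length_eq_zero_iff.1 (by rw [length_word, h0])
  rwa [mderiv_eq_wderiv, hw, h0, W.zero, pow_zero, one_mul, mul_one] at h1

theorem isModerate_exp_assoc (W : WeightSequence) (U : Opens (E d)) {k : ℝ} (hk : 0 < k) :
    IsModerate W .beurling U fun ε _ => (Real.exp (W.assoc (k / ε)) : ℂ) := by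
  refine ⟨fun ε => isUltradiff_const _, fun K _ _ r hr => ⟨k, hk, 1, one_pos, 1, one_pos,
    fun ε _ => (ultraNorm_const_le _ hr).trans (ENNReal.ofReal_le_ofReal ?_)⟩⟩
  rw [Complex.norm_of_nonneg (Real.exp_nonneg _), one_mul]

/-- The slab of points whose distance to the hyperplane `{x | x j = x₀ j}`, on its right side, has
inverse between `n + 1` and `n + 2`. -/
def slab (j : Fin d) (x₀ : E d) (n : ℕ) : Opens (E d) where
  carrier := {x | 0 < x j - x₀ j ∧ 1 < (x j - x₀ j) * (n + 2) ∧ (x j - x₀ j) * (n + 1) < 1}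
  is_open' := by
    have h1 : Continuous fun x : E d => x j - x₀ j := by fun_prop
    exact (isOpen_lt continuous_const h1).and ((isOpen_lt continuous_const
      (h1.mul continuous_const)).and (isOpen_lt (h1.mul continuous_const) continuous_const))

theorem floor_inv_of_mem_slab {j : Fin d} {x₀ x : E d} {n : ℕ} (hx : x ∈ slab j x₀ n) :
    ⌊(x j - x₀ j)⁻¹⌋₊ = n + 1 := by
  obtain ⟨h0, h1, h2⟩ := hx
  rw [Nat.floor_eq_iff (inv_nonneg.2 h0.le)]
  push_cast
  constructor
  · rw [le_inv_comm₀ (by positivity) h0, ← one_div, le_div_iff₀ (by positivity)]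
    exact h2.le
  · rw [inv_lt_comm₀ h0 (by positivity), ← one_div, div_lt_iff₀ (by positivity)]
    linarith

/-- A net of constants on each slab, growing faster and faster towards the hyperplane. -/
def slabNet (W : WeightSequence) (j : Fin d) (x₀ : E d) : Net d := fun ε x =>
  (Real.exp (W.assoc ((⌊(x j - x₀ j)⁻¹⌋₊ : ℝ) / ε)) : ℂ)

theorem slabNet_apply {j : Fin d} {x₀ x : E d} {n : ℕ} (hx : x ∈ slab j x₀ n)
    (ε : Set.Ioc (0 : ℝ) 1) :
    slabNet W j x₀ ε x = (Real.exp (W.assoc (((n : ℝ) + 1) / ε)) : ℂ) := by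
  rw [slabNet, floor_inv_of_mem_slab hx, Nat.cast_add, Nat.cast_one]

theorem isModerate_slabNet (W : WeightSequence) (j : Fin d) (x₀ : E d) {U : Opens (E d)}
    (hU : ∀ x ∈ U, ∃ n, x ∈ slab j x₀ n) : IsModerate W .beurling U (slabNet W j x₀) := by
  refine IsModerate.of_locally fun x hx => ?_
  obtain ⟨n, hn⟩ := hU x hx
  exact ⟨slab j x₀ n, hn, (isModerate_exp_assoc W _ (k := n + 1) (by positivity)).congr
    fun ε y hy => slabNet_apply hy ε⟩

/-- An extension of `slabNet` would satisfy one exponent `k` on a closed ball around `x₀`. That ball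
meets slabs with `n > H * k`, where the inequality `2 M(k/ε) ≤ M(H k/ε) + log A` makes the net grow
at least like the square of the allowed bound. -/
theorem not_isFlasque_restrictTo (W : WeightSequence) (hd : 0 < d) (Ω : Opens (TopCat.of (E d)))
    (hΩ : (Ω : Set (E d)).Nonempty) : ¬ (restrictTo (modPresheaf d W .beurling) Ω).IsFlasque := by
  intro hfl
  obtain ⟨x₀, hx₀⟩ := hΩ
  set j : Fin d := ⟨0, hd⟩ with hj
  set S : Opens (E d) := ⨆ n, slab j x₀ n with hS
  set V : Opens ((Opens.toTopCat _).obj Ω) := (Opens.map Ω.inclusion').obj S with hV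
  have hVS : imageOpen Ω V ≤ S := by
    rintro _ ⟨y, hy, rfl⟩
    exact hy
  have hf : IsModerate W .beurling (imageOpen Ω V) (slabNet W j x₀) :=
    isModerate_slabNet W j x₀ fun x hx => Opens.mem_iSup.1 (hVS hx)
  have hepi := hfl.epi (homOfLE le_top : V ⟶ ⊤).op
  obtain ⟨y, hy⟩ := (ModuleCat.epi_iff_surjective _).1 hepi (sec _ hf)
  obtain ⟨g, hg, rfl⟩ := exists_sec y
  have hgf : IsNegligible W .beurling (imageOpen Ω V) (g - slabNet W j x₀) :=
    (sec_eq_sec_iff (hg.mono (imageOpen_mono le_top)) hf).1 hy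
  obtain ⟨R, hR, hRΩ⟩ := Metric.nhds_basis_closedBall.mem_iff.1 (Ω.isOpen.mem_nhds hx₀)
  have hKtop : Metric.closedBall x₀ R ⊆ imageOpen Ω ⊤ := fun x hx => ⟨⟨x, hRΩ hx⟩, trivial, rfl⟩
  obtain ⟨k, hk, C, hC, e₁, he₁, H₁⟩ := hg.2 _ (isCompact_closedBall x₀ R) hKtop 1 one_pos
  obtain ⟨A, H, hA, hH, hAH⟩ := exists_two_mul_assoc_le W
  -- Beyond `H * k` the growth on the slab is too fast; beyond `1 / R` the test point lies in the
  -- ball.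
  obtain ⟨n, hn⟩ := exists_nat_gt (max (H * k) (1 / R))
  have hn0 : (0 : ℝ) ≤ n := Nat.cast_nonneg n
  -- The inverse distance is the midpoint of the interval from `n + 1` to `n + 2`, so the point is
  -- strictly inside the slab.
  set t : ℝ := 1 / (n + 3 / 2) with ht
  have ht0 : 0 < t := by positivity
  set x : E d := x₀ + EuclideanSpace.single j t with hx
  have hxj : x j - x₀ j = t := by simp [hx]
  have hxS : x ∈ slab j x₀ n := by
    refine ⟨?_, ?_, ?_⟩ <;> rw [hxj]
    · exact ht0
    · rw [ht, one_div_mul_eq_div, lt_div_iff₀ (by positivity)]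
      linarith
    · rw [ht, one_div_mul_eq_div, div_lt_iff₀ (by positivity)]
      linarith
  have hxK : x ∈ Metric.closedBall x₀ R := by
    rw [Metric.mem_closedBall, dist_eq_norm, hx, add_sub_cancel_left, PiLp.norm_single,
      Real.norm_of_nonneg ht0.le, ht, one_div_le (by positivity) hR]
    linarith [le_max_right (H * k) (1 / R)]
  have hxV : x ∈ imageOpen Ω V :=
    ⟨⟨x, hRΩ hxK⟩, Opens.mem_iSup.2 ⟨n, hxS⟩, rfl⟩
  obtain ⟨C', hC', e₂, he₂, H₂⟩ := hgf.2 {x} isCompact_singleton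
    (Set.singleton_subset_iff.2 hxV) 1 one_pos 1 one_pos
  obtain ⟨e₃, he₃, H₃⟩ := exists_lt_exp_assoc W (A * (C + C')) hk
  -- A single `ε` below all thresholds suffices: the contradiction is numerical, at one point and
  -- one parameter.
  set e : ℝ := min 1 (min e₁ (min e₂ e₃)) / 2 with he
  have hmin : 0 < min 1 (min e₁ (min e₂ e₃)) := by positivity
  have hlt : e < min 1 (min e₁ (min e₂ e₃)) := half_lt_self hmin
  have he0 : 0 < e := half_pos hmin
  simp only [lt_min_iff] at hlt
  set ε : Set.Ioc (0 : ℝ) 1 := ⟨e, he0, hlt.1.le⟩ with hε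
  have b1 : ‖g ε x‖ ≤ C * Real.exp (W.assoc (k / e)) :=
    norm_le_of_ultraNorm_le one_pos (by positivity) (H₁ ε hlt.2.1) hxK
  have b2 : ‖(g - slabNet W j x₀) ε x‖ ≤ C' * Real.exp (-W.assoc (1 / e)) :=
    norm_le_of_ultraNorm_le one_pos (by positivity) (H₂ ε hlt.2.2.1) rfl
  have b3 : A * (C + C') < Real.exp (W.assoc (k / e)) := H₃ ε hlt.2.2.2
  have b4 : ‖slabNet W j x₀ ε x‖ = Real.exp (W.assoc (((n : ℝ) + 1) / e)) := by
    rw [slabNet_apply hxS ε, Complex.norm_of_nonneg (Real.exp_nonneg _)]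
  have b5 : ‖slabNet W j x₀ ε x‖ ≤ ‖g ε x‖ + ‖(g - slabNet W j x₀) ε x‖ := by
    have : slabNet W j x₀ ε x = g ε x - (g - slabNet W j x₀) ε x := by simp
    rw [this]
    exact norm_sub_le _ _
  have b6 : Real.exp (-W.assoc (1 / e)) ≤ 1 :=
    Real.exp_le_one_iff.2 (neg_nonpos.2 (assoc_nonneg W (by positivity)))
  have b7 : 1 ≤ Real.exp (W.assoc (k / e)) := Real.one_le_exp (assoc_nonneg W (by positivity))
  have b8 : W.assoc (H * (k / e)) ≤ W.assoc (((n : ℝ) + 1) / e) := by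
    refine assoc_mono W (by positivity) ?_
    rw [← mul_div_assoc]
    gcongr
    linarith [le_max_left (H * k) (1 / R)]
  have b9 := Real.exp_le_exp.2 ((hAH (k / e) (by positivity)).trans (add_le_add_left b8 _))
  rw [Real.exp_add, Real.exp_log (by linarith), two_mul, Real.exp_add] at b9
  set Y := Real.exp (W.assoc (k / e)) with hY
  have b10 : Real.exp (W.assoc (((n : ℝ) + 1) / e)) ≤ (C + C') * Y := by
    rw [← b4]
    have := mul_le_mul_of_nonneg_left (b6.trans b7) hC'.le
    linarith
  have hA0 : 0 < A := by linarith
  -- Combines the square growth `Y * Y ≤ exp (M ((n + 1) / e)) * A` with the bound forced by the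
  -- extension; cancelling `Y` contradicts the choice of `e₃`.
  have b11 : Y * Y ≤ A * (C + C') * Y := by nlinarith [mul_le_mul_of_nonneg_right b10 hA0.le]
  exact absurd (le_of_mul_le_mul_right b11 (by linarith)) (not_le.2 b3)

end flabby

end

end UltraGen

/-! ### Assembly of the sheaf, operator and non-flabbiness results. -/

theorem mainTheorem8 (d : ℕ) (W : WeightSequence) :
    (∀ s : UltraType,
      -- a sheaf of commutative algebras
      (algPresheaf d W s).IsSheaf ∧
      -- with commuting partial derivatives, which are derivations compatible with restrictions
      (∃ D : ∀ (_ : Fin d) (Ω : Opens (E d)), Derivation ℂ (G W s Ω) (G W s Ω),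
        (∀ (j : Fin d) (Ω : Opens (E d)) (f : Net d) (hf : IsModerate W s Ω f),
          ∃ hf' : IsModerate W s Ω (fun ε => pderiv j (f ε)),
            D j Ω (cls W s f hf) = cls W s (fun ε => pderiv j (f ε)) hf') ∧
        (∀ (j : Fin d) (Ω Ω' : Opens (E d)) (hle : Ω' ≤ Ω) (f : G W s Ω),
          D j Ω' (res W s hle f) = res W s hle (D j Ω f)) ∧
        (∀ (i j : Fin d) (Ω : Opens (E d)) (f : G W s Ω),
          D i Ω (D j Ω f) = D j Ω (D i Ω f))) ∧
      -- fine and supple on every open set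
      (∀ Ω : Opens (TopCat.of (E d)),
        IsFine (restrictTo (modPresheaf d W s) Ω) ∧
        IsSupple (restrictTo (modPresheaf d W s) Ω)) ∧
      -- ultradifferential operators are sheaf morphisms
      (∀ a : (Fin d → ℕ) → ℂ, IsUltraCoeff W s a →
        ∃ T : modPresheaf d W s ⟶ modPresheaf d W s,
          ∀ (Ω : Opens (E d)) (f : Net d) (hf : IsModerate W s Ω f),
            (∀ ε, ∀ x ∈ Ω, Summable (ultraTerm a (f ε) x)) ∧
            ∃ hf' : IsModerate W s Ω (fun ε => ultraOp a (f ε)),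
              T.app (op Ω) (cls W s f hf) = cls W s (fun ε => ultraOp a (f ε)) hf')) ∧
    -- in the Beurling case the sheaf is not flabby on any nonempty open set
    (0 < d → ∀ Ω : Opens (TopCat.of (E d)), (Ω : Set (E d)).Nonempty →
      ¬ (restrictTo (modPresheaf d W .beurling) Ω).IsFlasque) := by
  refine ⟨fun s => ⟨isSheaf_algPresheaf W s, ⟨partialDerivation W s, fun j Ω f hf =>
      ⟨_, partialDerivation_cls j hf⟩, fun j Ω Ω' hle f => ?_, fun i j Ω f => ?_⟩,
    fun Ω => ⟨isFine_restrictTo W s Ω, isSupple_restrictTo W s Ω⟩, fun a ha => ?_⟩,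
    not_isFlasque_restrictTo W⟩
  · exact (isUltraOperator_pderiv W s j).toLinearMap_res hle f
  · obtain ⟨f, hf, rfl⟩ := exists_cls f
    have hi := (isUltraOperator_pderiv W s i).isModerate hf
    have hj := (isUltraOperator_pderiv W s j).isModerate hf
    rw [partialDerivation_cls, partialDerivation_cls, partialDerivation_cls,
      partialDerivation_cls]
    exact cls_congr _ _ fun ε => pderiv_comm (hf.1 ε).1 i j
  · exact ⟨(isUltraOperator_ultraOp ha).toHom, fun Ω f hf =>
      ⟨fun ε x hx => summable_ultraTerm ha (hf.1 ε) hx,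
        (isUltraOperator_ultraOp ha).isModerate hf, rfl⟩⟩
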